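/- Let $\mathbb X$ and $\Theta$ be Polish spaces (or Borel subsets of Polish spaces) with their Borel $\sigma$-fields, let $\mu$ be a $\sigma$-finite measure on $\mathbb X$, and let $f(x\mid\theta)\ge 0$ be jointly measurable with $\int f(x\mid\theta)\,d\mu(x)=1$ for every $\theta\in\Theta$. For a probability measure $H$ on $\Theta$ put $$f_H(x)=\int_\Theta f(x\mid\theta)\,dH(\theta),\qquad dF_H=f_H\,d\mu,\qquad P_H(A\mid x)=\frac{\int_A f(x\mid\theta)\,dH(\theta)}{\int_\Theta f(x\mid\theta)\,dH(\theta)}.$$ Let $G_0$ be a probability measure on $\Theta$ and $\alpha_n\in(0,1)$ for $n\ge1$. Given observations $X_1,X_2,\dots$, define recursively, for $n\ge 1$, $$G_n(A)=(1-\alpha_n)\,G_{n-1}(A)+\alpha_n\,P_{G_{n-1}}(A\mid X_n).$$ Let $((X_n,\theta_n))_{n\ge1}$ be a process on a probability space $(\Omega,P)$ with values in $\mathbb X\times\Theta$ such that $\theta_1\sim G_0$; for every $n\ge1$, the conditional law of $\theta_{n+1}$ given $X_{1:n}=(X_1,\dots,X_n)$ is $G_n$; and for every $n\ge1$, the conditional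 law of $X_n$ given $X_{1:n-1}$ and $\theta_n$ has density $f(\cdot\mid\theta_n)$ with respect to $\mu$ (Newton's model). Then there is a random probability measure $G$ on $\Theta$ such that $G_n\to G$ weakly, $P$-a.s. For any such $G$ the following holds. (1) Suppose that $\sum_n\alpha_n=\infty$ and $\sum_n\alpha_n^2<\infty$, and let $(r_n)_{n\ge1}$ be a monotone sequence of positive numbers such that $r_n\sim\bigl(\sum_{k>n}\alpha_k^2\bigr)^{-1}$ as $n\to\infty$, $$\sqrt{r_n}\,\sup_{k\ge n}\alpha_k\to0\qquad\text{and}\qquad\sum_{k\ge1}r_k^2\,\alpha_{k+1}^4<\infty .$$ Then, for every $k\ge1$ and all measurable $A_1,\dots,A_k\subseteq\Theta$, $P$-almost surely, the (regular) conditional law of $$\sqrt{r_n}\,\bigl(G(A_1)-G_n(A_1),\dots,G(A_k)-G_n(A_k)\bigr)$$ given $X_{1:n}$ converges weakly, as $n\to\infty$, to the Gaussian law $N_k\bigl(0,C(A_1,\dots,A_k)\bigr)$, where $C(A_1,\dots,A_k)$ is the random matrix with entries $$C_{A_i,A_j}=\int_{\{x:\,f_G(x)\ne0\}}P_G(A_i\mid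 x)\,P_G(A_j\mid x)\,dF_G(x)-G(A_i)\,G(A_j),$$ and Gaussian laws with singular covariance (in particular the point mass at $0$ if the covariance is $0$) are allowed. (2) If $\alpha_n=(\alpha+n)^{-\beta}$ for all $n\ge1$, with $\alpha>0$ and $1/2<\beta\le1$, then the same conclusion holds with $r_n=(2\beta-1)\,n^{2\beta-1}$. -/

import Mathlib

open MeasureTheory ProbabilityTheory Filter Topology
open scoped ENNReal NNReal Asymptotics BoundedContinuousFunction

noncomputable section

namespace NewtonMixture

variable {𝕏 Θ Ω : Type*} [MeasurableSpace 𝕏] [MeasurableSpace Θ] [MeasurableSpace Ω]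

/-- The mixture density `f_H(x) = ∫ f(x | θ) dH(θ)`. -/
def mixDensity (f : 𝕏 → Θ → ℝ≥0) (H : Measure Θ) (x : 𝕏) : ℝ≥0∞ :=
  ∫⁻ t, (f x t : ℝ≥0∞) ∂H

/-- The mixture distribution `F_H`, with density `f_H` with respect to `μ`. -/
def mixDistrib (μ : Measure 𝕏) (f : 𝕏 → Θ → ℝ≥0) (H : Measure Θ) : Measure 𝕏 :=
  μ.withDensity (mixDensity f H)

/-- The Bayes update `P_H(A | x) = ∫_A f(x | θ) dH(θ) / ∫ f(x | θ) dH(θ)`, as a measure in `A`. -/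
def bayes (f : 𝕏 → Θ → ℝ≥0) (H : Measure Θ) (x : 𝕏) : Measure Θ :=
  (mixDensity f H x)⁻¹ • H.withDensity (fun t => (f x t : ℝ≥0∞))

/-- Newton's recursion along a sequence of observations `x 1, x 2, …` (`x 0` and `α 0` are never
used): `G_{n+1} = (1 - α_{n+1}) G_n + α_{n+1} P_{G_n}(· | x_{n+1})`. -/
def newtonMeasure (f : 𝕏 → Θ → ℝ≥0) (α : ℕ → ℝ) (G₀ : Measure Θ) (x : ℕ → 𝕏) : ℕ → Measure Θ
  | 0 => G₀
  | n + 1 => ENNReal.ofReal (1 - α (n + 1)) • newtonMeasure f α G₀ x n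
      + ENNReal.ofReal (α (n + 1)) • bayes f (newtonMeasure f α G₀ x n) (x (n + 1))

/-- The history `X_{1:n} = (X_1, …, X_n)`. -/
def history (X : ℕ → Ω → 𝕏) (n : ℕ) (ω : Ω) : Fin n → 𝕏 := fun i => X (i + 1) ω

/-- Newton's model for `((X_n, θ_n))_{n ≥ 1}` under `P`: the variable `θ_1` has law `G₀`; given
`X_{1:n}`, the variable `θ_{n+1}` has law `G_n`; given `X_{1:n}` and `θ_{n+1}`, the variable
`X_{n+1}` has density `f(· | θ_{n+1})` with respect to `μ`. -/
structure IsNewtonModel [StandardBorelSpace 𝕏] [Nonempty 𝕏] [StandardBorelSpace Θ] [Nonempty Θ]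
    (P : Measure Ω) [IsProbabilityMeasure P] (μ : Measure 𝕏) (f : 𝕏 → Θ → ℝ≥0) (α : ℕ → ℝ)
    (G₀ : Measure Θ) (X : ℕ → Ω → 𝕏) (θ : ℕ → Ω → Θ) : Prop where
  measurable_obs : ∀ n, 1 ≤ n → Measurable (X n)
  measurable_latent : ∀ n, 1 ≤ n → Measurable (θ n)
  law_latent_one : P.map (θ 1) = G₀
  latent_given_history : ∀ n, 1 ≤ n → ∀ᵐ ω ∂P,
    condDistrib (θ (n + 1)) (history X n) P (history X n ω)
      = newtonMeasure f α G₀ (fun i => X i ω) n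
  obs_given_latent : ∀ n, ∀ᵐ ω ∂P,
    condDistrib (X (n + 1)) (fun ω' => (history X n ω', θ (n + 1) ω')) P
        (history X n ω, θ (n + 1) ω)
      = μ.withDensity (fun x => (f x (θ (n + 1) ω) : ℝ≥0∞))

/-- The random probability measure `G` is the almost sure weak limit of `(G_n)`. -/
structure IsNewtonLimit [TopologicalSpace Θ] (P : Measure Ω) (f : 𝕏 → Θ → ℝ≥0) (α : ℕ → ℝ)
    (G₀ : Measure Θ) (X : ℕ → Ω → 𝕏) (G : Kernel Ω Θ) : Prop where
  isMarkovKernel : IsMarkovKernel G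
  tendsto : ∀ᵐ ω ∂P, ∀ h : Θ →ᵇ ℝ,
    Tendsto (fun n => ∫ t, h t ∂(newtonMeasure f α G₀ (fun i => X i ω) n)) atTop
      (𝓝 (∫ t, h t ∂(G ω)))

/-- The matrix with entries
`∫_{f_H ≠ 0} P_H(A_i | x) P_H(A_j | x) dF_H(x) - H(A_i) H(A_j)`. -/
def covMatrix (μ : Measure 𝕏) (f : 𝕏 → Θ → ℝ≥0) {k : ℕ} (A : Fin k → Set Θ) (H : Measure Θ) :
    Matrix (Fin k) (Fin k) ℝ :=
  Matrix.of fun i j =>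
    (∫ x in {x | mixDensity f H x ≠ 0}, (bayes f H x).real (A i) * (bayes f H x).real (A j)
      ∂(mixDistrib μ f H)) - H.real (A i) * H.real (A j)

/-- The vector `√r_n (G(A_i) - G_n(A_i))_{i ≤ k}`. -/
def scaledError (f : 𝕏 → Θ → ℝ≥0) (α : ℕ → ℝ) (G₀ : Measure Θ) (X : ℕ → Ω → 𝕏)
    (G : Kernel Ω Θ) (r : ℕ → ℝ) {k : ℕ} (A : Fin k → Set Θ) (n : ℕ) (ω : Ω) :
    EuclideanSpace ℝ (Fin k) :=
  WithLp.toLp 2 fun i => √(r n) *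
    ((G ω).real (A i) - (newtonMeasure f α G₀ (fun i => X i ω) n).real (A i))

/-- The regular conditional distribution of `V` given `Y`, evaluated at `Y ω`. -/
def condLaw {E F : Type*} [MeasurableSpace E] [StandardBorelSpace E] [Nonempty E]
    [MeasurableSpace F] (P : Measure Ω) [IsProbabilityMeasure P] (V : Ω → E) (Y : Ω → F) (ω : Ω) :
    ProbabilityMeasure E :=
  ⟨condDistrib V Y P (Y ω), inferInstance⟩

/-- The centred `k`-variate Gaussian law with covariance matrix `C`. -/
def gaussianLaw {k : ℕ} (C : Matrix (Fin k) (Fin k) ℝ) :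
    ProbabilityMeasure (EuclideanSpace ℝ (Fin k)) :=
  ⟨multivariateGaussian 0 C, inferInstance⟩

/-- For all measurable `A_1, …, A_k`, almost surely, the conditional law of
`√r_n (G(A_i) - G_n(A_i))_{i ≤ k}` given `X_{1:n}` converges weakly to `N_k(0, C(A_1, …, A_k))`. -/
def JointGaussianLimit (P : Measure Ω) [IsProbabilityMeasure P] (μ : Measure 𝕏)
    (f : 𝕏 → Θ → ℝ≥0) (α : ℕ → ℝ) (G₀ : Measure Θ) (X : ℕ → Ω → 𝕏)
    (G : Kernel Ω Θ) (r : ℕ → ℝ) : Prop :=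
  ∀ (k : ℕ) (A : Fin k → Set Θ), 1 ≤ k → (∀ i, MeasurableSet (A i)) →
    ∀ᵐ ω ∂P, Tendsto (fun n => condLaw P (scaledError f α G₀ X G r A n) (history X n) ω) atTop
      (𝓝 (gaussianLaw (covMatrix μ f A (G ω))))

end NewtonMixture

end

/-! In Newton's model the conditional law of `X_{n+1}` given the first `n` observations is the
mixture `F_{G_n}` (`IsNewtonModel.condDistrib_obs`), and the `F_{G_n}`-average of the Bayes update
is `G_n` itself. So `G_n` is a martingale of random probability measures
(`IsNewtonModel.isMeasureMartingale`). It is closed by a random measure `G`, in the sense that `∫ φ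
dG_n = E[∫ φ dG | X_{1:n}]` for every nonnegative measurable `φ` of finite mean; almost sure weak
convergence, and convergence on each fixed measurable set, follow.

For fixed `t`, the process `M_n = ∑ t_i G_n(A_i)` is a bounded martingale with increments `α_{n+1}
Y_{n+1}`, where the conditional variance of `Y_{n+1}` is the quadratic form of the covariance matrix
at `G_n`. These variances converge: for `μ`-almost every `x` the integrals `∫_A f(x|θ) dG_n`
converge too, being closed martingales for fixed `x`, and a Scheffé-type argument passes to the
limit under the integral (`tendsto_covMatrix`).

The central limit theorem is a telescoping comparison (`norm_condExp_charFun_sub_le`). With `T_k =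
∑_{j>k} α_j²` and the variance frozen at its value `q_n`, the product `exp(i s (M_k - M_n)) exp(-s²
T_k q_n / 2)` goes from the Gaussian characteristic function at `k = n` to the true one at `k = ∞`.
Up to conditionally centred terms, each step costs at most `α_{k+1}² s²` times the later oscillation
of `q` plus powers of `s` times the largest later weight. With `s² = r_n`, so that `s² T_n → 1`, and
`√r_n` times the largest later weight tending to zero, the total cost vanishes.

Null sets depend on `t`, so the convergence is obtained on a countable dense set of `t` and extended
by the uniform Lipschitz bound that bounded first moments give; Lévy's theorem concludes. Polynomial
weights then only require the asymptotics of `T_n`. -/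

namespace NewtonMixture

/-! ### Conditional expectation tools and Taylor estimates. -/

section MartingaleCLT

variable {Ω : Type*} {m m0 : MeasurableSpace Ω} {P : Measure Ω}

/-- Along a filtration, the conditional expectations of a bounded sequence that decreases to zero
tend to zero. -/
lemma tendsto_condExp_of_antitone [IsFiniteMeasure P] {F : Filtration ℕ m0} {Z : ℕ → Ω → ℝ} {C : ℝ}
    (hZm : ∀ n, StronglyMeasurable[⨆ n, F n] (Z n)) (h0 : ∀ n ω, 0 ≤ Z n ω)
    (hC : ∀ n ω, Z n ω ≤ C) (hanti : ∀ ω, Antitone fun n => Z n ω)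
    (hlim : ∀ᵐ ω ∂P, Tendsto (fun n => Z n ω) atTop (𝓝 0)) :
    ∀ᵐ ω ∂P, Tendsto (fun n => P[Z n | F n] ω) atTop (𝓝 0) := by
  have hle : ⨆ n, F n ≤ m0 := iSup_le fun n => F.le n
  have hint : ∀ n, Integrable (Z n) P := fun n =>
    Integrable.of_bound ((hZm n).mono hle).aestronglyMeasurable C
      (ae_of_all _ fun ω => by rw [Real.norm_of_nonneg (h0 n ω)]; exact hC n ω)
  -- For fixed `k ≤ n`, `E[Z_n | F_n] ≤ E[Z_k | F_n]`, and the right side tends to `Z_k` by Lévy's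
  -- upward theorem; `k` is sent to infinity last.
  have h1 : ∀ᵐ ω ∂P, ∀ k, Tendsto (fun n => P[Z k | F n] ω) atTop (𝓝 (Z k ω)) :=
    ae_all_iff.2 fun k => (hint k).tendsto_ae_condExp (hZm k)
  have h2 : ∀ᵐ ω ∂P, ∀ k n, k ≤ n → P[Z n | F n] ω ≤ P[Z k | F n] ω := by
    refine ae_all_iff.2 fun k => ae_all_iff.2 fun n => ?_
    by_cases hkn : k ≤ n
    · filter_upwards [condExp_mono (m := F n) (hint n) (hint k)
        (ae_of_all _ fun ω => hanti ω hkn)] with ω hω _ using hω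
    · exact ae_of_all _ fun ω h => absurd h hkn
  have h3 : ∀ᵐ ω ∂P, ∀ n, 0 ≤ P[Z n | F n] ω :=
    ae_all_iff.2 fun n => condExp_nonneg (ae_of_all _ fun ω => h0 n ω)
  filter_upwards [h1, h2, h3, hlim] with ω h1 h2 h3 h4
  rw [tendsto_order]
  refine ⟨fun a ha => Eventually.of_forall fun n => ha.trans_le (h3 n), fun a ha => ?_⟩
  obtain ⟨k, hk⟩ := ((tendsto_order.1 h4).2 a ha).exists
  filter_upwards [(tendsto_order.1 (h1 k)).2 a hk, eventually_ge_atTop k] with n hn hkn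
  exact (h2 k n hkn).trans_lt hn

/-- A conditional expectation bound for a telescoping sum with centred terms and small errors. -/
lemma norm_condExp_sub_le_of_telescope [IsFiniteMeasure P] {E : Type*} [NormedAddCommGroup E]
    [NormedSpace ℝ E] [CompleteSpace E] {U L : ℕ → Ω → E} {Uinf : Ω → E} {e : ℕ → ℝ} {s C : ℝ}
    {R : Ω → ℝ}
    (hUm : ∀ j, AEStronglyMeasurable (U j) P) (hUb : ∀ j, ∀ᵐ ω ∂P, ‖U j ω‖ ≤ C)
    (hlim : ∀ᵐ ω ∂P, Tendsto (fun j => U j ω) atTop (𝓝 (Uinf ω)))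
    (hLi : ∀ j, Integrable (L j) P) (hL : ∀ j, P[L j | m] =ᵐ[P] 0)
    (he : HasSum e s) (hR : Integrable R P)
    (hbound : ∀ j, ∀ᵐ ω ∂P, ‖U (j + 1) ω - U j ω - L j ω‖ ≤ e j * R ω) (hR0 : ∀ᵐ ω ∂P, 0 ≤ R ω)
    (he0 : ∀ j, 0 ≤ e j) :
    ∀ᵐ ω ∂P, ‖P[fun ω => Uinf ω - U 0 ω | m] ω‖ ≤ s * P[R | m] ω := by
  set D : ℕ → Ω → E := fun j ω => U (j + 1) ω - U j ω - L j ω with hD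
  have hUi : ∀ j, Integrable (U j) P := fun j => Integrable.of_bound (hUm j) C (hUb j)
  have hDi : ∀ j, Integrable (D j) P := fun j => ((hUi (j + 1)).sub (hUi j)).sub (hLi j)
  have hb : ∀ᵐ ω ∂P, ∀ j, ‖D j ω‖ ≤ e j * R ω := ae_all_iff.2 hbound
  have hsum : ∀ ω, HasSum (fun j => e j * R ω) (s * R ω) := fun ω => he.mul_right _
  -- The partial sums of `D` and of the increments of `U` differ by centred terms, so they have the
  -- same conditional expectations; dominated convergence transfers this to the limits.
  have key : P[fun ω => Uinf ω - U 0 ω | m] =ᵐ[P] P[fun ω => ∑' j, D j ω | m] := by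
    refine tendsto_condExp_unique (m := m) (fun k ω => U k ω - U 0 ω)
      (fun k ω => ∑ j ∈ Finset.range k, D j ω) _ _
      (fun k => (hUi k).sub (hUi 0)) (fun k => integrable_finsetSum _ fun j _ => hDi j) ?_ ?_
      (fun _ => C + C) (integrable_const _) (fun ω => s * R ω) (hR.const_mul s) ?_ ?_ ?_
    · filter_upwards [hlim] with ω hω using hω.sub_const _
    · filter_upwards [hb] with ω hω
      exact (Summable.of_norm_bounded (hsum ω).summable hω).hasSum.tendsto_sum_nat
    · intro k
      filter_upwards [hUb k, hUb 0] with ω h1 h2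
      exact (norm_sub_le _ _).trans (add_le_add h1 h2)
    · intro k
      filter_upwards [hb, hR0] with ω hω hR0
      refine (norm_sum_le _ _).trans ((Finset.sum_le_sum fun j _ => hω j).trans ?_)
      exact sum_le_hasSum _ (fun j _ => mul_nonneg (he0 j) hR0) (hsum ω)
    · intro k
      have h1 : (fun ω => U k ω - U 0 ω)
          = (fun ω => ∑ j ∈ Finset.range k, D j ω) + ∑ j ∈ Finset.range k, L j := by
        ext ω
        rw [Pi.add_apply, Finset.sum_apply, ← Finset.sum_add_distrib,
          ← Finset.sum_range_sub (fun j => U j ω)]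
        exact Finset.sum_congr rfl fun j _ => by simp [hD]
      rw [h1]
      refine (condExp_add (integrable_finsetSum _ fun j _ => hDi j)
        (integrable_finsetSum' _ fun j _ => hLi j) m).trans ?_
      have h2 := condExp_finsetSum (m := m) (s := Finset.range k) (fun j _ => hLi j)
      have h3 : ∀ᵐ ω ∂P, ∀ j, P[L j | m] ω = 0 := ae_all_iff.2 hL
      filter_upwards [h2, h3] with ω h2 h3
      rw [Pi.add_apply, h2, Finset.sum_apply, Finset.sum_eq_zero fun j _ => h3 j, add_zero]
  have hnorm : ∀ᵐ ω ∂P, ‖∑' j, D j ω‖ ≤ s * R ω := by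
    filter_upwards [hb] with ω hω using tsum_of_norm_bounded (hsum ω) hω
  have hsm : AEStronglyMeasurable (fun ω => ∑' j, D j ω) P := by
    refine aestronglyMeasurable_of_tendsto_ae atTop
      (f := fun k ω => ∑ j ∈ Finset.range k, D j ω)
      (fun k => (integrable_finsetSum _ fun j _ => hDi j).1) ?_
    filter_upwards [hb] with ω hω
    exact (Summable.of_norm_bounded (hsum ω).summable hω).hasSum.tendsto_sum_nat
  have hSi : Integrable (fun ω => ∑' j, D j ω) P := (hR.const_mul s).mono' hsm hnorm
  filter_upwards [key, norm_condExp_le (μ := P) (m := m) (fun ω => ∑' j, D j ω),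
    condExp_mono (m := m) hSi.norm (hR.const_mul s) hnorm,
    condExp_smul (μ := P) s R m] with ω h1 h2 h3 h4
  rw [h1]
  refine h2.trans (h3.trans ?_)
  have : P[fun ω => s * R ω | m] ω = s * P[R | m] ω := h4
  exact this.le

/-- A conditionally centred variable stays centred after multiplication by a bounded variable
measurable with respect to the past. -/
lemma condExp_smul_eq_zero [IsFiniteMeasure P] {E : Type*} [NormedAddCommGroup E]
    [NormedSpace ℝ E] [CompleteSpace E] {m' : MeasurableSpace Ω} (hm : m ≤ m0) (hm' : m' ≤ m)
    {W : Ω → ℝ} {ξ : Ω → E} {C : ℝ} (hW : Integrable W P)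
    (hW0 : P[W | m] =ᵐ[P] 0) (hξ : StronglyMeasurable[m] ξ) (hξb : ∀ᵐ ω ∂P, ‖ξ ω‖ ≤ C) :
    Integrable (fun ω => W ω • ξ ω) P ∧ P[fun ω => W ω • ξ ω | m'] =ᵐ[P] 0 := by
  have hi : Integrable (fun ω => W ω • ξ ω) P :=
    hW.smul_bdd C (hξ.mono hm).aestronglyMeasurable hξb
  refine ⟨hi, ?_⟩
  have h1 : P[fun ω => W ω • ξ ω | m] =ᵐ[P] 0 := by
    filter_upwards [condExp_smul_of_aestronglyMeasurable_right hW hi hξ.aestronglyMeasurable,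
      hW0] with ω h1 h2
    have : P[fun ω => W ω • ξ ω | m] ω = P[W | m] ω • ξ ω := h1
    rw [this, h2]; simp
  refine (condExp_condExp_of_le hm' hm).symm.trans ?_
  refine (condExp_congr_ae h1).trans ?_
  rw [condExp_zero]

/-- The exponential series handles `|y| ≤ 1`; for `|y| ≥ 1` the crude bound `2 + |y| + y²/2` is at
most `4|y|³`. The constant is chosen to cover both cases without a smallness condition. -/
lemma norm_exp_I_sub_taylor_le (y : ℝ) :
    ‖Complex.exp (Complex.I * y) - 1 - Complex.I * y + (y : ℂ) ^ 2 / 2‖ ≤ 4 * |y| ^ 3 := by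
  have hn : ‖Complex.I * (y : ℂ)‖ = |y| := by simp
  rcases le_total |y| 1 with h | h
  · have := Complex.exp_bound (x := Complex.I * y) (n := 3) (by rwa [hn]) (by norm_num)
    rw [hn] at this
    have h2 : Complex.exp (Complex.I * y) - 1 - Complex.I * y + (y : ℂ) ^ 2 / 2
        = Complex.exp (Complex.I * y)
          - ∑ k ∈ Finset.range 3, (Complex.I * (y : ℂ)) ^ k / (k.factorial : ℂ) := by
      simp [Finset.sum_range_succ, Nat.factorial, mul_pow]; ring
    rw [h2]
    refine this.trans ?_
    have h0 : 0 ≤ |y| ^ 3 := by positivity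
    norm_num [Nat.factorial]
    nlinarith
  · have h1 : ‖Complex.exp (Complex.I * y)‖ = 1 := by
      rw [mul_comm]; exact Complex.norm_exp_ofReal_mul_I y
    have h2 : ‖(y : ℂ) ^ 2 / 2‖ = |y| ^ 2 / 2 := by simp
    calc _ ≤ ‖Complex.exp (Complex.I * y)‖ + ‖(1 : ℂ)‖ + ‖Complex.I * (y : ℂ)‖
          + ‖(y : ℂ) ^ 2 / 2‖ :=
        (norm_add_le _ _).trans (by gcongr; exact (norm_sub_le _ _).trans (by
          gcongr; exact norm_sub_le _ _))
      _ = 2 + |y| + |y| ^ 2 / 2 := by rw [h1, h2, hn]; norm_num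
      _ ≤ 4 * |y| ^ 3 := by
        have h3 : 1 ≤ |y| ^ 3 := one_le_pow₀ h
        have h4 : |y| ≤ |y| ^ 3 := le_self_pow₀ h (by norm_num)
        have h5 : |y| ^ 2 ≤ |y| ^ 3 := pow_le_pow_right₀ h (by norm_num)
        linarith

lemma abs_exp_neg_sub_taylor_le {w : ℝ} (hw : 0 ≤ w) : |Real.exp (-w) - 1 + w| ≤ w ^ 2 := by
  rcases le_total w 1 with h | h
  · have := Real.norm_exp_sub_one_sub_id_le (x := -w) (by rw [norm_neg, Real.norm_of_nonneg hw]; exact h)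
    simpa [abs_of_nonneg hw] using this
  · have h1 : Real.exp (-w) ≤ 1 := Real.exp_le_one_iff.2 (by linarith)
    have h2 := Real.add_one_le_exp (-w)
    rw [abs_of_nonneg (by linarith)]
    nlinarith

/-- One step of the comparison between a martingale increment and a Gaussian increment. -/
lemma norm_exp_step_le {s a Y K b v w S : ℝ} (hY : |Y| ≤ K) (hs : 0 ≤ s)
    (ha : |a| ≤ b) (hv0 : 0 ≤ v) (hvK : v ≤ K ^ 2) (hvw : |v - w| ≤ S) :
    ‖Complex.exp (Complex.I * ((s * a * Y : ℝ) : ℂ)) - (Real.exp (-(s ^ 2 * a ^ 2 * v / 2)) : ℂ)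
        - (s * a * Y) • Complex.I + ((s ^ 2 * a ^ 2 * (Y ^ 2 - w) / 2 : ℝ) : ℂ)‖
      ≤ a ^ 2 * (s ^ 2 * (S + 4 * K ^ 3 * (s * b) + K ^ 4 * (s * b) ^ 2)) := by
  have hb : 0 ≤ b := (abs_nonneg a).trans ha
  have hK : 0 ≤ K := (abs_nonneg Y).trans hY
  -- The difference splits into the cubic Taylor remainder of the oscillating exponential, the
  -- quadratic remainder of the Gaussian factor, and the price `v - w` of using the frozen variance
  -- `v` instead of the current one `w`.
  have e : Complex.exp (Complex.I * ((s * a * Y : ℝ) : ℂ))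
        - (Real.exp (-(s ^ 2 * a ^ 2 * v / 2)) : ℂ)
        - (s * a * Y) • Complex.I + ((s ^ 2 * a ^ 2 * (Y ^ 2 - w) / 2 : ℝ) : ℂ)
      = (Complex.exp (Complex.I * ((s * a * Y : ℝ) : ℂ)) - 1 - Complex.I * ((s * a * Y : ℝ) : ℂ)
          + ((s * a * Y : ℝ) : ℂ) ^ 2 / 2)
        - ((Real.exp (-(s ^ 2 * a ^ 2 * v / 2)) - 1 + s ^ 2 * a ^ 2 * v / 2 : ℝ) : ℂ)
        + ((s ^ 2 * a ^ 2 * (v - w) / 2 : ℝ) : ℂ) := by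
    rw [Complex.real_smul]; push_cast; ring
  rw [e]
  have h1 := norm_exp_I_sub_taylor_le (s * a * Y)
  have h2 := abs_exp_neg_sub_taylor_le (w := s ^ 2 * a ^ 2 * v / 2) (by positivity)
  have h3 : |s * a * Y| ^ 3 ≤ a ^ 2 * (s ^ 2 * (K ^ 3 * (s * b))) := by
    have : |s * a * Y| ^ 3 = a ^ 2 * (s ^ 2 * (|Y| ^ 3 * (s * |a|))) := by
      rw [abs_mul, abs_mul, abs_of_nonneg hs, ← sq_abs a]; ring
    rw [this]; gcongr
  have h4 : (s ^ 2 * a ^ 2 * v / 2) ^ 2 ≤ a ^ 2 * (s ^ 2 * (K ^ 4 * (s * b) ^ 2)) := by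
    have : a ^ 2 ≤ b ^ 2 := sq_le_sq' (by linarith [neg_abs_le a]) ((le_abs_self a).trans ha)
    calc (s ^ 2 * a ^ 2 * v / 2) ^ 2 ≤ (s ^ 2 * a ^ 2 * v) ^ 2 := by
            gcongr; have : 0 ≤ s ^ 2 * a ^ 2 * v := by positivity
            linarith
      _ = a ^ 2 * (s ^ 2 * (v ^ 2 * (s ^ 2 * a ^ 2))) := by ring
      _ ≤ a ^ 2 * (s ^ 2 * ((K ^ 2) ^ 2 * (s ^ 2 * b ^ 2))) := by gcongr
      _ = _ := by ring
  have h5 : |s ^ 2 * a ^ 2 * (v - w) / 2| ≤ a ^ 2 * (s ^ 2 * S) := by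
    have : |s ^ 2 * a ^ 2 * (v - w) / 2| = a ^ 2 * (s ^ 2 * (|v - w| / 2)) := by
      rw [abs_div, abs_mul, abs_of_nonneg (by positivity : 0 ≤ s ^ 2 * a ^ 2), abs_two]; ring
    rw [this]; gcongr; linarith [abs_nonneg (v - w)]
  refine (norm_add_le _ _).trans ((add_le_add_left (norm_sub_le _ _) _).trans ?_)
  rw [Complex.norm_real, Complex.norm_real, Real.norm_eq_abs, Real.norm_eq_abs]
  linarith

end MartingaleCLT

/-! ### The almost sure conditional central limit theorem for weighted martingales. -/

section MartingaleCLT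

variable {Ω : Type*} {m0 : MeasurableSpace Ω} {P : Measure Ω}

/-- The tail `∑_{k > n} a_k ^ 2`. -/
noncomputable def sqTail (a : ℕ → ℝ) (n : ℕ) : ℝ := ∑' j, a (n + 1 + j) ^ 2

lemma hasSum_sqTail {a : ℕ → ℝ} (ha : Summable fun n => a n ^ 2) (n : ℕ) :
    HasSum (fun j => a (n + j + 1) ^ 2) (sqTail a n) := by
  have h : Summable fun j => a (n + 1 + j) ^ 2 := by
    simpa [add_comm] using (summable_nat_add_iff (f := fun n => a n ^ 2) (n + 1)).2 ha
  simpa [sqTail, add_right_comm] using h.hasSum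

/-- Peeling off one term is what makes the Gaussian factor in the telescoping product change by
exactly one Gaussian increment. -/
lemma sqTail_eq_add {a : ℕ → ℝ} (ha : Summable fun n => a n ^ 2) (n : ℕ) :
    sqTail a n = a (n + 1) ^ 2 + sqTail a (n + 1) := by
  have h := (hasSum_sqTail ha n)
  rw [← h.tsum_eq, h.summable.tsum_eq_zero_add, ← (hasSum_sqTail ha (n + 1)).tsum_eq]
  simp only [add_zero]
  congr 2
  ext j; congr 2; ring

lemma sqTail_nonneg (a : ℕ → ℝ) (n : ℕ) : 0 ≤ sqTail a n := tsum_nonneg fun _ => sq_nonneg _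

lemma tendsto_sqTail {a : ℕ → ℝ} : Tendsto (sqTail a) atTop (𝓝 0) := by
  have h := tendsto_sum_nat_add fun n => a n ^ 2
  refine (h.comp (tendsto_add_atTop_nat 1)).congr fun n => ?_
  simp only [Function.comp, sqTail]
  congr 1; ext j; congr 2; ring

/-- A bounded martingale `M` with increments `a_{k+1} Y_{k+1}`, where `a` is deterministic, `Y` is
bounded, and the conditional variances `q_k` of `Y_{k+1}` converge. -/
structure IsWeightedMartingale (P : Measure Ω) (F : Filtration ℕ m0) (a : ℕ → ℝ) (K : ℝ)
    (M Y q : ℕ → Ω → ℝ) (Minf qinf : Ω → ℝ) : Prop where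
  step : ∀ k ω, M (k + 1) ω = M k ω + a (k + 1) * Y (k + 1) ω
  measurable_M : ∀ k, StronglyMeasurable[F k] (M k)
  measurable_Y : ∀ k, StronglyMeasurable (Y (k + 1))
  measurable_q : ∀ k, StronglyMeasurable[F k] (q k)
  bound_M : ∀ k ω, |M k ω| ≤ K
  bound_Y : ∀ k ω, |Y (k + 1) ω| ≤ K
  bound_q : ∀ k ω, |q k ω| ≤ K ^ 2
  condExp_Y : ∀ k, P[Y (k + 1) | F k] =ᵐ[P] 0
  condExp_sq : ∀ k, P[fun ω => Y (k + 1) ω ^ 2 | F k] =ᵐ[P] q k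
  tendsto_M : ∀ᵐ ω ∂P, Tendsto (fun k => M k ω) atTop (𝓝 (Minf ω))
  tendsto_q : ∀ᵐ ω ∂P, Tendsto (fun k => q k ω) atTop (𝓝 (qinf ω))

namespace IsWeightedMartingale

variable [IsProbabilityMeasure P] {F : Filtration ℕ m0} {a : ℕ → ℝ} {K : ℝ}
    {M Y q : ℕ → Ω → ℝ} {Minf qinf : Ω → ℝ} (h : IsWeightedMartingale P F a K M Y q Minf qinf)
include h

lemma integrable_Y (k : ℕ) : Integrable (Y (k + 1)) P :=
  Integrable.of_bound (h.measurable_Y k).aestronglyMeasurable K (ae_of_all _ (h.bound_Y k))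

lemma integrable_sq (k : ℕ) : Integrable (fun ω => Y (k + 1) ω ^ 2) P :=
  Integrable.of_bound ((h.measurable_Y k).pow 2).aestronglyMeasurable (K ^ 2)
    (ae_of_all _ fun ω => by
      rw [Real.norm_eq_abs, abs_pow]; exact pow_le_pow_left₀ (abs_nonneg _) (h.bound_Y k ω) 2)

lemma integrable_q (k : ℕ) : Integrable (q k) P :=
  Integrable.of_bound ((h.measurable_q k).mono (F.le k)).aestronglyMeasurable (K ^ 2)
    (ae_of_all _ (h.bound_q k))

lemma condExp_sq_sub (k : ℕ) : P[fun ω => Y (k + 1) ω ^ 2 - q k ω | F k] =ᵐ[P] 0 := by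
  filter_upwards [condExp_sub (m := F k) (h.integrable_sq k) (h.integrable_q k),
    h.condExp_sq k] with ω h1 h2
  rw [condExp_of_stronglyMeasurable (F.le k) (h.measurable_q k) (h.integrable_q k)] at h1
  have h3 : P[fun ω => Y (k + 1) ω ^ 2 - q k ω | F k] ω
      = P[fun ω => Y (k + 1) ω ^ 2 | F k] ω - q k ω := h1
  rw [h3, h2]; simp

omit [IsProbabilityMeasure P] in
lemma q_nonneg : ∀ᵐ ω ∂P, ∀ k, 0 ≤ q k ω := by
  refine ae_all_iff.2 fun k => ?_
  filter_upwards [h.condExp_sq k, condExp_nonneg (μ := P) (m := F k)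
    (f := fun ω => Y (k + 1) ω ^ 2) (ae_of_all _ fun ω => sq_nonneg _)] with ω h1 h2
  rw [← h1]; exact h2

/-- The conditional second moment of `M_∞ - M_n` is controlled by the tail of `a ^ 2`. -/
lemma condExp_sq_le (ha : Summable fun n => a n ^ 2) (n : ℕ) :
    ∀ᵐ ω ∂P, P[fun ω => (Minf ω - M n ω) ^ 2 | F n] ω ≤ K ^ 2 * sqTail a n := by
  have hMm : ∀ k, StronglyMeasurable (M k) := fun k => (h.measurable_M k).mono (F.le k)
  have hL := fun j => condExp_smul_eq_zero (P := P) (m := F (n + j)) (m' := F n) (F.le _)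
    (F.mono (Nat.le_add_right n j)) (h.integrable_Y (n + j)) (h.condExp_Y (n + j))
    (ξ := fun ω => 2 * a (n + j + 1) * (M (n + j) ω - M n ω)) (C := |2 * a (n + j + 1)| * (K + K))
    (((h.measurable_M _).sub
      ((h.measurable_M n).mono (F.mono (Nat.le_add_right n j)))).const_mul _)
    (ae_of_all _ fun ω => by
      rw [norm_mul, Real.norm_eq_abs, Real.norm_eq_abs]
      gcongr
      exact (abs_sub _ _).trans (add_le_add (h.bound_M _ _) (h.bound_M _ _)))
  -- Squares telescope: the cross term `2 a Y (M_{n+j} - M_n)` is conditionally centred, and what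
  -- remains is `a² Y² ≤ a² K²`.
  have key := norm_condExp_sub_le_of_telescope (P := P) (m := F n)
    (U := fun j ω => (M (n + j) ω - M n ω) ^ 2) (Uinf := fun ω => (Minf ω - M n ω) ^ 2)
    (L := fun j ω => Y (n + j + 1) ω • (2 * a (n + j + 1) * (M (n + j) ω - M n ω)))
    (C := (K + K) ^ 2) (R := fun _ => K ^ 2) (e := fun j => a (n + j + 1) ^ 2)
    (s := sqTail a n) (fun j => (((hMm _).sub (hMm n)).pow 2).aestronglyMeasurable)
    (fun j => ae_of_all _ fun ω => by
      rw [Real.norm_eq_abs, abs_pow]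
      refine pow_le_pow_left₀ (abs_nonneg _) ?_ 2
      exact (abs_sub _ _).trans (add_le_add (h.bound_M _ _) (h.bound_M _ _)))
    (by
      filter_upwards [h.tendsto_M] with ω hω
      exact (((hω.comp (tendsto_add_atTop_nat n)).congr fun j => by
        simp [add_comm]).sub_const _).pow 2)
    (fun j => (hL j).1) (fun j => (hL j).2) (hasSum_sqTail ha n) (integrable_const _)
    (fun j => ae_of_all _ fun ω => by
      have : (M (n + (j + 1)) ω - M n ω) ^ 2 - (M (n + j) ω - M n ω) ^ 2
          - Y (n + j + 1) ω • (2 * a (n + j + 1) * (M (n + j) ω - M n ω))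
          = a (n + j + 1) ^ 2 * |Y (n + j + 1) ω| ^ 2 := by
        rw [← add_assoc, h.step, smul_eq_mul, sq_abs]; ring
      rw [this, Real.norm_of_nonneg (by positivity)]
      gcongr
      exact h.bound_Y _ ω)
    (ae_of_all _ fun _ => sq_nonneg K) (fun j => sq_nonneg _)
  filter_upwards [key] with ω hω
  simp only [add_zero, sub_self, ne_eq, OfNat.ofNat_ne_zero, not_false_eq_true, zero_pow, sub_zero,
    condExp_const (F.le n)] at hω
  rw [mul_comm]
  exact (le_abs_self _).trans hω

omit [IsProbabilityMeasure P] in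
/-- The oscillation of the conditional variances after time `n`. -/
lemma exists_osc : ∃ S : ℕ → Ω → ℝ, (∀ n, StronglyMeasurable[⨆ n, F n] (S n)) ∧
    (∀ n ω, 0 ≤ S n ω) ∧ (∀ n ω, S n ω ≤ 2 * K ^ 2) ∧ (∀ ω, Antitone fun n => S n ω) ∧
    (∀ᵐ ω ∂P, Tendsto (fun n => S n ω) atTop (𝓝 0)) ∧
    ∀ n j ω, |q n ω - q (n + j) ω| ≤ S n ω := by
  have hb : ∀ i j ω, |q i ω - q j ω| ≤ 2 * K ^ 2 := fun i j ω =>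
    (abs_sub _ _).trans (by linarith [h.bound_q i ω, h.bound_q j ω])
  have hbdd : ∀ n ω, BddAbove (Set.range fun p : ℕ × ℕ => |q (n + p.1) ω - q (n + p.2) ω|) :=
    fun n ω => ⟨2 * K ^ 2, by rintro _ ⟨p, rfl⟩; exact hb _ _ ω⟩
  -- The supremum runs over all pairs of later times, not only over pairs containing `n`; this makes
  -- the oscillation antitone in `n`.
  refine ⟨fun n ω => ⨆ p : ℕ × ℕ, |q (n + p.1) ω - q (n + p.2) ω|, fun n => ?_, fun n ω => ?_,
    fun n ω => ciSup_le fun p => hb _ _ ω, fun ω n k hnk => ?_, ?_, fun n j ω => ?_⟩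
  · refine Measurable.stronglyMeasurable (Measurable.iSup fun p => ?_)
    have h1 : ∀ k, Measurable[⨆ n, F n] (q k) := fun k =>
      ((h.measurable_q k).mono (le_iSup (fun n => F n) k)).measurable
    exact measurable_abs.comp ((h1 _).sub (h1 _))
  · exact (abs_nonneg _).trans (le_ciSup (hbdd n ω) (0, 0))
  · refine ciSup_le fun p => ?_
    have := le_ciSup (hbdd n ω) (k - n + p.1, k - n + p.2)
    simpa [← add_assoc, Nat.add_sub_cancel' hnk] using this
  · filter_upwards [h.tendsto_q] with ω hω
    rw [Metric.tendsto_atTop] at hω ⊢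
    intro ε hε
    obtain ⟨N, hN⟩ := hω (ε / 4) (by linarith)
    refine ⟨N, fun n hn => ?_⟩
    have h2 : (⨆ p : ℕ × ℕ, |q (n + p.1) ω - q (n + p.2) ω|) ≤ ε / 2 := by
      refine ciSup_le fun p => ?_
      have h3 := hN (n + p.1) (by omega)
      have h4 := hN (n + p.2) (by omega)
      rw [Real.dist_eq] at h3 h4
      rw [abs_lt] at h3 h4
      rw [abs_le]; constructor <;> linarith
    rw [Real.dist_eq, sub_zero,
      abs_of_nonneg ((abs_nonneg _).trans (le_ciSup (hbdd n ω) (0, 0)))]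
    linarith
  · simpa using le_ciSup (hbdd n ω) (0, j)

/-- The conditional characteristic function of `M_∞ - M_n` is close to a Gaussian one. -/
lemma norm_condExp_charFun_sub_le (ha : Summable fun n => a n ^ 2) {S : ℕ → Ω → ℝ} (n : ℕ)
    (hSi : Integrable (S n) P)
    (hSq : ∀ j ω, |q n ω - q (n + j) ω| ≤ S n ω) {s b : ℝ} (hs : 0 ≤ s)
    (hb : ∀ j, |a (n + j + 1)| ≤ b) :
    ∀ᵐ ω ∂P, ‖P[fun ω => Complex.exp (Complex.I * ((s * (Minf ω - M n ω) : ℝ) : ℂ)) | F n] ω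
        - (Real.exp (-(s ^ 2 * sqTail a n * q n ω / 2)) : ℂ)‖
      ≤ s ^ 2 * sqTail a n
        * (P[S n | F n] ω + (4 * K ^ 3 * (s * b) + K ^ 4 * (s * b) ^ 2)) := by
  have hb0 : 0 ≤ b := (abs_nonneg _).trans (hb 0)
  have hMm : ∀ k, StronglyMeasurable (M k) := fun k => (h.measurable_M k).mono (F.le k)
  have hK : ∀ ω, 0 ≤ K := fun ω => (abs_nonneg _).trans (h.bound_M 0 ω)
  set c : ℝ := 4 * K ^ 3 * (s * b) + K ^ 4 * (s * b) ^ 2 with hc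
  -- `G j * V j` interpolates between the Gaussian characteristic function (`j = 0`, where `G 0 =
  -- 1`) and the true one (`j → ∞`, where `V j → 1`). Freezing the variance at `q n` keeps every `V
  -- j` measurable at time `n`, so `ξ j = G j * V (j + 1)` belongs to the past of `Y (n + j + 1)`.
  set G : ℕ → Ω → ℂ := fun j ω => Complex.exp (Complex.I * ((s * (M (n + j) ω - M n ω) : ℝ) : ℂ))
    with hG
  set V : ℕ → Ω → ℂ := fun j ω => (Real.exp (-(s ^ 2 * sqTail a (n + j) * q n ω / 2)) : ℂ) with hV
  set ξ : ℕ → Ω → ℂ := fun j ω => G j ω * V (j + 1) ω with hξ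
  have hGm : ∀ j, StronglyMeasurable[F (n + j)] (G j) := fun j => by
    have h1 : StronglyMeasurable[F (n + j)] fun ω => s * (M (n + j) ω - M n ω) :=
      ((h.measurable_M _).sub
        ((h.measurable_M n).mono (F.mono (Nat.le_add_right n j)))).const_mul s
    exact (show Continuous fun x : ℝ => Complex.exp (Complex.I * (x : ℂ)) by
      fun_prop).comp_stronglyMeasurable h1
  have hVm : ∀ j, StronglyMeasurable[F n] (V j) := fun j =>
    (show Continuous fun x : ℝ => (Real.exp (-(s ^ 2 * sqTail a (n + j) * x / 2)) : ℂ) by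
      fun_prop).comp_stronglyMeasurable (h.measurable_q n)
  have hξm : ∀ j, StronglyMeasurable[F (n + j)] (ξ j) := fun j =>
    (hGm j).mul ((hVm (j + 1)).mono (F.mono (Nat.le_add_right n j)))
  have hGn : ∀ j ω, ‖G j ω‖ = 1 := fun j ω => by
    simp only [hG]; rw [mul_comm]; exact Complex.norm_exp_ofReal_mul_I _
  have hVn : ∀ᵐ ω ∂P, ∀ j, ‖V j ω‖ ≤ 1 := by
    filter_upwards [h.q_nonneg] with ω hω j
    simp only [hV]
    rw [Complex.norm_real, Real.norm_of_nonneg (Real.exp_pos _).le, Real.exp_le_one_iff]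
    have := mul_nonneg (mul_nonneg (sq_nonneg s) (sqTail_nonneg a (n + j))) (hω n)
    linarith
  have hξn : ∀ j, ∀ᵐ ω ∂P, ‖ξ j ω‖ ≤ 1 := fun j => by
    filter_upwards [hVn] with ω hω
    simp only [hξ]; rw [norm_mul, hGn, one_mul]; exact hω _
  -- Two centred corrections: the first-order term in `Y`, and the second-order term with `Y²`
  -- compensated by its conditional mean `q (n + j)`.
  have hL1 := fun j => condExp_smul_eq_zero (P := P) (m := F (n + j)) (m' := F n) (F.le _)
    (F.mono (Nat.le_add_right n j)) (h.integrable_Y (n + j)) (h.condExp_Y (n + j))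
    (ξ := fun ω => (s * a (n + j + 1)) • (Complex.I * ξ j ω)) (C := |s * a (n + j + 1)| * 1)
    (((hξm j).const_mul Complex.I).fun_const_smul (s * a (n + j + 1)))
    (by filter_upwards [hξn j] with ω hω
        rw [norm_smul, norm_mul Complex.I, Complex.norm_I, one_mul, Real.norm_eq_abs]; gcongr)
  have hL2 := fun j => condExp_smul_eq_zero (P := P) (m := F (n + j)) (m' := F n)
    (W := fun ω => Y (n + j + 1) ω ^ 2 - q (n + j) ω) (F.le _)
    (F.mono (Nat.le_add_right n j)) ((h.integrable_sq (n + j)).sub (h.integrable_q (n + j)))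
    (h.condExp_sq_sub (n + j))
    (ξ := fun ω => (-(s ^ 2 * a (n + j + 1) ^ 2 / 2)) • ξ j ω)
    (C := |-(s ^ 2 * a (n + j + 1) ^ 2 / 2)| * 1)
    ((hξm j).fun_const_smul (-(s ^ 2 * a (n + j + 1) ^ 2 / 2)))
    (by filter_upwards [hξn j] with ω hω
        rw [norm_smul, Real.norm_eq_abs]; gcongr)
  have hRi : Integrable (fun ω => s ^ 2 * (S n ω + c)) P :=
    (hSi.add (integrable_const c)).const_mul _
  have key := norm_condExp_sub_le_of_telescope (P := P) (m := F n)
    (U := fun j ω => G j ω * V j ω)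
    (Uinf := fun ω => Complex.exp (Complex.I * ((s * (Minf ω - M n ω) : ℝ) : ℂ)))
    (L := fun j => (fun ω => Y (n + j + 1) ω • ((s * a (n + j + 1)) • (Complex.I * ξ j ω)))
      + fun ω => (Y (n + j + 1) ω ^ 2 - q (n + j) ω) • ((-(s ^ 2 * a (n + j + 1) ^ 2 / 2)) • ξ j ω))
    (C := 1) (R := fun ω => s ^ 2 * (S n ω + c))
    (e := fun j => a (n + j + 1) ^ 2)
    (s := sqTail a n)
    (fun j => (((hGm j).mono (F.le _)).mul ((hVm j).mono (F.le _))).aestronglyMeasurable)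
    (fun j => by
      filter_upwards [hVn] with ω hω
      rw [norm_mul, hGn, one_mul]; exact hω j)
    (by
      filter_upwards [h.tendsto_M] with ω hω
      have h1 : Tendsto (fun j => G j ω) atTop
          (𝓝 (Complex.exp (Complex.I * ((s * (Minf ω - M n ω) : ℝ) : ℂ)))) := by
        refine ((show Continuous fun x : ℝ =>
          Complex.exp (Complex.I * ((s * (x - M n ω) : ℝ) : ℂ)) by fun_prop).tendsto _).comp
          (((hω.comp (tendsto_add_atTop_nat n))).congr fun j => by simp [add_comm])
      have h2 : Tendsto (fun j => V j ω) atTop (𝓝 1) := by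
        have h3 : Tendsto (fun j => sqTail a (n + j)) atTop (𝓝 0) :=
          ((tendsto_sqTail (a := a)).comp (tendsto_add_atTop_nat n)).congr fun j => by simp [add_comm]
        have := ((show Continuous fun x : ℝ => (Real.exp (-(s ^ 2 * x * q n ω / 2)) : ℂ) by
          fun_prop).tendsto 0).comp h3
        simpa [hV, Function.comp_def] using this
      simpa using h1.mul h2)
    (fun j => (hL1 j).1.add (hL2 j).1)
    (fun j => by
      filter_upwards [condExp_add (hL1 j).1 (hL2 j).1 (F n), (hL1 j).2, (hL2 j).2] with ω h1 h2 h3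
      rw [h1, Pi.add_apply, h2]
      simpa using h3)
    (hasSum_sqTail ha n) hRi
    (fun j => by
      filter_upwards [hξn j, h.q_nonneg] with ω h1 h2
      have e1 : G (j + 1) ω = G j ω
          * Complex.exp (Complex.I * ((s * a (n + j + 1) * Y (n + j + 1) ω : ℝ) : ℂ)) := by
        simp only [hG]
        rw [← Complex.exp_add, ← add_assoc, h.step]
        congr 1; push_cast; ring
      have e2 : V j ω = V (j + 1) ω
          * (Real.exp (-(s ^ 2 * a (n + j + 1) ^ 2 * q n ω / 2)) : ℂ) := by
        simp only [hV]
        rw [← Complex.ofReal_mul, ← Real.exp_add, sqTail_eq_add ha (n + j)]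
        congr 2; ring_nf
      have e3 : G (j + 1) ω * V (j + 1) ω - G j ω * V j ω
          - ((fun ω => Y (n + j + 1) ω • ((s * a (n + j + 1)) • (Complex.I * ξ j ω)))
            + fun ω => (Y (n + j + 1) ω ^ 2 - q (n + j) ω)
              • ((-(s ^ 2 * a (n + j + 1) ^ 2 / 2)) • ξ j ω)) ω
          = ξ j ω * (Complex.exp (Complex.I * ((s * a (n + j + 1) * Y (n + j + 1) ω : ℝ) : ℂ))
            - (Real.exp (-(s ^ 2 * a (n + j + 1) ^ 2 * q n ω / 2)) : ℂ)
            - (s * a (n + j + 1) * Y (n + j + 1) ω) • Complex.I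
            + ((s ^ 2 * a (n + j + 1) ^ 2 * (Y (n + j + 1) ω ^ 2 - q (n + j) ω) / 2 : ℝ) : ℂ)) := by
        rw [e1, e2]
        simp only [hξ, Pi.add_apply, Complex.real_smul]
        push_cast; ring
      rw [e3, norm_mul]
      refine (mul_le_of_le_one_left (norm_nonneg _) h1).trans ?_
      refine (norm_exp_step_le (h.bound_Y _ ω) hs (hb j) (h2 n)
        ((le_abs_self _).trans (h.bound_q n ω)) (hSq j ω)).trans (le_of_eq ?_)
      rw [hc]; ring)
    (ae_of_all _ fun ω => by
      have := hK ω
      have h3 := (abs_nonneg _).trans (hSq 0 ω)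
      positivity) (fun j => sq_nonneg _)
  have hUi : Integrable (fun ω => Complex.exp (Complex.I * ((s * (Minf ω - M n ω) : ℝ) : ℂ))) P := by
    have hMinf : AEStronglyMeasurable Minf P :=
      aestronglyMeasurable_of_tendsto_ae atTop (fun k => (hMm k).aestronglyMeasurable) h.tendsto_M
    refine Integrable.of_bound ?_ 1 (ae_of_all _ fun ω => ?_)
    · exact (show Continuous fun x : ℝ => Complex.exp (Complex.I * ((s * x : ℝ) : ℂ)) by
        fun_prop).comp_aestronglyMeasurable (hMinf.sub (hMm n).aestronglyMeasurable)
    · rw [mul_comm]; exact (Complex.norm_exp_ofReal_mul_I _).le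
  have hVi : Integrable (V 0) P := Integrable.of_bound
    ((hVm 0).mono (F.le n)).aestronglyMeasurable 1 (by filter_upwards [hVn] with ω hω using hω 0)
  have hG0 : (fun ω => Complex.exp (Complex.I * ((s * (Minf ω - M n ω) : ℝ) : ℂ))
      - G 0 ω * V 0 ω)
      = (fun ω => Complex.exp (Complex.I * ((s * (Minf ω - M n ω) : ℝ) : ℂ))) - V 0 := by
    ext ω; simp [hG]
  rw [hG0] at key
  have hR' : (fun ω => s ^ 2 * (S n ω + c)) = s ^ 2 • (S n + fun _ => c) := rfl
  rw [hR'] at key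
  filter_upwards [key, condExp_sub hUi hVi (F n), condExp_smul (μ := P) (s ^ 2) (S n + fun _ => c) (F n),
    condExp_add hSi (integrable_const c) (F n)] with ω h1 h2 h3 h4
  rw [h2, h3, Pi.smul_apply, h4, Pi.sub_apply, Pi.add_apply, condExp_const (F.le n),
    condExp_of_stronglyMeasurable (F.le n) (hVm 0) hVi, smul_eq_mul] at h1
  refine h1.trans (le_of_eq ?_)
  ring

/-- **Almost sure conditional central limit theorem** for weighted martingales, in terms of
characteristic functions. -/
theorem tendsto_condExp_charFun (ha : Summable fun n => a n ^ 2) {b r : ℕ → ℝ}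
    (hb : ∀ᶠ n in atTop, ∀ j, |a (n + j + 1)| ≤ b n) (hr0 : ∀ᶠ n in atTop, 0 ≤ r n)
    (hr : Tendsto (fun n => r n * sqTail a n) atTop (𝓝 1))
    (hrb : Tendsto (fun n => √(r n) * b n) atTop (𝓝 0)) :
    ∀ᵐ ω ∂P, Tendsto (fun n =>
      P[fun ω => Complex.exp (Complex.I * ((√(r n) * (Minf ω - M n ω) : ℝ) : ℂ)) | F n] ω) atTop
      (𝓝 (Real.exp (-(qinf ω / 2)) : ℂ)) := by
  obtain ⟨S, hSm, hS0, hSC, hSa, hSl, hSq⟩ := h.exists_osc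
  have hSi : ∀ n, Integrable (S n) P := fun n =>
    Integrable.of_bound ((hSm n).mono (iSup_le fun n => F.le n)).aestronglyMeasurable (2 * K ^ 2)
      (ae_of_all _ fun ω => by rw [Real.norm_of_nonneg (hS0 n ω)]; exact hSC n ω)
  -- The oscillation looks into the future, so it enters the error only through its conditional
  -- expectation; monotonicity makes that vanish.
  have h1 := tendsto_condExp_of_antitone (P := P) (F := F) hSm hS0 hSC hSa hSl
  have h2 : ∀ᵐ ω ∂P, ∀ n, (∀ j, |a (n + j + 1)| ≤ b n) →
      ‖P[fun ω => Complex.exp (Complex.I * ((√(r n) * (Minf ω - M n ω) : ℝ) : ℂ)) | F n] ω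
        - (Real.exp (-(√(r n) ^ 2 * sqTail a n * q n ω / 2)) : ℂ)‖
      ≤ √(r n) ^ 2 * sqTail a n
        * (P[S n | F n] ω + (4 * K ^ 3 * (√(r n) * b n) + K ^ 4 * (√(r n) * b n) ^ 2)) := by
    refine ae_all_iff.2 fun n => ?_
    by_cases hn : ∀ j, |a (n + j + 1)| ≤ b n
    · filter_upwards [h.norm_condExp_charFun_sub_le ha n (hSi n) (hSq n) (Real.sqrt_nonneg (r n))
        hn] with ω hω _ using hω
    · exact ae_of_all _ fun ω hω => absurd hω hn
  have hrT : Tendsto (fun n => √(r n) ^ 2 * sqTail a n) atTop (𝓝 1) := by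
    refine hr.congr' ?_
    filter_upwards [hr0] with n hn
    rw [Real.sq_sqrt hn]
  filter_upwards [h1, h2, h.tendsto_q] with ω h1 h2 h3
  have h4 : Tendsto (fun n => (Real.exp (-(√(r n) ^ 2 * sqTail a n * q n ω / 2)) : ℂ)) atTop
      (𝓝 (Real.exp (-(qinf ω / 2)) : ℂ)) := by
    have := ((show Continuous fun x : ℝ => (Real.exp (-(x / 2)) : ℂ) by fun_prop).tendsto _).comp
      (hrT.mul h3)
    simpa [Function.comp_def] using this
  have h5 : Tendsto (fun n => √(r n) ^ 2 * sqTail a n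
        * (P[S n | F n] ω + (4 * K ^ 3 * (√(r n) * b n) + K ^ 4 * (√(r n) * b n) ^ 2)))
      atTop (𝓝 0) := by
    have := hrT.mul (h1.add ((hrb.const_mul (4 * K ^ 3)).add ((hrb.pow 2).const_mul (K ^ 4))))
    simpa using this
  have h6 := squeeze_zero_norm' (hb.mono fun n hn => h2 n hn) h5
  simpa using h6.add h4

end IsWeightedMartingale

end MartingaleCLT

/-! ### Bayes updates, mixtures and Newton's recursion as measures. -/

section Bayes

variable {𝕏 Θ Ω : Type*} [MeasurableSpace 𝕏] [MeasurableSpace Θ] [MeasurableSpace Ω]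
  {μ : Measure 𝕏} {f : 𝕏 → Θ → ℝ≥0} {H : Measure Θ}

lemma measurable_density_section (hf : Measurable (Function.uncurry f)) (x : 𝕏) :
    Measurable fun t => (f x t : ℝ≥0∞) :=
  (hf.comp measurable_prodMk_left).coe_nnreal_ennreal

lemma lintegral_bayes (hf : Measurable (Function.uncurry f)) {h : Θ → ℝ≥0∞} (hh : Measurable h)
    (x : 𝕏) : ∫⁻ t, h t ∂(bayes f H x) = (mixDensity f H x)⁻¹ * ∫⁻ t, f x t * h t ∂H := by
  rw [bayes, lintegral_smul_measure, smul_eq_mul,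
    lintegral_withDensity_eq_lintegral_mul _ (measurable_density_section hf x) hh]
  rfl

omit [MeasurableSpace 𝕏] in
lemma bayes_apply {A : Set Θ} (hA : MeasurableSet A) (x : 𝕏) :
    bayes f H x A = (mixDensity f H x)⁻¹ * ∫⁻ t in A, f x t ∂H := by
  rw [bayes, Measure.smul_apply, withDensity_apply _ hA, smul_eq_mul]

-- At a density `0` or `∞` the update is the zero measure: in the first case `f(x|·)` vanishes
-- almost everywhere and `∞ * 0 = 0`, in the second `∞⁻¹ = 0`. The bound therefore needs no
-- condition on `x`.
omit [MeasurableSpace 𝕏] in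
lemma bayes_univ_le_one (x : 𝕏) : bayes f H x Set.univ ≤ 1 := by
  rw [bayes_apply MeasurableSet.univ, Measure.restrict_univ]
  exact ENNReal.inv_mul_le_one _

omit [MeasurableSpace 𝕏] in
lemma bayes_univ_eq_one {x : 𝕏} (h0 : mixDensity f H x ≠ 0) (h1 : mixDensity f H x ≠ ∞) :
    bayes f H x Set.univ = 1 := by
  rw [bayes_apply MeasurableSet.univ, Measure.restrict_univ]
  exact ENNReal.inv_mul_cancel h0 h1

omit [MeasurableSpace 𝕏] in
instance isFiniteMeasure_bayes (x : 𝕏) : IsFiniteMeasure (bayes f H x) :=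
  ⟨(bayes_univ_le_one x).trans_lt ENNReal.one_lt_top⟩

omit [MeasurableSpace 𝕏] in
lemma bayes_real_le_one (x : 𝕏) (A : Set Θ) : (bayes f H x).real A ≤ 1 :=
  ENNReal.toReal_le_of_le_ofReal zero_le_one
    (by rw [ENNReal.ofReal_one]; exact (measure_mono (Set.subset_univ A)).trans (bayes_univ_le_one x))

lemma measurable_mixDensity [SFinite H] (hf : Measurable (Function.uncurry f)) :
    Measurable (mixDensity f H) :=
  Measurable.lintegral_prod_right' (f := fun p : 𝕏 × Θ => (f p.1 p.2 : ℝ≥0∞)) hf.coe_nnreal_ennreal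

/-- Under the mixture distribution, the mean of the Bayes update is the mixing measure. -/
lemma lintegral_lintegral_bayes [SigmaFinite μ] [IsFiniteMeasure H]
    (hf : Measurable (Function.uncurry f)) (hf1 : ∀ t, ∫⁻ x, (f x t : ℝ≥0∞) ∂μ = 1)
    {h : Θ → ℝ≥0∞} (hh : Measurable h) :
    ∫⁻ x, (∫⁻ t, h t ∂(bayes f H x)) * mixDensity f H x ∂μ = ∫⁻ t, h t ∂H := by
  have hfm : Measurable fun p : 𝕏 × Θ => (f p.1 p.2 : ℝ≥0∞) := hf.coe_nnreal_ennreal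
  have hT : ∀ g : Θ → ℝ≥0∞, Measurable g → ∫⁻ x, ∫⁻ t, f x t * g t ∂H ∂μ = ∫⁻ t, g t ∂H := by
    intro g hg
    rw [lintegral_lintegral_swap (hfm.mul (hg.comp measurable_snd)).aemeasurable]
    refine lintegral_congr fun t => ?_
    have : Measurable fun x => (f x t : ℝ≥0∞) :=
      (hf.comp measurable_prodMk_right).coe_nnreal_ennreal
    rw [lintegral_mul_const _ this, hf1, one_mul]
  have hfin : ∀ᵐ x ∂μ, mixDensity f H x < ∞ := by
    refine ae_lt_top (measurable_mixDensity hf) ?_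
    have := hT (fun _ => 1) measurable_const
    simp only [mul_one, lintegral_const, one_mul] at this
    change ∫⁻ x, ∫⁻ t, f x t ∂H ∂μ ≠ ∞
    rw [this]; exact measure_ne_top _ _
  rw [← hT h hh]
  refine lintegral_congr_ae ?_
  filter_upwards [hfin] with x hx
  rw [lintegral_bayes hf hh, mul_right_comm]
  -- When the normalizing density is zero it cannot be cancelled, but then `f(x|·)` is `H`-almost
  -- everywhere zero and both sides vanish.
  by_cases h0 : mixDensity f H x = 0
  · have h2 : (fun t => (f x t : ℝ≥0∞)) =ᵐ[H] 0 :=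
      (lintegral_eq_zero_iff (measurable_density_section hf x)).1 h0
    have : ∫⁻ t, f x t * h t ∂H = 0 := by
      refine lintegral_eq_zero_of_ae_eq_zero ?_
      filter_upwards [h2] with t ht
      simp only [Pi.zero_apply] at ht ⊢
      rw [ht, zero_mul]
    rw [this, mul_zero]
  · rw [ENNReal.inv_mul_cancel h0 hx.ne, one_mul]

lemma lintegral_mixDensity [SigmaFinite μ] [IsFiniteMeasure H]
    (hf : Measurable (Function.uncurry f)) (hf1 : ∀ t, ∫⁻ x, (f x t : ℝ≥0∞) ∂μ = 1) :
    ∫⁻ x, mixDensity f H x ∂μ = H Set.univ := by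
  have hfm : Measurable fun p : 𝕏 × Θ => (f p.1 p.2 : ℝ≥0∞) := hf.coe_nnreal_ennreal
  change ∫⁻ x, ∫⁻ t, f x t ∂H ∂μ = _
  rw [lintegral_lintegral_swap hfm.aemeasurable]
  simp [hf1]

lemma ae_mixDensity_lt_top [SigmaFinite μ] [IsFiniteMeasure H]
    (hf : Measurable (Function.uncurry f)) (hf1 : ∀ t, ∫⁻ x, (f x t : ℝ≥0∞) ∂μ = 1) :
    ∀ᵐ x ∂μ, mixDensity f H x < ∞ :=
  ae_lt_top (measurable_mixDensity hf)
    (by rw [lintegral_mixDensity hf hf1]; exact measure_ne_top H _)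

lemma ae_mixDistrib [SigmaFinite μ] [IsFiniteMeasure H]
    (hf : Measurable (Function.uncurry f)) (hf1 : ∀ t, ∫⁻ x, (f x t : ℝ≥0∞) ∂μ = 1) :
    ∀ᵐ x ∂(mixDistrib μ f H), mixDensity f H x ≠ 0 ∧ mixDensity f H x ≠ ∞ := by
  rw [mixDistrib, ae_withDensity_iff (measurable_mixDensity hf)]
  filter_upwards [ae_mixDensity_lt_top (H := H) hf hf1] with x hx h0 using ⟨h0, hx.ne⟩

lemma mixDistrib_univ [SigmaFinite μ] [IsFiniteMeasure H]
    (hf : Measurable (Function.uncurry f)) (hf1 : ∀ t, ∫⁻ x, (f x t : ℝ≥0∞) ∂μ = 1) :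
    mixDistrib μ f H Set.univ = H Set.univ := by
  rw [mixDistrib, withDensity_apply _ MeasurableSet.univ, Measure.restrict_univ,
    lintegral_mixDensity hf hf1]

lemma isFiniteMeasure_mixDistrib [SigmaFinite μ] [IsFiniteMeasure H]
    (hf : Measurable (Function.uncurry f)) (hf1 : ∀ t, ∫⁻ x, (f x t : ℝ≥0∞) ∂μ = 1) :
    IsFiniteMeasure (mixDistrib μ f H) :=
  ⟨by rw [mixDistrib_univ hf hf1]; exact measure_lt_top _ _⟩

section Measurability

variable {N : Ω → Measure Θ}

lemma measurable_lintegral_of_measurable_measure (hN : Measurable N)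
    (hN1 : ∀ ω, N ω Set.univ ≤ 1) {g : Ω → Θ → ℝ≥0∞} (hg : Measurable (Function.uncurry g)) :
    Measurable fun ω => ∫⁻ t, g ω t ∂(N ω) := by
  let κ : Kernel Ω Θ := ⟨N, hN⟩
  have : IsFiniteKernel κ := ⟨⟨1, ENNReal.one_lt_top, hN1⟩⟩
  exact Measurable.lintegral_kernel_prod_right (κ := κ) hg

lemma measurable_mixDensity_measure (hf : Measurable (Function.uncurry f)) (hN : Measurable N)
    (hN1 : ∀ ω, N ω Set.univ ≤ 1) {x : Ω → 𝕏} (hx : Measurable x) :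
    Measurable fun ω => mixDensity f (N ω) (x ω) :=
  measurable_lintegral_of_measurable_measure hN hN1
    (g := fun ω t => (f (x ω) t : ℝ≥0∞))
    (hf.comp ((hx.comp measurable_fst).prodMk measurable_snd)).coe_nnreal_ennreal

lemma measurable_setLIntegral_density (hf : Measurable (Function.uncurry f)) (hN : Measurable N)
    (hN1 : ∀ ω, N ω Set.univ ≤ 1) {x : Ω → 𝕏} (hx : Measurable x) {A : Set Θ}
    (hA : MeasurableSet A) :
    Measurable fun ω => ∫⁻ t in A, f (x ω) t ∂(N ω) := by
  simp_rw [← lintegral_indicator hA]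
  refine measurable_lintegral_of_measurable_measure hN hN1
    (g := fun ω => A.indicator fun t => (f (x ω) t : ℝ≥0∞)) ?_
  have : Function.uncurry (fun ω => A.indicator fun t => (f (x ω) t : ℝ≥0∞))
      = (Prod.snd ⁻¹' A).indicator fun p : Ω × Θ => (f (x p.1) p.2 : ℝ≥0∞) := by
    ext ⟨ω, t⟩; rfl
  rw [this]
  exact (hf.comp ((hx.comp measurable_fst).prodMk measurable_snd)).coe_nnreal_ennreal.indicator
    (measurable_snd hA)

lemma measurable_bayes (hf : Measurable (Function.uncurry f)) (hN : Measurable N)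
    (hN1 : ∀ ω, N ω Set.univ ≤ 1) {x : Ω → 𝕏} (hx : Measurable x) :
    Measurable fun ω => bayes f (N ω) (x ω) := by
  refine Measure.measurable_of_measurable_coe _ fun A hA => ?_
  simp_rw [bayes_apply hA]
  exact (measurable_mixDensity_measure hf hN hN1 hx).inv.mul
    (measurable_setLIntegral_density hf hN hN1 hx hA)

end Measurability

variable {α : ℕ → ℝ} {G₀ : Measure Θ}

-- Only an inequality holds along an arbitrary path, since an update with density `0` or `∞` loses
-- mass. Equality is recovered almost surely under the model.
omit [MeasurableSpace 𝕏] in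
lemma newtonMeasure_univ_le_one [IsProbabilityMeasure G₀] (hα : ∀ n, 1 ≤ n → 0 < α n ∧ α n < 1)
    (x : ℕ → 𝕏) (n : ℕ) : newtonMeasure f α G₀ x n Set.univ ≤ 1 := by
  induction n with
  | zero => simp [newtonMeasure]
  | succ n ih =>
    obtain ⟨h0, h1⟩ := hα (n + 1) (by omega)
    simp only [newtonMeasure, Measure.add_apply, Measure.smul_apply, smul_eq_mul]
    calc _ ≤ ENNReal.ofReal (1 - α (n + 1)) * 1 + ENNReal.ofReal (α (n + 1)) * 1 := by
          gcongr; exact bayes_univ_le_one _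
      _ = 1 := by
          rw [mul_one, mul_one, ← ENNReal.ofReal_add (by linarith) h0.le]; simp

-- This lets the random measure be written as a function of the finite history, with arbitrary
-- values filled in beyond time `n`.
omit [MeasurableSpace 𝕏] in
lemma newtonMeasure_congr {x y : ℕ → 𝕏} {n : ℕ} (h : ∀ i, 1 ≤ i → i ≤ n → x i = y i) :
    newtonMeasure f α G₀ x n = newtonMeasure f α G₀ y n := by
  induction n with
  | zero => rfl
  | succ n ih =>
    simp only [newtonMeasure]
    rw [ih fun i h1 h2 => h i h1 (by omega), h (n + 1) (by omega) le_rfl]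

lemma measurable_newtonMeasure [IsProbabilityMeasure G₀] (hf : Measurable (Function.uncurry f))
    (hα : ∀ n, 1 ≤ n → 0 < α n ∧ α n < 1) {X : ℕ → Ω → 𝕏} {n : ℕ}
    (hX : ∀ i, 1 ≤ i → i ≤ n → Measurable (X i)) :
    Measurable fun ω => newtonMeasure f α G₀ (fun i => X i ω) n := by
  induction n with
  | zero => exact measurable_const
  | succ n ih =>
    have h1 := ih fun i h1 h2 => hX i h1 (by omega)
    have h2 := measurable_bayes hf h1 (fun ω => newtonMeasure_univ_le_one hα _ n)
      (hX (n + 1) (by omega) le_rfl)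
    refine Measure.measurable_of_measurable_coe _ fun A hA => ?_
    simp only [newtonMeasure, Measure.add_apply, Measure.smul_apply, smul_eq_mul]
    exact (((Measure.measurable_coe hA).comp h1).const_mul _).add
      (((Measure.measurable_coe hA).comp h2).const_mul _)

omit [MeasurableSpace 𝕏] in
lemma newtonMeasure_real_succ [IsProbabilityMeasure G₀] (hα : ∀ n, 1 ≤ n → 0 < α n ∧ α n < 1)
    (x : ℕ → 𝕏) (n : ℕ) (A : Set Θ) :
    (newtonMeasure f α G₀ x (n + 1)).real A = (newtonMeasure f α G₀ x n).real A
      + α (n + 1) * ((bayes f (newtonMeasure f α G₀ x n) (x (n + 1))).real A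
        - (newtonMeasure f α G₀ x n).real A) := by
  obtain ⟨h0, h1⟩ := hα (n + 1) (by omega)
  have : IsFiniteMeasure (newtonMeasure f α G₀ x n) :=
    ⟨(newtonMeasure_univ_le_one hα x n).trans_lt ENNReal.one_lt_top⟩
  rw [newtonMeasure, Measure.real, Measure.add_apply, Measure.smul_apply, Measure.smul_apply,
    smul_eq_mul, smul_eq_mul, ENNReal.toReal_add (by finiteness) (by finiteness),
    ENNReal.toReal_mul, ENNReal.toReal_mul, ENNReal.toReal_ofReal (by linarith),
    ENNReal.toReal_ofReal h0.le, Measure.real, Measure.real]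
  ring

end Bayes

/-! ### The observation filtration. -/

section History

variable {𝕏 Θ Ω : Type*} [MeasurableSpace 𝕏] [MeasurableSpace Θ] [mΩ : MeasurableSpace Ω]
  {X : ℕ → Ω → 𝕏}

lemma measurable_history (hX : ∀ n, 1 ≤ n → Measurable (X n)) (n : ℕ) :
    Measurable (history X n) :=
  measurable_pi_lambda _ fun _ => hX _ (by omega)

omit mΩ in
lemma measurable_obs_comap_history {n i : ℕ} (h1 : 1 ≤ i) (hn : i ≤ n) :
    Measurable[MeasurableSpace.comap (history X n) inferInstance] (X i) := by
  have h : X i = (fun h : Fin n → 𝕏 => h ⟨i - 1, by omega⟩) ∘ history X n := by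
    ext ω; simp only [history, Function.comp]; congr 1; omega
  rw [h]
  exact (measurable_pi_apply _).comp (comap_measurable _)

/-- The filtration generated by the observations. -/
def historyFiltration (hX : ∀ n, 1 ≤ n → Measurable (X n)) : Filtration ℕ mΩ where
  seq n := MeasurableSpace.comap (history X n) inferInstance
  mono' n k hnk := Measurable.comap_le (@measurable_pi_lambda _ _ _
    (MeasurableSpace.comap (history X k) inferInstance) _ _ fun i =>
      measurable_obs_comap_history (by omega) (by omega))
  le' n := (measurable_history hX n).comap_le

/-- Extension of a finite history to a sequence of observations. -/
noncomputable def pathOf [Nonempty 𝕏] {n : ℕ} (h : Fin n → 𝕏) : ℕ → 𝕏 := fun i =>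
  if hi : 1 ≤ i ∧ i ≤ n then h ⟨i - 1, by omega⟩ else Classical.arbitrary 𝕏

lemma measurable_pathOf [Nonempty 𝕏] (n i : ℕ) :
    Measurable fun h : Fin n → 𝕏 => pathOf h i := by
  unfold pathOf
  split_ifs
  · exact measurable_pi_apply _
  · exact measurable_const

variable {f : 𝕏 → Θ → ℝ≥0} {α : ℕ → ℝ} {G₀ : Measure Θ}

omit [MeasurableSpace 𝕏] mΩ in
lemma newtonMeasure_pathOf_history [Nonempty 𝕏] (n : ℕ) (ω : Ω) :
    newtonMeasure f α G₀ (pathOf (history X n ω)) n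
      = newtonMeasure f α G₀ (fun i => X i ω) n := by
  refine newtonMeasure_congr fun i h1 h2 => ?_
  simp only [pathOf, h1, h2, and_self, dif_pos, history]
  congr 1; omega

end History

/-! ### One-step prediction in Newton's model. -/

section Model

variable {𝕏 Θ Ω : Type*} [MeasurableSpace 𝕏] [MeasurableSpace Θ] [MeasurableSpace Ω]
  [StandardBorelSpace 𝕏] [Nonempty 𝕏] [StandardBorelSpace Θ] [Nonempty Θ]
  {P : Measure Ω} [IsProbabilityMeasure P] {μ : Measure 𝕏} {f : 𝕏 → Θ → ℝ≥0} {α : ℕ → ℝ}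
  {G₀ : Measure Θ} [IsProbabilityMeasure G₀] {X : ℕ → Ω → 𝕏} {θ : ℕ → Ω → Θ}

omit [StandardBorelSpace 𝕏] [StandardBorelSpace Θ] [Nonempty Θ] in
lemma measurable_newtonMeasure_pathOf (hf : Measurable (Function.uncurry f))
    (hα : ∀ n, 1 ≤ n → 0 < α n ∧ α n < 1) (n : ℕ) :
    Measurable fun h : Fin n → 𝕏 => newtonMeasure f α G₀ (pathOf h) n :=
  measurable_newtonMeasure (X := fun i (h : Fin n → 𝕏) => pathOf h i) hf hα
    fun i _ _ => measurable_pathOf n i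

omit [StandardBorelSpace 𝕏] [Nonempty 𝕏] [StandardBorelSpace Θ] [Nonempty Θ] in
lemma mixDistrib_apply [SigmaFinite μ] (hf : Measurable (Function.uncurry f)) {H : Measure Θ}
    [SFinite H] {B : Set 𝕏} (hB : MeasurableSet B) :
    mixDistrib μ f H B = ∫⁻ t, ∫⁻ x in B, f x t ∂μ ∂H := by
  have hfm : Measurable fun p : 𝕏 × Θ => (f p.1 p.2 : ℝ≥0∞) := hf.coe_nnreal_ennreal
  rw [mixDistrib, withDensity_apply _ hB]
  exact lintegral_lintegral_swap hfm.aemeasurable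

/-- The one-step predictive kernel of Newton's model. -/
noncomputable def predictive (μ : Measure 𝕏) [SigmaFinite μ] (hf : Measurable (Function.uncurry f))
    (hα : ∀ n, 1 ≤ n → 0 < α n ∧ α n < 1) (G₀ : Measure Θ) [IsProbabilityMeasure G₀] (n : ℕ) :
    Kernel (Fin n → 𝕏) 𝕏 where
  toFun h := mixDistrib μ f (newtonMeasure f α G₀ (pathOf h) n)
  measurable' := by
    refine Measure.measurable_of_measurable_coe _ fun B hB => ?_
    simp_rw [mixDistrib, withDensity_apply _ hB]
    exact Measurable.lintegral_prod_right'
      (f := fun p : (Fin n → 𝕏) × 𝕏 => mixDensity f (newtonMeasure f α G₀ (pathOf p.1) n) p.2)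
      (measurable_mixDensity_measure hf
        ((measurable_newtonMeasure_pathOf hf hα n).comp measurable_fst)
        (fun p => newtonMeasure_univ_le_one hα _ n) measurable_snd)

omit [MeasurableSpace 𝕏] [StandardBorelSpace 𝕏] [Nonempty 𝕏] [StandardBorelSpace Θ] [Nonempty Θ] in
lemma isFiniteMeasure_newtonMeasure (hα : ∀ n, 1 ≤ n → 0 < α n ∧ α n < 1) (x : ℕ → 𝕏) (n : ℕ) :
    IsFiniteMeasure (newtonMeasure f α G₀ x n) :=
  ⟨(newtonMeasure_univ_le_one hα x n).trans_lt ENNReal.one_lt_top⟩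

namespace IsNewtonModel

variable (hM : IsNewtonModel P μ f α G₀ X θ)
include hM

-- This is the disintegration of the latent variable over the history. Time zero is separate: the
-- history then lives in a one-point space, so the event is empty or everything and the law of `θ 1`
-- decides.
omit [IsProbabilityMeasure G₀] in
lemma setLIntegral_latent {n : ℕ} {B : Set (Fin n → 𝕏)} (hB : MeasurableSet B) {φ : Θ → ℝ≥0∞}
    (hφ : Measurable φ) :
    ∫⁻ ω in history X n ⁻¹' B, φ (θ (n + 1) ω) ∂P
      = ∫⁻ ω in history X n ⁻¹' B, ∫⁻ t, φ t ∂(newtonMeasure f α G₀ (fun i => X i ω) n) ∂P := by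
  have hθ := hM.measurable_latent (n + 1) (by omega)
  have hh := measurable_history hM.measurable_obs n
  rcases Nat.eq_zero_or_pos n with rfl | hn
  · have h1 : ∫⁻ ω, φ (θ 1 ω) ∂P = ∫⁻ t, φ t ∂G₀ := by
      rw [← hM.law_latent_one, lintegral_map hφ hθ]
    rcases Set.eq_empty_or_nonempty B with rfl | ⟨b, hb⟩
    · simp
    · have : history X 0 ⁻¹' B = Set.univ := by
        ext ω; simp [Subsingleton.elim (history X 0 ω) b, hb]
      rw [this]
      simp [newtonMeasure, h1]
  · have hφ2 : Measurable fun p : (Fin n → 𝕏) × Θ => φ p.2 := hφ.comp measurable_snd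
    have h1 : ∫⁻ p in B ×ˢ Set.univ, φ p.2 ∂(P.map fun ω => (history X n ω, θ (n + 1) ω))
        = ∫⁻ ω in history X n ⁻¹' B, φ (θ (n + 1) ω) ∂P := by
      rw [setLIntegral_map (hB.prod MeasurableSet.univ) hφ2
        (hh.prodMk hθ)]
      congr 2; ext ω; simp
    rw [← h1, ← compProd_map_condDistrib hθ.aemeasurable,
      Measure.setLIntegral_compProd hφ2 hB MeasurableSet.univ,
      setLIntegral_map hB _ hh]
    · refine setLIntegral_congr_fun_ae (hh hB) ?_
      filter_upwards [hM.latent_given_history n hn] with ω hω _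
      rw [hω, Measure.restrict_univ]
    · simp only [Measure.restrict_univ]
      exact Measurable.lintegral_kernel_prod_right' hφ2

variable [SigmaFinite μ]

/-- The conditional law of the next observation is the current mixture distribution. -/
lemma condDistrib_obs (hf : Measurable (Function.uncurry f))
    (hf1 : ∀ t, ∫⁻ x, (f x t : ℝ≥0∞) ∂μ = 1) (hα : ∀ n, 1 ≤ n → 0 < α n ∧ α n < 1) (n : ℕ) :
    ∀ᵐ ω ∂P, condDistrib (X (n + 1)) (history X n) P (history X n ω)
      = mixDistrib μ f (newtonMeasure f α G₀ (fun i => X i ω) n) := by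
  have hθ := hM.measurable_latent (n + 1) (by omega)
  have hX := hM.measurable_obs (n + 1) (by omega)
  have hh := measurable_history hM.measurable_obs n
  have hfin := fun h : Fin n → 𝕏 => isFiniteMeasure_newtonMeasure (f := f) (G₀ := G₀) hα (pathOf h) n
  have : IsFiniteKernel (predictive μ hf hα G₀ n) := ⟨⟨1, ENNReal.one_lt_top, fun h => by
    change mixDistrib μ f (newtonMeasure f α G₀ (pathOf h) n) Set.univ ≤ 1
    rw [mixDistrib_univ hf hf1]
    exact newtonMeasure_univ_le_one hα _ n⟩⟩
  -- It suffices to match the joint law on rectangles; uniqueness of disintegration then identifies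
  -- the conditional law.
  have key : P.map (fun ω => (history X n ω, X (n + 1) ω))
      = P.map (history X n) ⊗ₘ predictive μ hf hα G₀ n := by
    refine Measure.ext_prod fun {B} {C} hB hC => ?_
    have hφ : Measurable fun t => ∫⁻ x in C, (f x t : ℝ≥0∞) ∂μ :=
      Measurable.lintegral_prod_left' (f := fun p : 𝕏 × Θ => (f p.1 p.2 : ℝ≥0∞))
        hf.coe_nnreal_ennreal
    rw [Measure.map_apply (hh.prodMk hX) (hB.prod hC), Measure.compProd_apply_prod hB hC,
      setLIntegral_map hB (Kernel.measurable_coe _ hC) hh]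
    have h1 := setLIntegral_preimage_condDistrib (μ := P) (hh.prodMk hθ) hX.aemeasurable hC
      (hB.prod (MeasurableSet.univ (α := Θ)))
    have h2 : (fun ω => (history X n ω, θ (n + 1) ω)) ⁻¹' B ×ˢ Set.univ = history X n ⁻¹' B := by
      ext ω; simp
    rw [h2] at h1
    have h3 : (fun ω => (history X n ω, X (n + 1) ω)) ⁻¹' B ×ˢ C
        = history X n ⁻¹' B ∩ X (n + 1) ⁻¹' C := by
      ext ω; simp
    rw [h3, ← h1]
    have h4 : ∫⁻ ω in history X n ⁻¹' B, condDistrib (X (n + 1))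
          (fun ω' => (history X n ω', θ (n + 1) ω')) P (history X n ω, θ (n + 1) ω) C ∂P
        = ∫⁻ ω in history X n ⁻¹' B, ∫⁻ x in C, f x (θ (n + 1) ω) ∂μ ∂P := by
      refine setLIntegral_congr_fun_ae (hh hB) ?_
      filter_upwards [hM.obs_given_latent n] with ω hω _
      rw [hω, withDensity_apply _ hC]
    -- The latent variable is integrated out: averaging `∫_C f(x|θ) dμ` over `G_n` gives
    -- `F_{G_n}(C)` by Tonelli.
    rw [h4, hM.setLIntegral_latent hB hφ]
    refine setLIntegral_congr_fun (hh hB) fun ω _ => ?_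
    change _ = mixDistrib μ f (newtonMeasure f α G₀ (pathOf (history X n ω)) n) C
    rw [mixDistrib_apply hf hC, newtonMeasure_pathOf_history]
  have h := ae_of_ae_map hh.aemeasurable
    (condDistrib_ae_eq_of_measure_eq_compProd (history X n) hX.aemeasurable key)
  filter_upwards [h] with ω hω
  rw [hω]
  change mixDistrib μ f (newtonMeasure f α G₀ (pathOf (history X n ω)) n) = _
  rw [newtonMeasure_pathOf_history]

/-- Conditional expectations of functions of the past and of the next observation. -/
lemma condExp_next (hf : Measurable (Function.uncurry f))
    (hf1 : ∀ t, ∫⁻ x, (f x t : ℝ≥0∞) ∂μ = 1) (hα : ∀ n, 1 ≤ n → 0 < α n ∧ α n < 1) (n : ℕ)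
    {φ : Measure Θ → 𝕏 → ℝ}
    (hφ : Measurable fun p : (Fin n → 𝕏) × 𝕏 => φ (newtonMeasure f α G₀ (pathOf p.1) n) p.2)
    (hφi : Integrable (fun ω =>
      φ (newtonMeasure f α G₀ (fun i => X i ω) n) (X (n + 1) ω)) P) :
    P[fun ω => φ (newtonMeasure f α G₀ (fun i => X i ω) n) (X (n + 1) ω) |
        historyFiltration hM.measurable_obs n]
      =ᵐ[P] fun ω => ∫ x, φ (newtonMeasure f α G₀ (fun i => X i ω) n) x
        ∂(mixDistrib μ f (newtonMeasure f α G₀ (fun i => X i ω) n)) := by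
  have hX := hM.measurable_obs (n + 1) (by omega)
  have hh := measurable_history hM.measurable_obs n
  have h := condExp_prod_ae_eq_integral_condDistrib (μ := P) hh hX.aemeasurable
    hφ.stronglyMeasurable (by simpa only [newtonMeasure_pathOf_history] using hφi)
  simp only [newtonMeasure_pathOf_history] at h
  refine h.trans ?_
  filter_upwards [hM.condDistrib_obs hf hf1 hα n] with ω hω
  rw [hω]

/-- Integrals of functions of the past and of the next observation. -/
lemma setLIntegral_next (hf : Measurable (Function.uncurry f))
    (hf1 : ∀ t, ∫⁻ x, (f x t : ℝ≥0∞) ∂μ = 1) (hα : ∀ n, 1 ≤ n → 0 < α n ∧ α n < 1) (n : ℕ)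
    {φ : Measure Θ → 𝕏 → ℝ≥0∞}
    (hφ : Measurable fun p : (Fin n → 𝕏) × 𝕏 => φ (newtonMeasure f α G₀ (pathOf p.1) n) p.2)
    {B : Set Ω} (hB : MeasurableSet[historyFiltration hM.measurable_obs n] B) :
    ∫⁻ ω in B, φ (newtonMeasure f α G₀ (fun i => X i ω) n) (X (n + 1) ω) ∂P
      = ∫⁻ ω in B, ∫⁻ x, φ (newtonMeasure f α G₀ (fun i => X i ω) n) x
        ∂(mixDistrib μ f (newtonMeasure f α G₀ (fun i => X i ω) n)) ∂P := by
  obtain ⟨B, hB, rfl⟩ := hB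
  have hX := hM.measurable_obs (n + 1) (by omega)
  have hh := measurable_history hM.measurable_obs n
  have h1 : ∫⁻ p in B ×ˢ Set.univ, φ (newtonMeasure f α G₀ (pathOf p.1) n) p.2
        ∂(P.map fun ω => (history X n ω, X (n + 1) ω))
      = ∫⁻ ω in history X n ⁻¹' B,
          φ (newtonMeasure f α G₀ (fun i => X i ω) n) (X (n + 1) ω) ∂P := by
    rw [setLIntegral_map (hB.prod MeasurableSet.univ) hφ (hh.prodMk hX)]
    simp only [newtonMeasure_pathOf_history]
    congr 2; ext ω; simp
  rw [← h1, ← compProd_map_condDistrib hX.aemeasurable,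
    Measure.setLIntegral_compProd hφ hB MeasurableSet.univ, setLIntegral_map hB _ hh]
  · refine setLIntegral_congr_fun_ae (hh hB) ?_
    filter_upwards [hM.condDistrib_obs hf hf1 hα n] with ω hω _
    simp only [newtonMeasure_pathOf_history]
    rw [hω, Measure.restrict_univ]
  · simp only [Measure.restrict_univ]
    exact Measurable.lintegral_kernel_prod_right' hφ

end IsNewtonModel

end Model

/-! ### Martingales of random probability measures and their limits. -/

section RandomMeasure

lemma exists_measure_of_ratCDF {Ω : Type*} {m : MeasurableSpace Ω} {V : Ω → ℚ → ℝ}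
    (hV : Measurable V) : ∃ K : Ω → Measure ℝ, Measurable K ∧ (∀ ω, IsProbabilityMeasure (K ω)) ∧
      ∀ ω, IsRatStieltjesPoint V ω → ∀ q : ℚ, K ω (Set.Iic q) = ENNReal.ofReal (V ω q) := by
  refine ⟨fun ω => (stieltjesOfMeasurableRat V hV ω).measure,
    measurable_measure_stieltjesOfMeasurableRat hV, fun ω => inferInstance, fun ω hω q => ?_⟩
  rw [measure_stieltjesOfMeasurableRat_Iic, stieltjesOfMeasurableRat_eq,
    toRatCDF_of_isRatStieltjesPoint hω]

/-- A standard Borel space embeds measurably in the line, so a random measure on the line pulls back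
wherever it is carried by the image of the embedding. -/
lemma exists_measure_of_measure_real {Ω Θ : Type*} {m : MeasurableSpace Ω} [MeasurableSpace Θ]
    [StandardBorelSpace Θ] [Nonempty Θ] {K : Ω → Measure ℝ} (hK : Measurable K)
    (hK1 : ∀ ω, IsProbabilityMeasure (K ω)) :
    ∃ G : Ω → Measure Θ, Measurable G ∧ (∀ ω, IsProbabilityMeasure (G ω)) ∧
      ∀ ω, K ω (Set.range (embeddingReal Θ))ᶜ = 0 →
        ∀ A, MeasurableSet A → G ω A = K ω (embeddingReal Θ '' A) := by
  let κ : Kernel Ω ℝ := ⟨K, hK⟩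
  have : IsMarkovKernel κ := ⟨hK1⟩
  refine ⟨fun ω => Kernel.borelMarkovFromReal Θ κ ω, Kernel.measurable _,
    fun ω => inferInstance, fun ω hω A hA => ?_⟩
  rw [Kernel.borelMarkovFromReal_apply' Θ κ ω hA, if_pos (show κ ω _ = 0 from hω)]
  rfl

variable {Ω : Type*} {m0 : MeasurableSpace Ω} {P : Measure Ω}

/-- Markov's inequality along the sequence gives infimum zero almost surely. For sequences monotone
in `n` this amounts to convergence, which is how limits in mean become pathwise limits below. -/
lemma ae_exists_lt_of_tendsto_integral [IsFiniteMeasure P] {g : ℕ → Ω → ℝ}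
    (h0 : ∀ n, 0 ≤ᵐ[P] g n) (hi : ∀ n, Integrable (g n) P)
    (hlim : Tendsto (fun n => ∫ ω, g n ω ∂P) atTop (𝓝 0)) :
    ∀ᵐ ω ∂P, ∀ ε : ℝ, 0 < ε → ∃ n, g n ω < ε := by
  have key : ∀ k : ℕ, ∀ᵐ ω ∂P, ∃ n, g n ω < 1 / ((k : ℝ) + 1) := by
    intro k
    have hε : (0 : ℝ) < 1 / ((k : ℝ) + 1) := by positivity
    set ε : ℝ := 1 / ((k : ℝ) + 1)
    rw [ae_iff]
    push Not
    have h1 : ∀ n, P.real {ω | ∀ n, ε ≤ g n ω} ≤ ε⁻¹ * ∫ ω, g n ω ∂P := by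
      intro n
      have h2 : P.real {ω | ∀ n, ε ≤ g n ω} ≤ P.real {ω | ε ≤ g n ω} :=
        measureReal_mono fun ω hω => hω n
      refine h2.trans ?_
      have := mul_meas_ge_le_integral_of_nonneg (h0 n) (hi n) ε
      rwa [le_inv_mul_iff₀ hε]
    have h3 : P.real {ω | ∀ n, ε ≤ g n ω} ≤ 0 := by
      have h4 : Tendsto (fun n => ε⁻¹ * ∫ ω, g n ω ∂P) atTop (𝓝 0) := by
        simpa using hlim.const_mul ε⁻¹
      exact ge_of_tendsto' h4 h1
    exact (measureReal_eq_zero_iff).1 (le_antisymm h3 measureReal_nonneg)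
  filter_upwards [ae_all_iff.2 key] with ω hω ε hε
  obtain ⟨k, hk⟩ := exists_nat_one_div_lt hε
  obtain ⟨n, hn⟩ := hω k
  exact ⟨n, hn.trans hk⟩

/-- The limits at `±∞` and right continuity hold for the mean, which is a true distribution
function. Since `V` is monotone and bounded, each defect is nonnegative with mean tending to zero,
so it vanishes almost surely. -/
lemma ae_isRatStieltjesPoint [IsProbabilityMeasure P] {V : Ω → ℚ → ℝ}
    (hV : ∀ q, Measurable fun ω => V ω q) (hmono : ∀ᵐ ω ∂P, Monotone (V ω))
    (h0 : ∀ᵐ ω ∂P, ∀ q, 0 ≤ V ω q) (h1 : ∀ᵐ ω ∂P, ∀ q, V ω q ≤ 1) (ν : Measure ℝ)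
    (hν : ∀ q : ℚ, ∫ ω, V ω q ∂P = cdf ν q) : ∀ᵐ ω ∂P, IsRatStieltjesPoint V ω := by
  have hi : ∀ q, Integrable (fun ω => V ω q) P := fun q =>
    Integrable.of_bound (hV q).aestronglyMeasurable 1 (by
      filter_upwards [h0, h1] with ω h0 h1
      rw [Real.norm_of_nonneg (h0 q)]; exact h1 q)
  have htop := ae_exists_lt_of_tendsto_integral (P := P) (g := fun n ω => 1 - V ω (n : ℚ))
    (fun n => by filter_upwards [h1] with ω h1 using sub_nonneg.2 (h1 _))
    (fun n => (integrable_const 1).sub (hi _)) (by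
      have h := (tendsto_cdf_atTop ν).comp tendsto_natCast_atTop_atTop
      have h2 : Tendsto (fun n : ℕ => 1 - cdf ν n) atTop (𝓝 (1 - 1)) := h.const_sub 1
      rw [sub_self] at h2
      refine h2.congr fun n => ?_
      rw [integral_sub (integrable_const 1) (hi _), hν]; simp)
  have hbot := ae_exists_lt_of_tendsto_integral (P := P) (g := fun n ω => V ω (-(n : ℚ)))
    (fun n => by filter_upwards [h0] with ω h0 using h0 _) (fun n => hi _) (by
      have h := (tendsto_cdf_atBot ν).comp
        (tendsto_neg_atTop_atBot.comp tendsto_natCast_atTop_atTop)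
      refine h.congr fun n => ?_
      rw [hν]; simp)
  have hright : ∀ᵐ ω ∂P, ∀ t : ℚ, ∀ ε : ℝ, 0 < ε →
      ∃ n : ℕ, V ω (t + 1 / ((n : ℚ) + 1)) - V ω t < ε := by
    refine ae_all_iff.2 fun t => ?_
    refine ae_exists_lt_of_tendsto_integral
      (g := fun n ω => V ω (t + 1 / ((n : ℚ) + 1)) - V ω t) (fun n => ?_)
      (fun n => (hi _).sub (hi _)) ?_
    · filter_upwards [hmono] with ω hω
      exact sub_nonneg.2 (hω (by have : (0 : ℚ) < 1 / ((n : ℚ) + 1) := by positivity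
                                 linarith))
    · have h2 : Tendsto (fun n : ℕ => (t : ℝ) + 1 / ((n : ℝ) + 1)) atTop (𝓝[≥] (t : ℝ)) := by
        refine tendsto_nhdsWithin_iff.2 ⟨?_, Eventually.of_forall fun n => ?_⟩
        · simpa using tendsto_one_div_add_atTop_nhds_zero_nat.const_add (t : ℝ)
        · have : (0 : ℝ) < 1 / ((n : ℝ) + 1) := by positivity
          simp only [Set.mem_Ici]; linarith
      have h3 := (((cdf ν).right_continuous (t : ℝ)).tendsto.comp h2).sub_const (cdf ν t)
      rw [sub_self] at h3
      refine h3.congr fun n => ?_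
      rw [integral_sub (hi _) (hi _), hν, hν]; simp
  filter_upwards [hmono, h0, h1, htop, hbot, hright] with ω hmono h0 h1 htop hbot hright
  refine ⟨hmono, ?_, ?_, fun t => le_antisymm ?_ ?_⟩
  · rw [tendsto_order]
    refine ⟨fun a ha => ?_, fun a ha => Eventually.of_forall fun q => (h1 q).trans_lt ha⟩
    obtain ⟨n, hn⟩ := htop (1 - a) (by linarith)
    filter_upwards [eventually_ge_atTop (n : ℚ)] with q hq
    linarith [hmono hq]
  · rw [tendsto_order]
    refine ⟨fun a ha => Eventually.of_forall fun q => ha.trans_le (h0 q), fun a ha => ?_⟩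
    obtain ⟨n, hn⟩ := hbot a ha
    filter_upwards [eventually_le_atBot (-(n : ℚ))] with q hq
    linarith [hmono hq]
  · refine le_of_forall_pos_lt_add fun ε hε => ?_
    obtain ⟨n, hn⟩ := hright t ε hε
    have hn0 : (0 : ℚ) < 1 / ((n : ℚ) + 1) := by positivity
    have := ciInf_le (f := fun r : Set.Ioi t => V ω r)
      ⟨0, by rintro _ ⟨r, rfl⟩; exact h0 _⟩ ⟨t + 1 / ((n : ℚ) + 1), by simpa using hn0⟩
    dsimp only at this
    linarith
  · have : Nonempty (Set.Ioi t) := ⟨⟨t + 1, by simp⟩⟩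
    exact le_ciInf fun r => hmono (le_of_lt r.2)

/-- A sequence of random probability measures with the martingale property. -/
structure IsMeasureMartingale {Θ : Type*} [MeasurableSpace Θ] (P : Measure Ω) (F : Filtration ℕ m0)
    (N : ℕ → Ω → Measure Θ) : Prop where
  measurable : ∀ n, Measurable[F n] (N n)
  univ_le_one : ∀ n ω, N n ω Set.univ ≤ 1
  univ_eq_one : ∀ᵐ ω ∂P, ∀ n, N n ω Set.univ = 1
  lintegral_succ : ∀ n B, MeasurableSet[F n] B → ∀ A, MeasurableSet A →
    ∫⁻ ω in B, N (n + 1) ω A ∂P = ∫⁻ ω in B, N n ω A ∂P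

namespace IsMeasureMartingale

variable {Θ : Type*} [MeasurableSpace Θ] {F : Filtration ℕ m0} {N : ℕ → Ω → Measure Θ}
  (h : IsMeasureMartingale P F N)
include h

lemma isFiniteMeasure (n : ℕ) (ω : Ω) : IsFiniteMeasure (N n ω) :=
  ⟨(h.univ_le_one n ω).trans_lt ENNReal.one_lt_top⟩

lemma apply_le_one (n : ℕ) (ω : Ω) (A : Set Θ) : N n ω A ≤ 1 :=
  (measure_mono (Set.subset_univ A)).trans (h.univ_le_one n ω)

lemma real_le_one (n : ℕ) (ω : Ω) (A : Set Θ) : (N n ω).real A ≤ 1 :=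
  ENNReal.toReal_le_of_le_ofReal zero_le_one (by simpa using h.apply_le_one n ω A)

lemma measurable_real (n : ℕ) {A : Set Θ} (hA : MeasurableSet A) :
    Measurable[F n] fun ω => (N n ω).real A :=
  ((Measure.measurable_coe hA).comp (h.measurable n)).ennreal_toReal

lemma lintegral_eq {n k : ℕ} (hnk : n ≤ k) {B : Set Ω} (hB : MeasurableSet[F n] B) {A : Set Θ}
    (hA : MeasurableSet A) : ∫⁻ ω in B, N k ω A ∂P = ∫⁻ ω in B, N n ω A ∂P := by
  induction k, hnk using Nat.le_induction with
  | base => rfl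
  | succ k hnk ih => rw [h.lintegral_succ k B (F.mono hnk B hB) A hA, ih]

lemma setIntegral_real (n : ℕ) (B : Set Ω) {A : Set Θ} (hA : MeasurableSet A) :
    ∫ ω in B, (N n ω).real A ∂P = (∫⁻ ω in B, N n ω A ∂P).toReal := by
  have hm : Measurable fun ω => N n ω A :=
    (Measure.measurable_coe hA).comp ((h.measurable n).mono (F.le n) le_rfl)
  exact integral_toReal hm.aemeasurable
    (ae_of_all _ fun ω => (h.apply_le_one n ω A).trans_lt ENNReal.one_lt_top)

variable [IsProbabilityMeasure P]

lemma martingale_real {A : Set Θ} (hA : MeasurableSet A) :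
    Martingale (fun n ω => (N n ω).real A) F P := by
  refine martingale_of_setIntegral_eq_succ (fun n => (h.measurable_real n hA).stronglyMeasurable)
    (fun n => ?_) fun n B hB => ?_
  · exact Integrable.of_bound (((h.measurable_real n hA).mono (F.le n) le_rfl).aestronglyMeasurable)
      1 (ae_of_all _ fun ω => by
        rw [Real.norm_of_nonneg measureReal_nonneg]; exact h.real_le_one n ω A)
  · rw [h.setIntegral_real n B hA, h.setIntegral_real (n + 1) B hA, h.lintegral_succ n B hB A hA]

lemma ae_tendsto_real {A : Set Θ} (hA : MeasurableSet A) :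
    ∀ᵐ ω ∂P, Tendsto (fun n => (N n ω).real A) atTop
      (𝓝 (limsup (fun n => (N n ω).real A) atTop)) := by
  suffices hc : ∀ᵐ ω ∂P, ∃ c, Tendsto (fun n => (N n ω).real A) atTop (𝓝 c) by
    filter_upwards [hc] with ω ⟨c, hc⟩
    rwa [hc.limsup_eq]
  refine (h.martingale_real hA).submartingale.exists_ae_tendsto_of_bdd (R := 1) fun n => ?_
  have := eLpNorm_le_of_ae_bound (p := 1) (μ := P) (f := fun ω => (N n ω).real A) (C := 1)
    (ae_of_all _ fun ω => by
      rw [Real.norm_of_nonneg measureReal_nonneg]; exact h.real_le_one n ω A)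
  simpa using this

/-- The integrals over `B` are constant from time `n` on, and bounded convergence passes this
constant to the limit. -/
lemma setLIntegral_limit {A : Set Θ} (hA : MeasurableSet A) {V : Ω → ℝ}
    (hV : ∀ᵐ ω ∂P, Tendsto (fun n => (N n ω).real A) atTop (𝓝 (V ω))) {n : ℕ} {B : Set Ω}
    (hB : MeasurableSet[F n] B) :
    ∫⁻ ω in B, ENNReal.ofReal (V ω) ∂P = ∫⁻ ω in B, N n ω A ∂P := by
  have h1 : Tendsto (fun k => ∫⁻ ω in B, N k ω A ∂P) atTop
      (𝓝 (∫⁻ ω in B, ENNReal.ofReal (V ω) ∂P)) := by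
    refine tendsto_lintegral_of_dominated_convergence (fun _ => 1)
      (fun k => (Measure.measurable_coe hA).comp ((h.measurable k).mono (F.le k) le_rfl))
      (fun k => ae_of_all _ fun ω => h.apply_le_one k ω A) (by simp) (ae_restrict_of_ae ?_)
    filter_upwards [hV] with ω hω
    refine (ENNReal.tendsto_ofReal hω).congr fun k => ?_
    have := h.isFiniteMeasure k ω
    exact ENNReal.ofReal_toReal (measure_ne_top _ _)
  refine tendsto_nhds_unique h1 (tendsto_const_nhds.congr' ?_)
  filter_upwards [eventually_ge_atTop n] with k hk
  rw [h.lintegral_eq hk hB hA]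

/-- The limit of a martingale of random probability measures. -/
theorem exists_limit [StandardBorelSpace Θ] [Nonempty Θ] :
    ∃ G : Ω → Measure Θ, Measurable[⨆ n, F n] G ∧ (∀ ω, IsProbabilityMeasure (G ω)) ∧
      ∀ n B, MeasurableSet[F n] B → ∀ A, MeasurableSet A →
        ∫⁻ ω in B, G ω A ∂P = ∫⁻ ω in B, N n ω A ∂P := by
  set e : Θ → ℝ := embeddingReal Θ with he
  have hem : MeasurableEmbedding e := measurableEmbedding_embeddingReal Θ
  have hAq : ∀ q : ℚ, MeasurableSet (e ⁻¹' Set.Iic (q : ℝ)) := fun q =>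
    hem.measurable measurableSet_Iic
  set V : Ω → ℚ → ℝ := fun ω q =>
    limsup (fun n => (N n ω).real (e ⁻¹' Set.Iic (q : ℝ))) atTop with hV
  have hle : ⨆ n, F n ≤ m0 := iSup_le fun n => F.le n
  have hVm : ∀ q, Measurable[⨆ n, F n] fun ω => V ω q := fun q =>
    Measurable.limsup fun n => (h.measurable_real n (hAq q)).mono (le_iSup F n) le_rfl
  have hVlim : ∀ᵐ ω ∂P, ∀ q : ℚ, Tendsto (fun n => (N n ω).real (e ⁻¹' Set.Iic (q : ℝ))) atTop
      (𝓝 (V ω q)) := ae_all_iff.2 fun q => h.ae_tendsto_real (hAq q)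
  have h0 : ∀ᵐ ω ∂P, ∀ q, 0 ≤ V ω q := by
    filter_upwards [hVlim] with ω hω q using ge_of_tendsto' (hω q) fun n => measureReal_nonneg
  have h1 : ∀ᵐ ω ∂P, ∀ q, V ω q ≤ 1 := by
    filter_upwards [hVlim] with ω hω q using le_of_tendsto' (hω q) fun n => h.real_le_one n ω _
  have hmono : ∀ᵐ ω ∂P, Monotone (V ω) := by
    filter_upwards [hVlim] with ω hω q r hqr
    refine le_of_tendsto_of_tendsto' (hω q) (hω r) fun n => ?_
    have := h.isFiniteMeasure n ω
    exact measureReal_mono (Set.preimage_mono (Set.Iic_subset_Iic.2 (by exact_mod_cast hqr)))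
  have hN0 : Measurable (N 0) := (h.measurable 0).mono (F.le 0) le_rfl
  have hbind : ∀ n (B : Set Ω) (A : Set Θ), MeasurableSet A →
      (P.restrict B).bind (N n) A = ∫⁻ ω in B, N n ω A ∂P := fun n B A hA =>
    Measure.bind_apply hA ((h.measurable n).mono (F.le n) le_rfl).aemeasurable
  have hN0univ : ∀ n (B : Set Ω), ∫⁻ ω in B, N n ω Set.univ ∂P = P B := fun n B => by
    have : ∀ᵐ ω ∂(P.restrict B), N n ω Set.univ = 1 := by
      filter_upwards [ae_restrict_of_ae h.univ_eq_one] with ω hω using hω n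
    rw [lintegral_congr_ae this]; simp
  have hst : ∀ᵐ ω ∂P, IsRatStieltjesPoint V ω := by
    have hp : IsProbabilityMeasure ((P.bind (N 0)).map e) := by
      refine ⟨?_⟩
      rw [Measure.map_apply hem.measurable MeasurableSet.univ, Set.preimage_univ]
      have h2 := hbind 0 Set.univ Set.univ MeasurableSet.univ
      rw [Measure.restrict_univ] at h2
      rw [h2]
      have h3 := hN0univ 0 Set.univ
      rw [Measure.restrict_univ] at h3
      rw [h3]; exact measure_univ
    refine ae_isRatStieltjesPoint (fun q => (hVm q).mono hle le_rfl) hmono h0 h1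
      ((P.bind (N 0)).map e) fun q => ?_
    rw [cdf_eq_real, Measure.real, Measure.map_apply hem.measurable measurableSet_Iic,
      Measure.bind_apply (hAq q) hN0.aemeasurable]
    have h2 := h.setLIntegral_limit (hAq q) (hVlim.mono fun ω hω => hω q) (n := 0)
      (@MeasurableSet.univ _ (F 0))
    rw [Measure.restrict_univ] at h2
    rw [← h2, integral_eq_lintegral_of_nonneg_ae (h0.mono fun ω hω => hω q)
      ((hVm q).mono hle le_rfl).aestronglyMeasurable]
  obtain ⟨K, hKm, hK1, hK⟩ := exists_measure_of_ratCDF (m := ⨆ n, F n)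
    (@measurable_pi_lambda _ _ _ (⨆ n, F n) _ _ hVm)
  obtain ⟨G, hGm, hG1, hG⟩ := exists_measure_of_measure_real (m := ⨆ n, F n) (Θ := Θ) hKm hK1
  have hKm0 : Measurable K := hKm.mono hle le_rfl
  -- Averaged over `B`, the limit and the transported `N n` agree on rational half-lines, a
  -- generating π-system, and have the same total mass; hence they agree on all Borel sets.
  have hKbind : ∀ n B, MeasurableSet[F n] B →
      (P.restrict B).bind K = ((P.restrict B).bind (N n)).map e := by
    intro n B hB
    have huniv : (P.restrict B).bind K Set.univ = P B := by
      rw [Measure.bind_apply MeasurableSet.univ hKm0.aemeasurable]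
      simp
    have : IsFiniteMeasure ((P.restrict B).bind K) := ⟨by rw [huniv]; exact measure_lt_top _ _⟩
    refine ext_of_generate_finite _ Real.borel_eq_generateFrom_Iic_rat Real.isPiSystem_Iic_rat
      (fun s hs => ?_) ?_
    · obtain ⟨q, hq⟩ := Set.mem_iUnion.1 hs
      rw [Set.mem_singleton_iff] at hq
      subst hq
      rw [Measure.bind_apply measurableSet_Iic hKm0.aemeasurable,
        Measure.map_apply hem.measurable measurableSet_Iic, hbind n B _ (hAq q),
        ← h.setLIntegral_limit (hAq q) (hVlim.mono fun ω hω => hω q) hB]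
      refine lintegral_congr_ae (ae_restrict_of_ae ?_)
      filter_upwards [hst] with ω hω using hK ω hω q
    · rw [huniv, Measure.map_apply hem.measurable MeasurableSet.univ, Set.preimage_univ,
        hbind n B _ MeasurableSet.univ, hN0univ]
  -- The mean of `K` is the image of a measure under `e`, so it does not charge the complement of
  -- the range; almost every realization then does not either.
  have hKr : ∀ᵐ ω ∂P, K ω (Set.range e)ᶜ = 0 := by
    have h2 := congr_arg (fun ρ : Measure ℝ => ρ (Set.range e)ᶜ)
      (hKbind 0 Set.univ (@MeasurableSet.univ _ (F 0)))
    have hms : MeasurableSet (Set.range e)ᶜ := hem.measurableSet_range.compl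
    simp only [Measure.restrict_univ] at h2
    rw [Measure.bind_apply hms hKm0.aemeasurable, Measure.map_apply hem.measurable hms,
      Set.preimage_compl, Set.preimage_range, Set.compl_univ,
      measure_empty] at h2
    have hKms : Measurable fun ω => K ω (Set.range e)ᶜ := (Measure.measurable_coe hms).comp hKm0
    exact (lintegral_eq_zero_iff hKms).1 h2
  refine ⟨G, hGm, hG1, fun n B hB A hA => ?_⟩
  have hA' : MeasurableSet (e '' A) := hem.measurableSet_image.2 hA
  have h2 : ∫⁻ ω in B, G ω A ∂P = ∫⁻ ω in B, K ω (e '' A) ∂P := by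
    refine lintegral_congr_ae (ae_restrict_of_ae ?_)
    filter_upwards [hKr] with ω hω using hG ω hω A hA
  rw [h2, ← Measure.bind_apply hA' hKm0.aemeasurable, hKbind n B hB,
    Measure.map_apply hem.measurable hA', Set.preimage_image_eq _ hem.injective, hbind n B A hA]

end IsMeasureMartingale

end RandomMeasure

/-! ### A convergence theorem with varying bounds. -/

/-- Dominated convergence with a convergent sequence of bounds. -/
lemma tendsto_integral_of_le_of_tendsto_integral {S : Type*} [MeasurableSpace S] {μ : Measure S}
    {g F : ℕ → S → ℝ} {g' F' : S → ℝ}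
    (hgm : ∀ n, AEStronglyMeasurable (g n) μ) (hF : ∀ n, Integrable (F n) μ)
    (hF' : Integrable F' μ) (h0 : ∀ n, ∀ᵐ x ∂μ, 0 ≤ g n x) (hgF : ∀ n, ∀ᵐ x ∂μ, g n x ≤ F n x)
    (hF0 : ∀ᵐ x ∂μ, g' x ≤ F' x)
    (hg : ∀ᵐ x ∂μ, Tendsto (fun n => g n x) atTop (𝓝 (g' x)))
    (hFt : ∀ᵐ x ∂μ, Tendsto (fun n => F n x) atTop (𝓝 (F' x)))
    (hi : Tendsto (fun n => ∫ x, F n x ∂μ) atTop (𝓝 (∫ x, F' x ∂μ))) :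
    Tendsto (fun n => ∫ x, g n x ∂μ) atTop (𝓝 (∫ x, g' x ∂μ)) := by
  have hF0' : ∀ᵐ x ∂μ, 0 ≤ F' x := by
    filter_upwards [hg, ae_all_iff.2 h0, hF0] with x h1 h2 h3
    exact (ge_of_tendsto' h1 h2).trans h3
  have hgi : ∀ n, Integrable (g n) μ := fun n => (hF n).mono' (hgm n) (by
    filter_upwards [h0 n, hgF n] with x h1 h2
    rwa [Real.norm_of_nonneg h1])
  -- Truncation at `F'` puts the sequence under a single integrable bound.
  have hmin : ∀ (u : ℕ → S → ℝ) (u' : S → ℝ), (∀ n, AEStronglyMeasurable (u n) μ) →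
      (∀ n, ∀ᵐ x ∂μ, 0 ≤ u n x) → (∀ᵐ x ∂μ, u' x ≤ F' x) →
      (∀ᵐ x ∂μ, Tendsto (fun n => u n x) atTop (𝓝 (u' x))) →
      Tendsto (fun n => ∫ x, min (u n x) (F' x) ∂μ) atTop (𝓝 (∫ x, u' x ∂μ)) := by
    intro u u' hum hu0 hu' hu
    refine tendsto_integral_of_dominated_convergence F' (fun n => (hum n).inf hF'.1) hF'
      (fun n => ?_) ?_
    · filter_upwards [hu0 n, hF0'] with x h1 h2
      rw [Real.norm_of_nonneg (le_min h1 h2)]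
      exact min_le_right _ _
    · filter_upwards [hu, hu'] with x h1 h2
      have := h1.min (tendsto_const_nhds (x := F' x))
      rwa [min_eq_left h2] at this
  have h1 := hmin g g' hgm h0 hF0 hg
  have h2 := hmin F F' (fun n => (hF n).1) (fun n => by
    filter_upwards [h0 n, hgF n] with x h1 h2 using h1.trans h2) (ae_of_all _ fun _ => le_rfl) hFt
  have h3 : Tendsto (fun n => ∫ x, F n x ∂μ - ∫ x, min (F n x) (F' x) ∂μ) atTop (𝓝 0) := by
    simpa using hi.sub h2
  have hgm' : ∀ n, Integrable (fun x => min (g n x) (F' x)) μ := fun n => (hgi n).inf hF'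
  have hFm' : ∀ n, Integrable (fun x => min (F n x) (F' x)) μ := fun n => (hF n).inf hF'
  have h4 : Tendsto (fun n => ∫ x, g n x ∂μ - ∫ x, min (g n x) (F' x) ∂μ) atTop (𝓝 0) := by
    refine squeeze_zero (fun n => ?_) (fun n => ?_) h3
    · exact sub_nonneg.2 (integral_mono (hgm' n) (hgi n) fun x => min_le_left _ _)
    · rw [← integral_sub (hgi n) (hgm' n), ← integral_sub (hF n) (hFm' n)]
      -- The part cut off from `g n` is at most the part cut off from `F n`, whose integral tends to
      -- zero.
      refine integral_mono_ae ((hgi n).sub (hgm' n)) ((hF n).sub (hFm' n)) ?_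
      filter_upwards [hgF n] with x hx
      rcases le_total (g n x) (F' x) with h | h
      · simp only [min_eq_left h, sub_self, sub_nonneg]
        exact min_le_left _ _
      · simp only [min_eq_right h, min_eq_right (h.trans hx)]
        linarith
  simpa using h4.add h1

/-! ### The predictive covariance matrix: measurability, positivity, continuity. -/

section Covariance

variable {𝕏 Θ Ω : Type*} [MeasurableSpace 𝕏] [MeasurableSpace Θ] {m : MeasurableSpace Ω}
  {μ : Measure 𝕏} [SigmaFinite μ] {f : 𝕏 → Θ → ℝ≥0} {H : Measure Θ} {k : ℕ} {A : Fin k → Set Θ}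

lemma measurable_bayes_real (hf : Measurable (Function.uncurry f)) {N : Ω → Measure Θ}
    (hN : Measurable N) (hN1 : ∀ ω, N ω Set.univ ≤ 1) {x : Ω → 𝕏} (hx : Measurable x) {A : Set Θ}
    (hA : MeasurableSet A) : Measurable fun ω => (bayes f (N ω) (x ω)).real A :=
  ((Measure.measurable_coe hA).comp (measurable_bayes hf hN hN1 hx)).ennreal_toReal

lemma measurable_bayes_real_right (hf : Measurable (Function.uncurry f)) (hH : H Set.univ ≤ 1)
    {A : Set Θ} (hA : MeasurableSet A) : Measurable fun x => (bayes f H x).real A :=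
  measurable_bayes_real (N := fun _ => H) hf measurable_const (fun _ => hH) measurable_id hA

/-- The restriction to `f_H ≠ 0` is harmless because `F_H` does not charge the zeros of its own
density. -/
lemma covMatrix_apply [IsFiniteMeasure H] (hf : Measurable (Function.uncurry f))
    (hf1 : ∀ t, ∫⁻ x, (f x t : ℝ≥0∞) ∂μ = 1) (i j : Fin k) :
    covMatrix μ f A H i j = (∫ x, (bayes f H x).real (A i) * (bayes f H x).real (A j)
      ∂(mixDistrib μ f H)) - H.real (A i) * H.real (A j) := by
  rw [covMatrix, Matrix.of_apply]
  congr 1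
  rw [Measure.restrict_eq_self_of_ae_mem]
  filter_upwards [ae_mixDistrib hf hf1] with x hx using hx.1

lemma integral_mixDistrib [IsFiniteMeasure H] (hf : Measurable (Function.uncurry f))
    (hf1 : ∀ t, ∫⁻ x, (f x t : ℝ≥0∞) ∂μ = 1) (g : 𝕏 → ℝ) :
    ∫ x, g x ∂(mixDistrib μ f H) = ∫ x, g x * (mixDensity f H x).toReal ∂μ := by
  rw [mixDistrib, integral_withDensity_eq_integral_toReal_smul (measurable_mixDensity hf)
    (ae_mixDensity_lt_top hf hf1)]
  simp_rw [smul_eq_mul, mul_comm]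

lemma measurable_covMatrix (hf : Measurable (Function.uncurry f))
    (hf1 : ∀ t, ∫⁻ x, (f x t : ℝ≥0∞) ∂μ = 1) (hA : ∀ i, MeasurableSet (A i))
    {N : Ω → Measure Θ} (hN : Measurable N) (hN1 : ∀ ω, N ω Set.univ ≤ 1) (i j : Fin k) :
    Measurable fun ω => covMatrix μ f A (N ω) i j := by
  have hfin : ∀ ω, IsFiniteMeasure (N ω) := fun ω => ⟨(hN1 ω).trans_lt ENNReal.one_lt_top⟩
  simp_rw [covMatrix_apply hf hf1, integral_mixDistrib hf hf1]
  have hN' : Measurable fun p : Ω × 𝕏 => N p.1 := hN.comp measurable_fst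
  have hr : ∀ i, Measurable fun ω => (N ω).real (A i) := fun i =>
    ((Measure.measurable_coe (hA i)).comp hN).ennreal_toReal
  have hb : ∀ i, Measurable fun p : Ω × 𝕏 => (bayes f (N p.1) p.2).real (A i) := fun i =>
    measurable_bayes_real hf hN' (fun p => hN1 p.1) measurable_snd (hA i)
  have hd : Measurable fun p : Ω × 𝕏 => (mixDensity f (N p.1) p.2).toReal :=
    (measurable_mixDensity_measure hf hN' (fun p => hN1 p.1) measurable_snd).ennreal_toReal
  refine Measurable.sub ?_ ((hr i).mul (hr j))
  exact (StronglyMeasurable.integral_prod_right'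
    (f := fun p : Ω × 𝕏 => (bayes f (N p.1) p.2).real (A i) * (bayes f (N p.1) p.2).real (A j)
      * (mixDensity f (N p.1) p.2).toReal)
    (((hb i).mul (hb j)).mul hd).stronglyMeasurable).measurable

lemma abs_covMatrix_le (hH : H Set.univ ≤ 1) (hf : Measurable (Function.uncurry f))
    (hf1 : ∀ t, ∫⁻ x, (f x t : ℝ≥0∞) ∂μ = 1) (i j : Fin k) : |covMatrix μ f A H i j| ≤ 1 := by
  have : IsFiniteMeasure H := ⟨hH.trans_lt ENNReal.one_lt_top⟩
  have := isFiniteMeasure_mixDistrib (H := H) hf hf1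
  have hr : ∀ i, H.real (A i) ≤ 1 := fun i =>
    ENNReal.toReal_le_of_le_ofReal zero_le_one
      (by simpa using (measure_mono (Set.subset_univ _)).trans hH)
  have h1 : H.real (A i) * H.real (A j) ≤ 1 := mul_le_one₀ (hr i) measureReal_nonneg (hr j)
  have h2 : 0 ≤ H.real (A i) * H.real (A j) := mul_nonneg measureReal_nonneg measureReal_nonneg
  rw [covMatrix_apply hf hf1]
  have h3 : 0 ≤ ∫ x, (bayes f H x).real (A i) * (bayes f H x).real (A j) ∂(mixDistrib μ f H) :=
    integral_nonneg fun x => mul_nonneg measureReal_nonneg measureReal_nonneg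
  have h4 : ∫ x, (bayes f H x).real (A i) * (bayes f H x).real (A j) ∂(mixDistrib μ f H) ≤ 1 := by
    refine (le_abs_self _).trans ?_
    have h5 := norm_integral_le_of_norm_le_const (μ := mixDistrib μ f H) (C := 1)
      (f := fun x => (bayes f H x).real (A i) * (bayes f H x).real (A j)) (ae_of_all _ fun x => by
        rw [Real.norm_of_nonneg (mul_nonneg measureReal_nonneg measureReal_nonneg)]
        exact mul_le_one₀ (bayes_real_le_one x _) measureReal_nonneg (bayes_real_le_one x _))
    refine h5.trans ?_
    rw [one_mul, Measure.real, mixDistrib_univ hf hf1]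
    exact ENNReal.toReal_le_of_le_ofReal zero_le_one (by simpa using hH)
  rw [abs_le]; constructor <;> linarith

lemma integral_bayes_real [IsProbabilityMeasure H] (hf : Measurable (Function.uncurry f))
    (hf1 : ∀ t, ∫⁻ x, (f x t : ℝ≥0∞) ∂μ = 1) {A : Set Θ} (hA : MeasurableSet A) :
    ∫ x, (bayes f H x).real A ∂(mixDistrib μ f H) = H.real A := by
  have hm : Measurable fun x => bayes f H x A :=
    (Measure.measurable_coe hA).comp
      (measurable_bayes (N := fun _ => H) hf measurable_const (by simp) measurable_id)
  have h1 := lintegral_lintegral_bayes (H := H) hf hf1 (h := A.indicator 1)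
    (measurable_one.indicator hA)
  simp only [lintegral_indicator_one hA] at h1
  unfold Measure.real
  rw [integral_toReal hm.aemeasurable (ae_of_all _ fun x => measure_lt_top _ _), mixDistrib,
    lintegral_withDensity_eq_lintegral_mul _ (measurable_mixDensity hf) hm, ← h1]
  simp_rw [Pi.mul_apply, mul_comm]

/-- The quadratic form of the covariance matrix is the variance of the Bayes update. -/
lemma covMatrix_quadForm [IsProbabilityMeasure H] (hf : Measurable (Function.uncurry f))
    (hf1 : ∀ t, ∫⁻ x, (f x t : ℝ≥0∞) ∂μ = 1) (hA : ∀ i, MeasurableSet (A i)) (t : Fin k → ℝ) :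
    t ⬝ᵥ (covMatrix μ f A H).mulVec t
      = ∫ x, (∑ i, t i * ((bayes f H x).real (A i) - H.real (A i))) ^ 2 ∂(mixDistrib μ f H) := by
  have hF : IsProbabilityMeasure (mixDistrib μ f H) := ⟨by simp [mixDistrib_univ hf hf1]⟩
  have hm : ∀ i, Measurable fun x => (bayes f H x).real (A i) := fun i =>
    measurable_bayes_real_right hf (by simp) (hA i)
  have hi : ∀ i, Integrable (fun x => (bayes f H x).real (A i)) (mixDistrib μ f H) := fun i =>
    Integrable.of_bound (hm i).aestronglyMeasurable 1 (ae_of_all _ fun x => by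
      rw [Real.norm_of_nonneg measureReal_nonneg]; exact bayes_real_le_one x _)
  have hij : ∀ i j, Integrable (fun x => (bayes f H x).real (A i) * (bayes f H x).real (A j))
      (mixDistrib μ f H) := fun i j =>
    Integrable.of_bound ((hm i).mul (hm j)).aestronglyMeasurable 1 (ae_of_all _ fun x => by
      rw [Real.norm_of_nonneg (mul_nonneg measureReal_nonneg measureReal_nonneg)]
      exact mul_le_one₀ (bayes_real_le_one x _) measureReal_nonneg (bayes_real_le_one x _))
  have hcov : ∀ i j, Integrable (fun x => t i * ((bayes f H x).real (A i) - H.real (A i))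
      * (t j * ((bayes f H x).real (A j) - H.real (A j)))) (mixDistrib μ f H) ∧
      ∫ x, t i * ((bayes f H x).real (A i) - H.real (A i))
      * (t j * ((bayes f H x).real (A j) - H.real (A j))) ∂(mixDistrib μ f H)
      = t i * (covMatrix μ f A H i j * t j) := by
    intro i j
    have e : (fun x => t i * ((bayes f H x).real (A i) - H.real (A i))
        * (t j * ((bayes f H x).real (A j) - H.real (A j))))
        = fun x => t i * t j * ((bayes f H x).real (A i) * (bayes f H x).real (A j)
          - (bayes f H x).real (A i) * H.real (A j)
          - H.real (A i) * (bayes f H x).real (A j) + H.real (A i) * H.real (A j)) := by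
      ext x; ring
    have i1 := (hi i).mul_const (H.real (A j))
    have i2 := (hi j).const_mul (H.real (A i))
    have i3 : Integrable (fun x => (bayes f H x).real (A i) * (bayes f H x).real (A j)
        - (bayes f H x).real (A i) * H.real (A j)) (mixDistrib μ f H) := (hij i j).sub i1
    have i4 : Integrable (fun x => (bayes f H x).real (A i) * (bayes f H x).real (A j)
        - (bayes f H x).real (A i) * H.real (A j)
        - H.real (A i) * (bayes f H x).real (A j)) (mixDistrib μ f H) := i3.sub i2
    rw [e]
    refine ⟨(i4.add (integrable_const _)).const_mul _, ?_⟩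
    rw [integral_const_mul, integral_add i4 (integrable_const _), integral_sub i3 i2, integral_sub (hij i j) i1, integral_mul_const,
      integral_const_mul, integral_bayes_real hf hf1 (hA i), integral_bayes_real hf hf1 (hA j),
      integral_const, covMatrix_apply hf hf1]
    simp; ring
  simp_rw [pow_two, Finset.sum_mul_sum]
  rw [integral_finsetSum _ fun i _ => integrable_finsetSum _ fun j _ => (hcov i j).1]
  simp only [dotProduct, Matrix.mulVec, Finset.mul_sum]
  refine Finset.sum_congr rfl fun i _ => ?_
  rw [integral_finsetSum _ fun j _ => (hcov i j).1]
  exact Finset.sum_congr rfl fun j _ => ((hcov i j).2).symm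

lemma posSemidef_covMatrix [IsProbabilityMeasure H] (hf : Measurable (Function.uncurry f))
    (hf1 : ∀ t, ∫⁻ x, (f x t : ℝ≥0∞) ∂μ = 1) (hA : ∀ i, MeasurableSet (A i)) :
    (covMatrix μ f A H).PosSemidef := by
  refine Matrix.PosSemidef.of_dotProduct_mulVec_nonneg ?_ fun t => ?_
  · ext i j
    simp only [Matrix.conjTranspose_apply, covMatrix_apply hf hf1, star_trivial]
    simp_rw [mul_comm]
  · rw [star_trivial, covMatrix_quadForm hf hf1 hA]
    exact integral_nonneg fun x => sq_nonneg _

/-- Pointwise convergence of the mixture densities implies convergence of the covariances. -/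
lemma tendsto_covMatrix {N : ℕ → Measure Θ} (hN : ∀ n, N n Set.univ = 1) [IsProbabilityMeasure H]
    (hf : Measurable (Function.uncurry f)) (hf1 : ∀ t, ∫⁻ x, (f x t : ℝ≥0∞) ∂μ = 1)
    (hA : ∀ i, MeasurableSet (A i))
    (hNA : ∀ i, Tendsto (fun n => (N n).real (A i)) atTop (𝓝 (H.real (A i))))
    (hmix : ∀ᵐ x ∂μ, Tendsto (fun n => mixDensity f (N n) x) atTop (𝓝 (mixDensity f H x)))
    (hmixA : ∀ᵐ x ∂μ, ∀ i, Tendsto (fun n => ∫⁻ t in A i, f x t ∂(N n)) atTop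
      (𝓝 (∫⁻ t in A i, f x t ∂H))) (i j : Fin k) :
    Tendsto (fun n => covMatrix μ f A (N n) i j) atTop (𝓝 (covMatrix μ f A H i j)) := by
  have hp : ∀ n, IsProbabilityMeasure (N n) := fun n => ⟨hN n⟩
  simp_rw [covMatrix_apply hf hf1, integral_mixDistrib hf hf1]
  refine Tendsto.sub ?_ ((hNA i).mul (hNA j))
  have hint : ∀ H' : Measure Θ, IsProbabilityMeasure H' →
      Integrable (fun x => (mixDensity f H' x).toReal) μ ∧
        ∫ x, (mixDensity f H' x).toReal ∂μ = 1 := fun H' _ => by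
    refine ⟨integrable_toReal_of_lintegral_ne_top (measurable_mixDensity hf).aemeasurable
      (by rw [lintegral_mixDensity hf hf1]; simp), ?_⟩
    rw [integral_toReal (measurable_mixDensity hf).aemeasurable (ae_mixDensity_lt_top hf hf1),
      lintegral_mixDensity hf hf1]
    simp
  have hle : ∀ (H' : Measure Θ) (x : 𝕏), 0 ≤ (bayes f H' x).real (A i)
      * (bayes f H' x).real (A j) * (mixDensity f H' x).toReal ∧ (bayes f H' x).real (A i)
      * (bayes f H' x).real (A j) * (mixDensity f H' x).toReal ≤ (mixDensity f H' x).toReal :=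
    fun H' x => ⟨by positivity, mul_le_of_le_one_left ENNReal.toReal_nonneg
      (mul_le_one₀ (bayes_real_le_one x _) measureReal_nonneg (bayes_real_le_one x _))⟩
  have hfinH : ∀ᵐ x ∂μ, mixDensity f H x < ∞ := ae_mixDensity_lt_top hf hf1
  have hmixR : ∀ᵐ x ∂μ, Tendsto (fun n => (mixDensity f (N n) x).toReal) atTop
      (𝓝 (mixDensity f H x).toReal) := by
    filter_upwards [hmix, hfinH] with x hx hH using (ENNReal.tendsto_toReal hH.ne).comp hx
  -- The bounds are the mixture densities themselves: they converge pointwise and all have integral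
  -- one, so no fixed dominating function is needed.
  refine tendsto_integral_of_le_of_tendsto_integral
    (F := fun n x => (mixDensity f (N n) x).toReal)
    (F' := fun x => (mixDensity f H x).toReal) (fun n => ?_)
    (fun n => (hint (N n) (hp n)).1) (hint H inferInstance).1
    (fun n => ae_of_all _ fun x => (hle (N n) x).1) (fun n => ae_of_all _ fun x => (hle (N n) x).2)
    (ae_of_all _ fun x => (hle H x).2) ?_ hmixR ?_
  · exact (((measurable_bayes_real_right hf (hN n).le (hA i)).mul
      (measurable_bayes_real_right hf (hN n).le (hA j))).mul
        (measurable_mixDensity hf).ennreal_toReal).aestronglyMeasurable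
  · filter_upwards [hmix, hmixA, hmixR, hfinH] with x h1 h2 h3 h4
    -- Where the limiting density vanishes the posterior need not converge, but the integrand is
    -- squeezed by the density; elsewhere the quotient defining the posterior is continuous.
    by_cases h0 : mixDensity f H x = 0
    · rw [h0, ENNReal.toReal_zero] at h3
      rw [h0, ENNReal.toReal_zero, mul_zero]
      exact squeeze_zero (fun n => (hle (N n) x).1) (fun n => (hle (N n) x).2) h3
    · have hb : ∀ i, Tendsto (fun n => (bayes f (N n) x).real (A i)) atTop
          (𝓝 ((bayes f H x).real (A i))) := by
        intro i
        refine (ENNReal.tendsto_toReal (measure_ne_top _ _)).comp ?_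
        simp_rw [bayes_apply (hA i)]
        refine ENNReal.Tendsto.mul (tendsto_inv_iff.2 h1) (Or.inl ?_) (h2 i) (Or.inr ?_)
        · exact ENNReal.inv_ne_zero.2 h4.ne
        · exact ENNReal.inv_ne_top.2 h0
      exact ((hb i).mul (hb j)).mul h3
  · simp_rw [(hint _ (hp _)).2, (hint H inferInstance).2]
    exact tendsto_const_nhds

end Covariance

/-! ### Convergence of integrals and weak convergence along a measure-valued martingale. -/

namespace IsMeasureMartingale

variable {Ω Θ : Type*} {m0 : MeasurableSpace Ω} [MeasurableSpace Θ] {P : Measure Ω}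
  {F : Filtration ℕ m0} {N : ℕ → Ω → Measure Θ} (h : IsMeasureMartingale P F N)
  {G : Ω → Measure Θ}
include h

/-- The two averages over `B` coincide as measures on `Θ`, hence give every nonnegative function the
same integral. -/
lemma setLIntegral_lintegral_limit (hGm : Measurable[⨆ n, F n] G)
    (hG : ∀ n B, MeasurableSet[F n] B → ∀ A, MeasurableSet A →
      ∫⁻ ω in B, G ω A ∂P = ∫⁻ ω in B, N n ω A ∂P) {n : ℕ} {B : Set Ω}
    (hB : MeasurableSet[F n] B) {φ : Θ → ℝ≥0∞} (hφ : Measurable φ) :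
    ∫⁻ ω in B, ∫⁻ t, φ t ∂(G ω) ∂P = ∫⁻ ω in B, ∫⁻ t, φ t ∂(N n ω) ∂P := by
  have hle : ⨆ n, F n ≤ m0 := iSup_le fun n => F.le n
  have hGm' : AEMeasurable G (P.restrict B) := (hGm.mono hle le_rfl).aemeasurable
  have hNm : AEMeasurable (N n) (P.restrict B) := ((h.measurable n).mono (F.le n) le_rfl).aemeasurable
  rw [← Measure.lintegral_bind hGm' hφ.aemeasurable, ← Measure.lintegral_bind hNm hφ.aemeasurable]
  congr 1
  ext A hA
  rw [Measure.bind_apply hA hGm', Measure.bind_apply hA hNm, hG n B hB A hA]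

/-- The integrals against `N n` are the conditional expectations of the integral against `G`, so
Lévy's upward theorem applies. Unbounded `φ` are allowed because `φ = f(x|·)` is needed later. -/
lemma ae_tendsto_lintegral [IsProbabilityMeasure P] (hGm : Measurable[⨆ n, F n] G)
    (hG : ∀ n B, MeasurableSet[F n] B → ∀ A, MeasurableSet A →
      ∫⁻ ω in B, G ω A ∂P = ∫⁻ ω in B, N n ω A ∂P) {φ : Θ → ℝ≥0∞} (hφ : Measurable φ)
    (hfin : ∫⁻ ω, ∫⁻ t, φ t ∂(N 0 ω) ∂P ≠ ∞) :
    ∀ᵐ ω ∂P, Tendsto (fun n => ∫⁻ t, φ t ∂(N n ω)) atTop (𝓝 (∫⁻ t, φ t ∂(G ω))) := by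
  have hle : ⨆ n, F n ≤ m0 := iSup_le fun n => F.le n
  have hgm : Measurable[⨆ n, F n] fun ω => ∫⁻ t, φ t ∂(G ω) :=
    (Measure.measurable_lintegral hφ).comp hGm
  have hnm : ∀ n, Measurable[F n] fun ω => ∫⁻ t, φ t ∂(N n ω) := fun n =>
    (Measure.measurable_lintegral hφ).comp (h.measurable n)
  have hset := fun n (B : Set Ω) (hB : MeasurableSet[F n] B) =>
    h.setLIntegral_lintegral_limit hGm hG hB hφ
  have hGfin : ∫⁻ ω, ∫⁻ t, φ t ∂(G ω) ∂P ≠ ∞ := by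
    have := hset 0 Set.univ (@MeasurableSet.univ _ (F 0))
    rw [Measure.restrict_univ] at this
    rwa [this]
  have hNfin : ∀ n, ∫⁻ ω, ∫⁻ t, φ t ∂(N n ω) ∂P ≠ ∞ := fun n => by
    have := hset n Set.univ (@MeasurableSet.univ _ (F n))
    rw [Measure.restrict_univ] at this
    rwa [← this]
  have hgi : Integrable (fun ω => (∫⁻ t, φ t ∂(G ω)).toReal) P :=
    integrable_toReal_of_lintegral_ne_top (hgm.mono hle le_rfl).aemeasurable hGfin
  have hni : ∀ n, Integrable (fun ω => (∫⁻ t, φ t ∂(N n ω)).toReal) P := fun n =>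
    integrable_toReal_of_lintegral_ne_top ((hnm n).mono (F.le n) le_rfl).aemeasurable (hNfin n)
  have hGlt : ∀ᵐ ω ∂P, ∫⁻ t, φ t ∂(G ω) < ∞ := ae_lt_top (hgm.mono hle le_rfl) hGfin
  have hNlt : ∀ᵐ ω ∂P, ∀ n, ∫⁻ t, φ t ∂(N n ω) < ∞ :=
    ae_all_iff.2 fun n => ae_lt_top ((hnm n).mono (F.le n) le_rfl) (hNfin n)
  have hcond : ∀ n, (fun ω => (∫⁻ t, φ t ∂(N n ω)).toReal)
      =ᵐ[P] P[fun ω => (∫⁻ t, φ t ∂(G ω)).toReal | F n] := fun n => by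
    refine ae_eq_condExp_of_forall_setIntegral_eq (F.le n) hgi (fun s _ _ => (hni n).integrableOn)
      (fun s hs _ => ?_) (hnm n).ennreal_toReal.aestronglyMeasurable
    rw [integral_toReal ((hnm n).mono (F.le n) le_rfl).aemeasurable
      (ae_restrict_of_ae (hNlt.mono fun ω hω => hω n)),
      integral_toReal (hgm.mono hle le_rfl).aemeasurable (ae_restrict_of_ae hGlt), hset n s hs]
  have hlim := hgi.tendsto_ae_condExp (ℱ := F) hgm.ennreal_toReal.stronglyMeasurable
  filter_upwards [hlim, ae_all_iff.2 hcond, hNlt, hGlt] with ω h1 h2 h3 h4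
  have h5 : Tendsto (fun n => (∫⁻ t, φ t ∂(N n ω)).toReal) atTop
      (𝓝 (∫⁻ t, φ t ∂(G ω)).toReal) := h1.congr fun n => (h2 n).symm
  exact (ENNReal.tendsto_toReal_iff (fun n => (h3 n).ne) h4.ne).1 h5

lemma ae_tendsto_apply [IsProbabilityMeasure P] (hGm : Measurable[⨆ n, F n] G)
    (hG : ∀ n B, MeasurableSet[F n] B → ∀ A, MeasurableSet A →
      ∫⁻ ω in B, G ω A ∂P = ∫⁻ ω in B, N n ω A ∂P) {A : Set Θ} (hA : MeasurableSet A) :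
    ∀ᵐ ω ∂P, Tendsto (fun n => N n ω A) atTop (𝓝 (G ω A)) := by
  have := h.ae_tendsto_lintegral hGm hG (φ := A.indicator 1) (measurable_one.indicator hA) (by
    simp only [lintegral_indicator_one hA]
    refine ((lintegral_mono fun ω => h.apply_le_one 0 ω A).trans_lt ?_).ne
    simp)
  simpa only [lintegral_indicator_one hA] using this

/-- A martingale of random probability measures converges weakly almost surely. -/
lemma ae_tendsto_weak [IsProbabilityMeasure P] [TopologicalSpace Θ] [SecondCountableTopology Θ]
    [OpensMeasurableSpace Θ] (hGm : Measurable[⨆ n, F n] G) (hG1 : ∀ ω, IsProbabilityMeasure (G ω))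
    (hG : ∀ n B, MeasurableSet[F n] B → ∀ A, MeasurableSet A →
      ∫⁻ ω in B, G ω A ∂P = ∫⁻ ω in B, N n ω A ∂P) :
    ∀ᵐ ω ∂P, ∀ g : Θ →ᵇ ℝ, Tendsto (fun n => ∫ t, g t ∂(N n ω)) atTop (𝓝 (∫ t, g t ∂(G ω))) := by
  obtain ⟨b, hbc, -, hb⟩ := TopologicalSpace.exists_countable_basis Θ
  -- Finite intersections of a countable basis form a countable π-system. One null set therefore
  -- covers all of them, and convergence on them already implies weak convergence.
  set S : Set (Set Θ) := (fun c : Set (Set Θ) => ⋂₀ c) '' {c | c.Finite ∧ c ⊆ b} with hS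
  have hSc : S.Countable := (Set.countable_ofPred_finite_subset hbc).image _
  have hSo : ∀ s ∈ S, IsOpen s := by
    rintro _ ⟨c, ⟨hc, hcb⟩, rfl⟩
    exact hc.isOpen_sInter fun s hs => hb.isOpen (hcb hs)
  have hSpi : IsPiSystem S := by
    rintro _ ⟨c, ⟨hc, hcb⟩, rfl⟩ _ ⟨d, ⟨hd, hdb⟩, rfl⟩ -
    exact ⟨c ∪ d, ⟨hc.union hd, Set.union_subset hcb hdb⟩, Set.sInter_union _ _⟩
  have hlim : ∀ᵐ ω ∂P, ∀ s ∈ S, Tendsto (fun n => N n ω s) atTop (𝓝 (G ω s)) :=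
    (ae_ball_iff hSc).2 fun s hs => h.ae_tendsto_apply hGm hG (hSo s hs).measurableSet
  filter_upwards [hlim, h.univ_eq_one] with ω hω h1
  have hp : ∀ n, IsProbabilityMeasure (N n ω) := fun n => ⟨h1 n⟩
  have := hG1 ω
  have key := hSpi.tendsto_probabilityMeasure_of_tendsto_of_mem (l := atTop)
    (μ := fun n => (⟨N n ω, hp n⟩ : ProbabilityMeasure Θ)) (ν := ⟨G ω, hG1 ω⟩)
    (fun s hs => (hSo s hs).measurableSet) (fun u hu x hx => ?_) fun s hs => ?_
  · exact ProbabilityMeasure.tendsto_iff_forall_integral_tendsto.1 key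
  · obtain ⟨v, hv, hxv, hvu⟩ := hb.exists_subset_of_mem_open hx hu
    exact ⟨v, ⟨{v}, ⟨Set.finite_singleton v, by simpa using hv⟩, Set.sInter_singleton v⟩,
      (hb.isOpen hv).mem_nhds hxv, hvu⟩
  · exact (ENNReal.tendsto_toNNReal (measure_ne_top (G ω) s)).comp (hω s hs)

end IsMeasureMartingale

/-! ### Newton's recursion as a measure-valued martingale, and its limit. -/

section Model

variable {𝕏 Θ Ω : Type*} [MeasurableSpace 𝕏] [MeasurableSpace Θ] [MeasurableSpace Ω]
  [StandardBorelSpace 𝕏] [Nonempty 𝕏] [StandardBorelSpace Θ] [Nonempty Θ]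
  {P : Measure Ω} [IsProbabilityMeasure P] {μ : Measure 𝕏} [SigmaFinite μ]
  {f : 𝕏 → Θ → ℝ≥0} {α : ℕ → ℝ}
  {G₀ : Measure Θ} [IsProbabilityMeasure G₀] {X : ℕ → Ω → 𝕏} {θ : ℕ → Ω → Θ}

omit [StandardBorelSpace 𝕏] [Nonempty 𝕏] [StandardBorelSpace Θ] [Nonempty Θ] in
lemma lintegral_bayes_mixDistrib {H : Measure Θ} (hH : H Set.univ ≤ 1)
    (hf : Measurable (Function.uncurry f))
    (hf1 : ∀ t, ∫⁻ x, (f x t : ℝ≥0∞) ∂μ = 1) {A : Set Θ} (hA : MeasurableSet A) :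
    ∫⁻ x, bayes f H x A ∂(mixDistrib μ f H) = H A := by
  have : IsFiniteMeasure H := ⟨hH.trans_lt ENNReal.one_lt_top⟩
  have hm : Measurable fun x => bayes f H x A :=
    (Measure.measurable_coe hA).comp
      (measurable_bayes (N := fun _ => H) hf measurable_const (fun _ => hH) measurable_id)
  have h1 := lintegral_lintegral_bayes (H := H) hf hf1 (h := A.indicator 1)
    (measurable_one.indicator hA)
  simp only [lintegral_indicator_one hA] at h1
  rw [mixDistrib, lintegral_withDensity_eq_lintegral_mul _ (measurable_mixDensity hf) hm, ← h1]
  simp_rw [Pi.mul_apply, mul_comm]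

namespace IsNewtonModel

variable (hM : IsNewtonModel P μ f α G₀ X θ) (hf : Measurable (Function.uncurry f))
    (hf1 : ∀ t, ∫⁻ x, (f x t : ℝ≥0∞) ∂μ = 1) (hα : ∀ n, 1 ≤ n → 0 < α n ∧ α n < 1)
include hM hf hα

omit [SigmaFinite μ] in
lemma measurable_newtonMeasure_filtration (n : ℕ) :
    Measurable[historyFiltration hM.measurable_obs n]
      fun ω => newtonMeasure f α G₀ (fun i => X i ω) n := by
  have h := (measurable_newtonMeasure_pathOf (f := f) (α := α) (G₀ := G₀) hf hα n).comp
    (comap_measurable (history X n))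
  have e : (fun h : Fin n → 𝕏 => newtonMeasure f α G₀ (pathOf h) n) ∘ history X n
      = fun ω => newtonMeasure f α G₀ (fun i => X i ω) n := by
    ext1 ω; exact newtonMeasure_pathOf_history n ω
  rwa [e] at h

include hf1

/-- Points of density `0` or `∞` are null for `F_{G_n}`, which is the conditional law of the next
observation. Hence almost surely no update along the observed path loses mass. -/
lemma ae_mixDensity_obs (n : ℕ) : ∀ᵐ ω ∂P,
    mixDensity f (newtonMeasure f α G₀ (fun i => X i ω) n) (X (n + 1) ω) ≠ 0 ∧
      mixDensity f (newtonMeasure f α G₀ (fun i => X i ω) n) (X (n + 1) ω) ≠ ∞ := by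
  have hmix : Measurable fun p : (Fin n → 𝕏) × 𝕏 =>
      mixDensity f (newtonMeasure f α G₀ (pathOf p.1) n) p.2 :=
    measurable_mixDensity_measure hf ((measurable_newtonMeasure_pathOf hf hα n).comp measurable_fst)
      (fun p => newtonMeasure_univ_le_one hα _ n) measurable_snd
  set D : Set ℝ≥0∞ := {0, ∞} with hD
  have hDm : MeasurableSet D := (measurableSet_singleton _).insert _
  have hind : Measurable (D.indicator (1 : ℝ≥0∞ → ℝ≥0∞)) := measurable_one.indicator hDm
  have h := hM.setLIntegral_next hf hf1 hα n (φ := fun H x => D.indicator 1 (mixDensity f H x))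
    (hind.comp hmix) (B := Set.univ) (@MeasurableSet.univ _ (historyFiltration hM.measurable_obs n))
  have h0 : ∀ ω, ∫⁻ x, D.indicator (1 : ℝ≥0∞ → ℝ≥0∞)
      (mixDensity f (newtonMeasure f α G₀ (fun i => X i ω) n) x)
      ∂(mixDistrib μ f (newtonMeasure f α G₀ (fun i => X i ω) n)) = 0 := fun ω => by
    have := isFiniteMeasure_newtonMeasure (f := f) (G₀ := G₀) hα (fun i => X i ω) n
    refine lintegral_eq_zero_of_ae_eq_zero ?_
    filter_upwards [ae_mixDistrib (μ := μ)
      (H := newtonMeasure f α G₀ (fun i => X i ω) n) hf hf1] with x hx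
    exact Set.indicator_of_notMem (by simpa [hD] using hx) _
  simp only [h0, lintegral_const, zero_mul, Measure.restrict_univ] at h
  have hm : Measurable fun ω => D.indicator (1 : ℝ≥0∞ → ℝ≥0∞)
      (mixDensity f (newtonMeasure f α G₀ (fun i => X i ω) n) (X (n + 1) ω)) :=
    hind.comp (measurable_mixDensity_measure hf
      ((hM.measurable_newtonMeasure_filtration hf hα n).mono (Filtration.le _ n) le_rfl)
      (fun ω => newtonMeasure_univ_le_one hα _ n) (hM.measurable_obs (n + 1) (by omega)))
  filter_upwards [(lintegral_eq_zero_iff hm).1 h] with ω hω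
  by_contra hc
  have : mixDensity f (newtonMeasure f α G₀ (fun i => X i ω) n) (X (n + 1) ω) ∈ D := by
    simp only [hD, Set.mem_insert_iff, Set.mem_singleton_iff]; tauto
  rw [Set.indicator_of_mem this] at hω
  simp at hω

/-- In Newton's model the recursion is a martingale of random probability measures. -/
lemma isMeasureMartingale : IsMeasureMartingale P (historyFiltration hM.measurable_obs)
    fun n ω => newtonMeasure f α G₀ (fun i => X i ω) n where
  measurable n := hM.measurable_newtonMeasure_filtration hf hα n
  univ_le_one n ω := newtonMeasure_univ_le_one hα _ n
  univ_eq_one := by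
    filter_upwards [ae_all_iff.2 fun n => hM.ae_mixDensity_obs hf hf1 hα n] with ω hω n
    induction n with
    | zero => simp [newtonMeasure]
    | succ n ih =>
      obtain ⟨h0, h1⟩ := hα (n + 1) (by omega)
      simp only [newtonMeasure, Measure.add_apply, Measure.smul_apply, smul_eq_mul]
      rw [ih, bayes_univ_eq_one (hω n).1 (hω n).2, mul_one, mul_one,
        ← ENNReal.ofReal_add (by linarith) h0.le]
      simp
  lintegral_succ n B hB A hA := by
    have hN := (hM.measurable_newtonMeasure_filtration hf hα n).mono (Filtration.le _ n) le_rfl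
    have hb : Measurable fun ω =>
        bayes f (newtonMeasure f α G₀ (fun i => X i ω) n) (X (n + 1) ω) A :=
      (Measure.measurable_coe hA).comp (measurable_bayes hf hN
        (fun ω => newtonMeasure_univ_le_one hα _ n) (hM.measurable_obs (n + 1) (by omega)))
    have hNA : Measurable fun ω => newtonMeasure f α G₀ (fun i => X i ω) n A :=
      (Measure.measurable_coe hA).comp hN
    have h := hM.setLIntegral_next hf hf1 hα n (φ := fun H x => bayes f H x A)
      ((Measure.measurable_coe hA).comp (measurable_bayes hf
        ((measurable_newtonMeasure_pathOf hf hα n).comp measurable_fst)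
        (fun p => newtonMeasure_univ_le_one hα _ n) measurable_snd)) hB
    -- The predictive mean of the update is `G_n(A)`, so the convex combination defining the next
    -- step leaves the mean unchanged.
    simp only [lintegral_bayes_mixDistrib (newtonMeasure_univ_le_one hα _ n) hf hf1 hA] at h
    obtain ⟨h0, h1⟩ := hα (n + 1) (by omega)
    simp only [newtonMeasure, Measure.add_apply, Measure.smul_apply, smul_eq_mul]
    rw [lintegral_add_left (hNA.const_mul _), lintegral_const_mul _ hNA, lintegral_const_mul _ hb, h,
      ← add_mul, ← ENNReal.ofReal_add (by linarith) h0.le]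
    simp

variable [TopologicalSpace Θ] [SecondCountableTopology Θ] [BorelSpace Θ]

lemma exists_isNewtonLimit : ∃ G : Kernel Ω Θ, IsNewtonLimit P f α G₀ X G := by
  have h := hM.isMeasureMartingale hf hf1 hα
  obtain ⟨G, hGm, hG1, hG⟩ := h.exists_limit
  exact ⟨⟨G, hGm.mono (iSup_le fun n => Filtration.le _ n) le_rfl⟩, ⟨hG1⟩,
    h.ae_tendsto_weak hGm hG1 hG⟩

variable [TopologicalSpace.MetrizableSpace Θ] {G : Kernel Ω Θ}
  (hG : IsNewtonLimit P f α G₀ X G)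
include hG

/-- The given limit `G` is not assumed measurable for the observations, but by uniqueness of weak
limits it agrees almost surely with the closing measure constructed above and inherits its
convergence properties. -/
lemma ae_tendsto_lintegral {φ : Θ → ℝ≥0∞} (hφ : Measurable φ) (hfin : ∫⁻ t, φ t ∂G₀ ≠ ∞) :
    ∀ᵐ ω ∂P, Tendsto (fun n => ∫⁻ t, φ t ∂(newtonMeasure f α G₀ (fun i => X i ω) n)) atTop
      (𝓝 (∫⁻ t, φ t ∂(G ω))) := by
  have h := hM.isMeasureMartingale hf hf1 hα
  obtain ⟨G', hGm, hG1, hG'⟩ := h.exists_limit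
  have := hG.isMarkovKernel
  filter_upwards [h.ae_tendsto_lintegral hGm hG' hφ (by simpa [newtonMeasure] using hfin),
    h.ae_tendsto_weak hGm hG1 hG', hG.tendsto] with ω h1 h2 h3
  have : G ω = G' ω := ext_of_forall_integral_eq_of_IsFiniteMeasure fun g =>
    tendsto_nhds_unique (h3 g) (h2 g)
  rwa [this]

lemma ae_tendsto_real {A : Set Θ} (hA : MeasurableSet A) :
    ∀ᵐ ω ∂P, Tendsto (fun n => (newtonMeasure f α G₀ (fun i => X i ω) n).real A) atTop
      (𝓝 ((G ω).real A)) := by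
  have := hG.isMarkovKernel
  filter_upwards [hM.ae_tendsto_lintegral hf hf1 hα hG (φ := A.indicator 1)
    (measurable_one.indicator hA) (by simp [lintegral_indicator_one hA])] with ω hω
  simp only [lintegral_indicator_one hA] at hω
  exact (ENNReal.tendsto_toReal (measure_ne_top _ _)).comp hω

/-- The predictive covariances converge almost surely. -/
lemma ae_tendsto_covMatrix {k : ℕ} {A : Fin k → Set Θ} (hA : ∀ i, MeasurableSet (A i)) :
    ∀ᵐ ω ∂P, ∀ i j, Tendsto
      (fun n => covMatrix μ f A (newtonMeasure f α G₀ (fun i => X i ω) n) i j) atTop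
      (𝓝 (covMatrix μ f A (G ω) i j)) := by
  have hGk := hG.isMarkovKernel
  have hNm : ∀ n, Measurable fun ω => newtonMeasure f α G₀ (fun i => X i ω) n := fun n =>
    (hM.measurable_newtonMeasure_filtration hf hα n).mono (Filtration.le _ n) le_rfl
  have key : ∀ B : Set Θ, MeasurableSet B → ∀ᵐ ω ∂P, ∀ᵐ x ∂μ,
      Tendsto (fun n => ∫⁻ t in B, f x t ∂(newtonMeasure f α G₀ (fun i => X i ω) n)) atTop
        (𝓝 (∫⁻ t in B, f x t ∂(G ω))) := by
    intro B hB
    -- Convergence is available for each fixed `x` with `f_{G_0}(x) < ∞`, outside a null set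
    -- depending on `x`. Joint measurability allows the quantifiers over `x` and `ω` to be
    -- exchanged.
    rw [Measure.ae_ae_comm]
    · filter_upwards [ae_mixDensity_lt_top (H := G₀) hf hf1] with x hx
      have := hM.ae_tendsto_lintegral hf hf1 hα hG (φ := B.indicator fun t => (f x t : ℝ≥0∞))
        ((measurable_density_section hf x).indicator hB) (by
          rw [lintegral_indicator hB]
          exact ((setLIntegral_le_lintegral _ _).trans_lt hx).ne)
      simpa only [lintegral_indicator hB] using this
    · refine measurableSet_tendsto_fun
        (f := fun n (p : Ω × 𝕏) =>
          ∫⁻ t in B, f p.2 t ∂(newtonMeasure f α G₀ (fun i => X i p.1) n))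
        (g := fun p : Ω × 𝕏 => ∫⁻ t in B, f p.2 t ∂(G p.1)) (fun n => ?_) ?_
      · exact measurable_setLIntegral_density hf ((hNm n).comp measurable_fst)
          (fun p => newtonMeasure_univ_le_one hα _ n) measurable_snd hB
      · exact measurable_setLIntegral_density hf (G.measurable.comp measurable_fst)
          (fun p => by
            have := hGk.isProbabilityMeasure p.1
            exact prob_le_one (μ := G p.1)) measurable_snd hB
  filter_upwards [key Set.univ MeasurableSet.univ, ae_all_iff.2 fun i => key (A i) (hA i),
    ae_all_iff.2 fun i => hM.ae_tendsto_real hf hf1 hα hG (hA i),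
    (hM.isMeasureMartingale hf hf1 hα).univ_eq_one] with ω h1 h2 h3 h4 i j
  simp only [Measure.restrict_univ] at h1
  exact tendsto_covMatrix h4 hf hf1 hA h3 h1 (ae_all_iff.2 h2) i j

end IsNewtonModel

end Model

/-! ### Lévy's theorem from a dense set of arguments. -/

section CharFun

variable {E : Type*} [NormedAddCommGroup E] [InnerProductSpace ℝ E] [MeasurableSpace E]
  [BorelSpace E]

/-- The bound `|e^{iu} - 1| ≤ |u|` and Cauchy–Schwarz give a Lipschitz constant equal to the first
moment, hence equicontinuity for families with bounded first moments. -/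
lemma norm_charFun_sub_le [SecondCountableTopology E] {ν : Measure E} [IsFiniteMeasure ν]
    (h : Integrable (fun x => ‖x‖) ν) (s t : E) :
    ‖charFun ν s - charFun ν t‖ ≤ ‖s - t‖ * ∫ x, ‖x‖ ∂ν := by
  have hi : ∀ s : E, Integrable (fun x => Complex.exp (inner ℝ x s * Complex.I)) ν := fun s =>
    Integrable.of_bound (by fun_prop) 1 (ae_of_all _ fun x => by rw [Complex.norm_exp_ofReal_mul_I])
  rw [charFun_apply, charFun_apply, ← integral_sub (hi s) (hi t), ← integral_const_mul]
  refine norm_integral_le_of_norm_le (h.const_mul _) (ae_of_all _ fun x => ?_)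
  have h1 : Complex.exp (inner ℝ x s * Complex.I) - Complex.exp (inner ℝ x t * Complex.I)
      = Complex.exp (inner ℝ x t * Complex.I)
        * (Complex.exp (Complex.I * ((inner ℝ x (s - t) : ℝ) : ℂ)) - 1) := by
    rw [mul_sub, mul_one, ← Complex.exp_add, inner_sub_right]
    congr 2; push_cast; ring
  rw [h1, norm_mul, Complex.norm_exp_ofReal_mul_I, one_mul]
  refine Real.norm_exp_I_mul_ofReal_sub_one_le.trans ?_
  rw [mul_comm]
  exact norm_inner_le_norm x (s - t)

/-- Lévy's convergence theorem for characteristic functions that converge on a dense set, under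
bounded first moments. -/
lemma tendsto_of_tendsto_charFun_of_dense [FiniteDimensional ℝ E] {ν : ℕ → ProbabilityMeasure E}
    {ν₀ : ProbabilityMeasure E} {D : Set E} (hD : Dense D)
    (h : ∀ t ∈ D, Tendsto (fun n => charFun (ν n) t) atTop (𝓝 (charFun ν₀ t))) {L : ℝ}
    (hL : ∀ᶠ n in atTop, Integrable (fun x => ‖x‖) (ν n : Measure E) ∧
      ∫ x, ‖x‖ ∂(ν n : Measure E) ≤ L) :
    Tendsto ν atTop (𝓝 ν₀) := by
  refine ProbabilityMeasure.tendsto_of_tendsto_charFun fun t => ?_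
  rw [Metric.tendsto_atTop']
  intro ε hε
  have hc : Continuous fun s => ‖s - t‖ * L + ‖charFun (ν₀ : Measure E) s - charFun ν₀ t‖ := by
    fun_prop
  -- The point `s` in the dense set is taken so near `t` that the two errors from moving `t` to `s`,
  -- in `ν n` and in `ν₀`, together stay below `ε`.
  obtain ⟨s, hsD, hs⟩ := hD.exists_mem_open (hc.isOpen_preimage _ (isOpen_Iio (a := ε)))
    ⟨t, by simpa using hε⟩
  have h1 : Tendsto (fun n => ‖charFun (ν n : Measure E) s - charFun ν₀ s‖ +
      (‖s - t‖ * L + ‖charFun (ν₀ : Measure E) s - charFun ν₀ t‖)) atTop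
      (𝓝 (0 + (‖s - t‖ * L + ‖charFun (ν₀ : Measure E) s - charFun ν₀ t‖))) :=
    (tendsto_iff_norm_sub_tendsto_zero.1 (h s hsD)).add_const _
  rw [zero_add] at h1
  obtain ⟨N, hN⟩ := eventually_atTop.1 ((h1.eventually_lt_const hs).and hL)
  refine ⟨N, fun n hn => ?_⟩
  obtain ⟨h2, h3, h4⟩ := hN n hn.le
  have h5 := (norm_charFun_sub_le h3 s t).trans
    (mul_le_mul_of_nonneg_left h4 (norm_nonneg _))
  rw [dist_eq_norm]
  have h6 : charFun (ν n : Measure E) t - charFun (ν₀ : Measure E) t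
      = -(charFun (ν n : Measure E) s - charFun (ν n : Measure E) t)
        + ((charFun (ν n : Measure E) s - charFun (ν₀ : Measure E) s)
        + (charFun (ν₀ : Measure E) s - charFun (ν₀ : Measure E) t)) := by ring
  rw [h6]
  refine (norm_add_le _ _).trans_lt ?_
  rw [norm_neg]
  have := norm_add_le (charFun (ν n : Measure E) s - charFun (ν₀ : Measure E) s)
    (charFun (ν₀ : Measure E) s - charFun (ν₀ : Measure E) t)
  linarith

end CharFun

/-! ### Linear combinations as weighted martingales. -/

section Model

variable {𝕏 Θ Ω : Type*} [MeasurableSpace 𝕏] [MeasurableSpace Θ] [MeasurableSpace Ω]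
  [StandardBorelSpace 𝕏] [Nonempty 𝕏] [TopologicalSpace Θ] [TopologicalSpace.MetrizableSpace Θ]
  [SecondCountableTopology Θ] [BorelSpace Θ] [StandardBorelSpace Θ] [Nonempty Θ]
  {P : Measure Ω} [IsProbabilityMeasure P] {μ : Measure 𝕏} [SigmaFinite μ] {f : 𝕏 → Θ → ℝ≥0}
  {α : ℕ → ℝ} {G₀ : Measure Θ} [IsProbabilityMeasure G₀] {X : ℕ → Ω → 𝕏} {θ : ℕ → Ω → Θ}

lemma abs_sum_mul_le {k : ℕ} (t : Fin k → ℝ) {u : Fin k → ℝ} (hu : ∀ i, |u i| ≤ 1) :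
    |∑ i, t i * u i| ≤ ∑ i, |t i| := by
  refine (Finset.abs_sum_le_sum_abs _ _).trans (Finset.sum_le_sum fun i _ => ?_)
  rw [abs_mul]
  exact mul_le_of_le_one_right (abs_nonneg _) (hu i)

omit [MeasurableSpace 𝕏] [StandardBorelSpace 𝕏] [Nonempty 𝕏] [TopologicalSpace Θ]
  [TopologicalSpace.MetrizableSpace Θ] [SecondCountableTopology Θ] [BorelSpace Θ]
  [StandardBorelSpace Θ] [Nonempty Θ] in
lemma newtonMeasure_real_le_one (hα : ∀ n, 1 ≤ n → 0 < α n ∧ α n < 1) (x : ℕ → 𝕏) (n : ℕ)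
    (A : Set Θ) : (newtonMeasure f α G₀ x n).real A ≤ 1 :=
  ENNReal.toReal_le_of_le_ofReal zero_le_one
    (by simpa using (measure_mono (Set.subset_univ _)).trans (newtonMeasure_univ_le_one hα x n))

/-- Linear combinations of `G_n(A_1), …, G_n(A_k)` form a weighted martingale. -/
lemma IsNewtonModel.isWeightedMartingale (hM : IsNewtonModel P μ f α G₀ X θ)
    (hf : Measurable (Function.uncurry f)) (hf1 : ∀ t, ∫⁻ x, (f x t : ℝ≥0∞) ∂μ = 1)
    (hα : ∀ n, 1 ≤ n → 0 < α n ∧ α n < 1) {G : Kernel Ω Θ} (hG : IsNewtonLimit P f α G₀ X G)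
    {k : ℕ} {A : Fin k → Set Θ} (hA : ∀ i, MeasurableSet (A i)) (t : Fin k → ℝ) :
    IsWeightedMartingale P (historyFiltration hM.measurable_obs) α (∑ i, |t i|)
      (fun n ω => ∑ i, t i * (newtonMeasure f α G₀ (fun i => X i ω) n).real (A i))
      (fun n ω => ∑ i, t i *
        ((bayes f (newtonMeasure f α G₀ (fun i => X i ω) (n - 1)) (X n ω)).real (A i)
          - (newtonMeasure f α G₀ (fun i => X i ω) (n - 1)).real (A i)))
      (fun n ω => t ⬝ᵥ
        (covMatrix μ f A (newtonMeasure f α G₀ (fun i => X i ω) n)).mulVec t)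
      (fun ω => ∑ i, t i * (G ω).real (A i))
      (fun ω => t ⬝ᵥ (covMatrix μ f A (G ω)).mulVec t) := by
  have hNF := fun n => hM.measurable_newtonMeasure_filtration hf hα n
  have hNm : ∀ n, Measurable fun ω => newtonMeasure f α G₀ (fun i => X i ω) n := fun n =>
    (hNF n).mono (Filtration.le _ n) le_rfl
  have hN1 := fun n ω => newtonMeasure_univ_le_one (f := f) (G₀ := G₀) hα (fun i => X i ω) n
  have hYb : ∀ (H : Measure Θ), H Set.univ ≤ 1 → ∀ x i,
      |(bayes f H x).real (A i) - H.real (A i)| ≤ 1 := by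
    intro H hH x i
    have h1 : H.real (A i) ≤ 1 := ENNReal.toReal_le_of_le_ofReal zero_le_one
      (by simpa using (measure_mono (Set.subset_univ _)).trans hH)
    have h2 : (bayes f H x).real (A i) ≤ 1 := bayes_real_le_one _ _
    have h3 : 0 ≤ H.real (A i) := measureReal_nonneg
    have h4 : 0 ≤ (bayes f H x).real (A i) := measureReal_nonneg
    rw [abs_le]; constructor <;> linarith
  have hYm : ∀ n, Measurable fun ω => ∑ i, t i *
        ((bayes f (newtonMeasure f α G₀ (fun i => X i ω) n) (X (n + 1) ω)).real (A i)
          - (newtonMeasure f α G₀ (fun i => X i ω) n).real (A i)) := fun n =>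
    Finset.measurable_sum _ fun i _ => ((measurable_bayes_real hf (hNm n) (hN1 n)
      (hM.measurable_obs _ (by omega)) (hA i)).sub
      ((Measure.measurable_coe (hA i)).comp (hNm n)).ennreal_toReal).const_mul _
  have hφ : ∀ n, Measurable fun p : (Fin n → 𝕏) × 𝕏 => ∑ i, t i *
      ((bayes f (newtonMeasure f α G₀ (pathOf p.1) n) p.2).real (A i)
        - (newtonMeasure f α G₀ (pathOf p.1) n).real (A i)) := fun n => by
    have hp : Measurable fun p : (Fin n → 𝕏) × 𝕏 => newtonMeasure f α G₀ (pathOf p.1) n :=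
      (measurable_newtonMeasure_pathOf hf hα n).comp measurable_fst
    exact Finset.measurable_sum _ fun i _ => ((measurable_bayes_real hf hp
      (fun p => newtonMeasure_univ_le_one hα _ n) measurable_snd (hA i)).sub
      ((Measure.measurable_coe (hA i)).comp hp).ennreal_toReal).const_mul _
  have hbY : ∀ n ω, |∑ i, t i *
        ((bayes f (newtonMeasure f α G₀ (fun i => X i ω) n) (X (n + 1) ω)).real (A i)
          - (newtonMeasure f α G₀ (fun i => X i ω) n).real (A i))| ≤ ∑ i, |t i| := fun n ω =>
    abs_sum_mul_le t (hYb _ (hN1 n ω) _)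
  have huniv := (hM.isMeasureMartingale hf hf1 hα).univ_eq_one
  refine ⟨fun n ω => ?_, fun n => ?_, fun n => (hYm n).stronglyMeasurable, fun n => ?_,
    fun n ω => abs_sum_mul_le t fun i => ?_, fun n ω => hbY n ω, fun n ω => ?_, fun n => ?_,
    fun n => ?_, ?_, ?_⟩
  -- The increment indexed by `n` uses the measure at time `n - 1`; it is only evaluated at positive
  -- indices, so truncated subtraction causes no distortion.
  · simp only [Nat.add_sub_cancel]
    rw [Finset.mul_sum, ← Finset.sum_add_distrib]
    refine Finset.sum_congr rfl fun i _ => ?_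
    rw [newtonMeasure_real_succ hα]
    ring
  · exact (Finset.measurable_sum _ fun i _ =>
      ((Measure.measurable_coe (hA i)).comp (hNF n)).ennreal_toReal.const_mul _).stronglyMeasurable
  · have hc := fun i j => @measurable_covMatrix _ _ Ω _ _ (historyFiltration hM.measurable_obs n) μ _ f
      k A hf hf1 hA _ (hNF n) (hN1 n) i j
    refine Measurable.stronglyMeasurable ?_
    simp only [dotProduct, Matrix.mulVec]
    exact Finset.measurable_sum _ fun i _ => (Finset.measurable_sum _ fun j _ =>
      (hc i j).mul_const _).const_mul _
  · rw [abs_of_nonneg measureReal_nonneg]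
    exact newtonMeasure_real_le_one hα _ n _
  -- Covariance entries are at most one in absolute value, so the quadratic form is at most `(∑ |t
  -- i|)²`; the single constant `∑ |t i|` thus serves all three bounds.
  · simp only [dotProduct, Matrix.mulVec]
    refine (Finset.abs_sum_le_sum_abs _ _).trans ?_
    rw [sq, Finset.sum_mul]
    refine Finset.sum_le_sum fun i _ => ?_
    rw [abs_mul]
    refine mul_le_mul_of_nonneg_left ?_ (abs_nonneg _)
    simp_rw [mul_comm _ (t _)]
    exact abs_sum_mul_le t fun j => abs_covMatrix_le (hN1 n ω) hf hf1 i j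
  · refine (hM.condExp_next hf hf1 hα n (φ := fun H x => ∑ i, t i *
      ((bayes f H x).real (A i) - H.real (A i))) (hφ n)
      (Integrable.of_bound (hYm n).aestronglyMeasurable _ (ae_of_all _ (hbY n)))).trans ?_
    filter_upwards [huniv] with ω hω
    have hp : IsProbabilityMeasure (newtonMeasure f α G₀ (fun i => X i ω) n) := ⟨hω n⟩
    set H := newtonMeasure f α G₀ (fun i => X i ω) n
    have hF : IsProbabilityMeasure (mixDistrib μ f H) := ⟨by simp [mixDistrib_univ hf hf1]⟩
    have hi : ∀ i, Integrable (fun x => (bayes f H x).real (A i)) (mixDistrib μ f H) := fun i =>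
      Integrable.of_bound (measurable_bayes_real_right hf (by simp) (hA i)).aestronglyMeasurable 1
        (ae_of_all _ fun x => by
          rw [Real.norm_of_nonneg measureReal_nonneg]; exact bayes_real_le_one _ _)
    rw [integral_finsetSum _ fun i _ => by
      exact ((hi i).sub (integrable_const (H.real (A i)))).const_mul (t i)]
    refine Finset.sum_eq_zero fun i _ => ?_
    rw [integral_const_mul, integral_sub (hi i) (integrable_const _),
      integral_bayes_real hf hf1 (hA i)]
    simp
  · refine (hM.condExp_next hf hf1 hα n (φ := fun H x => (∑ i, t i *
      ((bayes f H x).real (A i) - H.real (A i))) ^ 2) ((hφ n).pow_const 2)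
      (Integrable.of_bound ((hYm n).pow_const 2).aestronglyMeasurable ((∑ i, |t i|) ^ 2)
        (ae_of_all _ fun ω => ?_))).trans ?_
    · rw [Real.norm_eq_abs, abs_pow]
      exact pow_le_pow_left₀ (abs_nonneg _) (hbY n ω) 2
    · filter_upwards [huniv] with ω hω
      have hp : IsProbabilityMeasure (newtonMeasure f α G₀ (fun i => X i ω) n) := ⟨hω n⟩
      rw [covMatrix_quadForm hf hf1 hA]
  · filter_upwards [ae_all_iff.2 fun i => hM.ae_tendsto_real hf hf1 hα hG (hA i)] with ω hω
    exact tendsto_finsetSum _ fun i _ => (hω i).const_mul _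
  · filter_upwards [hM.ae_tendsto_covMatrix hf hf1 hα hG hA] with ω hω
    simp only [dotProduct, Matrix.mulVec]
    exact tendsto_finsetSum _ fun i _ => (tendsto_finsetSum _ fun j _ =>
      (hω i j).mul_const _).const_mul _

end Model

/-! ### Conditional characteristic functions and moments of the scaled error. -/

section Model

variable {𝕏 Θ Ω : Type*} [MeasurableSpace 𝕏] [MeasurableSpace Θ] [MeasurableSpace Ω]
  [StandardBorelSpace 𝕏] [Nonempty 𝕏] [TopologicalSpace Θ] [TopologicalSpace.MetrizableSpace Θ]
  [SecondCountableTopology Θ] [BorelSpace Θ] [StandardBorelSpace Θ] [Nonempty Θ]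
  {P : Measure Ω} [IsProbabilityMeasure P] {μ : Measure 𝕏} [SigmaFinite μ] {f : 𝕏 → Θ → ℝ≥0}
  {α : ℕ → ℝ} {G₀ : Measure Θ} [IsProbabilityMeasure G₀] {X : ℕ → Ω → 𝕏} {θ : ℕ → Ω → Θ}
  {G : Kernel Ω Θ} {k : ℕ} {A : Fin k → Set Θ}

omit [MeasurableSpace 𝕏] [StandardBorelSpace 𝕏] [Nonempty 𝕏] [TopologicalSpace Θ]
  [TopologicalSpace.MetrizableSpace Θ] [SecondCountableTopology Θ] [BorelSpace Θ]
  [StandardBorelSpace Θ] [Nonempty Θ] [IsProbabilityMeasure G₀] in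
lemma inner_scaledError (r : ℕ → ℝ) (n : ℕ) (ω : Ω) (t : EuclideanSpace ℝ (Fin k)) :
    inner ℝ (scaledError f α G₀ X G r A n ω) t = √(r n) * (∑ i, t i * (G ω).real (A i)
      - ∑ i, t i * (newtonMeasure f α G₀ (fun i => X i ω) n).real (A i)) := by
  rw [PiLp.inner_apply, ← Finset.sum_sub_distrib, Finset.mul_sum]
  refine Finset.sum_congr rfl fun i _ => ?_
  simp only [scaledError, RCLike.inner_apply, conj_trivial]
  ring

variable (hM : IsNewtonModel P μ f α G₀ X θ) (hf : Measurable (Function.uncurry f))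
  (hf1 : ∀ t, ∫⁻ x, (f x t : ℝ≥0∞) ∂μ = 1) (hα : ∀ n, 1 ≤ n → 0 < α n ∧ α n < 1)
  (hG : IsNewtonLimit P f α G₀ X G) (hA : ∀ i, MeasurableSet (A i))
include hM hf hα hA

omit [TopologicalSpace Θ] [TopologicalSpace.MetrizableSpace Θ] [SecondCountableTopology Θ]
  [BorelSpace Θ] [SigmaFinite μ] in
lemma IsNewtonModel.measurable_scaledError (r : ℕ → ℝ) (n : ℕ) :
    Measurable (scaledError f α G₀ X G r A n) := by
  have hNm : Measurable fun ω => newtonMeasure f α G₀ (fun i => X i ω) n :=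
    (hM.measurable_newtonMeasure_filtration hf hα n).mono (Filtration.le _ n) le_rfl
  refine (WithLp.measurable_toLp 2 _).comp (measurable_pi_lambda _ fun i => ?_)
  exact (((Measure.measurable_coe (hA i)).comp G.measurable).ennreal_toReal.sub
    ((Measure.measurable_coe (hA i)).comp hNm).ennreal_toReal).const_mul _

include hG hf1

omit hM hf hα hA hf1 [MeasurableSpace 𝕏] [StandardBorelSpace 𝕏] [Nonempty 𝕏]
  [TopologicalSpace.MetrizableSpace Θ] [SecondCountableTopology Θ] [BorelSpace Θ]
  [StandardBorelSpace Θ] [Nonempty Θ] [IsProbabilityMeasure P] in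
lemma abs_scaledError_le (hα : ∀ n, 1 ≤ n → 0 < α n ∧ α n < 1) (r : ℕ → ℝ) (n : ℕ) (ω : Ω)
    (i : Fin k) : |scaledError f α G₀ X G r A n ω i| ≤ √(r n) := by
  have hGk := hG.isMarkovKernel
  have h1 := newtonMeasure_real_le_one (f := f) (G₀ := G₀) hα (fun i => X i ω) n (A i)
  have h2 : (G ω).real (A i) ≤ 1 := measureReal_le_one
  have h3 : 0 ≤ (newtonMeasure f α G₀ (fun i => X i ω) n).real (A i) := measureReal_nonneg
  have h4 : 0 ≤ (G ω).real (A i) := measureReal_nonneg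
  simp only [scaledError]
  rw [abs_mul, abs_of_nonneg (Real.sqrt_nonneg _)]
  refine mul_le_of_le_one_right (Real.sqrt_nonneg _) ?_
  rw [abs_le]; constructor <;> linarith

/-- The characteristic functions of the conditional laws converge. -/
lemma IsNewtonModel.ae_tendsto_charFun_condLaw (hsum : Summable fun n => α n ^ 2) {r b : ℕ → ℝ}
    (hb : ∀ᶠ n in atTop, ∀ j, |α (n + j + 1)| ≤ b n) (hr0 : ∀ᶠ n in atTop, 0 ≤ r n)
    (hr : Tendsto (fun n => r n * sqTail α n) atTop (𝓝 1))
    (hrb : Tendsto (fun n => √(r n) * b n) atTop (𝓝 0)) (t : EuclideanSpace ℝ (Fin k)) :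
    ∀ᵐ ω ∂P, Tendsto
      (fun n => charFun (condLaw P (scaledError f α G₀ X G r A n) (history X n) ω :
        Measure (EuclideanSpace ℝ (Fin k))) t) atTop
      (𝓝 (charFun (gaussianLaw (covMatrix μ f A (G ω)) :
        Measure (EuclideanSpace ℝ (Fin k))) t)) := by
  have hGk := hG.isMarkovKernel
  have h1 : ∀ n, P[fun ω => Complex.exp (inner ℝ (scaledError f α G₀ X G r A n ω) t * Complex.I) |
      historyFiltration hM.measurable_obs n] =ᵐ[P] fun ω => charFun (condLaw P
        (scaledError f α G₀ X G r A n) (history X n) ω : Measure (EuclideanSpace ℝ (Fin k))) t := by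
    intro n
    have hV := hM.measurable_scaledError (G := G) hf hα hA r n
    have hm : Measurable fun x : EuclideanSpace ℝ (Fin k) =>
      Complex.exp (inner ℝ x t * Complex.I) := by fun_prop
    have h := condExp_ae_eq_integral_condDistrib (μ := P)
      (measurable_history hM.measurable_obs n) hV.aemeasurable hm.stronglyMeasurable
      (Integrable.of_bound (hm.comp hV).aestronglyMeasurable 1 (ae_of_all _ fun ω => by
        rw [Complex.norm_exp_ofReal_mul_I]))
    exact h.trans (ae_of_all _ fun ω => (charFun_apply t).symm)
  filter_upwards [ae_all_iff.2 h1, (hM.isWeightedMartingale hf hf1 hα hG hA t).tendsto_condExp_charFun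
    hsum hb hr0 hr hrb] with ω h1 h2
  -- Positive semidefiniteness is enough here, so degenerate limits need no separate treatment.
  have h3 := charFun_multivariateGaussian (μ := 0)
    (posSemidef_covMatrix (H := G ω) (A := A) hf hf1 hA) t
  simp only [gaussianLaw, ProbabilityMeasure.coe_mk]
  rw [h3]
  have h4 : Complex.exp (inner ℝ t (0 : EuclideanSpace ℝ (Fin k)) * Complex.I
      - ((t : Fin k → ℝ) ⬝ᵥ (covMatrix μ f A (G ω)).mulVec t : ℝ) / 2)
      = (Real.exp (-((t : Fin k → ℝ) ⬝ᵥ (covMatrix μ f A (G ω)).mulVec t / 2)) : ℂ) := by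
    rw [inner_zero_right]
    push_cast
    simp
  rw [h4]
  refine h2.congr fun n => ?_
  rw [← h1 n]
  simp_rw [inner_scaledError, mul_comm Complex.I]

/-- The conditional laws have bounded first moments. -/
lemma IsNewtonModel.ae_integral_norm_condLaw_le (hsum : Summable fun n => α n ^ 2) {r : ℕ → ℝ}
    (hr0 : ∀ᶠ n in atTop, 0 ≤ r n) (hr : Tendsto (fun n => r n * sqTail α n) atTop (𝓝 1)) :
    ∀ᵐ ω ∂P, ∀ᶠ n in atTop,
      Integrable (fun x => ‖x‖) (condLaw P (scaledError f α G₀ X G r A n) (history X n) ω :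
        Measure (EuclideanSpace ℝ (Fin k))) ∧
      ∫ x, ‖x‖ ∂(condLaw P (scaledError f α G₀ X G r A n) (history X n) ω :
        Measure (EuclideanSpace ℝ (Fin k))) ≤ 1 + k * 2 := by
  have hm : ∀ i, Measurable fun x : EuclideanSpace ℝ (Fin k) => x i ^ 2 := fun i => by fun_prop
  have hVi : ∀ n i, Integrable (fun ω => scaledError f α G₀ X G r A n ω i ^ 2) P := fun n i =>
    Integrable.of_bound ((hm i).comp (hM.measurable_scaledError hf hα hA r n)).aestronglyMeasurable
      (√(r n) ^ 2) (ae_of_all _ fun ω => by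
        rw [Real.norm_eq_abs, abs_pow]
        exact pow_le_pow_left₀ (abs_nonneg _) (abs_scaledError_le hG hα r n ω i) 2)
  have h1 : ∀ n i, P[fun ω => scaledError f α G₀ X G r A n ω i ^ 2 |
      historyFiltration hM.measurable_obs n] =ᵐ[P] fun ω => ∫ x : EuclideanSpace ℝ (Fin k), x i ^ 2
        ∂(condLaw P (scaledError f α G₀ X G r A n) (history X n) ω) := fun n i =>
    condExp_ae_eq_integral_condDistrib (μ := P) (measurable_history hM.measurable_obs n)
      (hM.measurable_scaledError hf hα hA r n).aemeasurable (hm i).stronglyMeasurable (hVi n i)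
  have h2 : ∀ n i, ∀ᵐ ω ∂P, Integrable (fun x : EuclideanSpace ℝ (Fin k) => x i ^ 2)
      (condLaw P (scaledError f α G₀ X G r A n) (history X n) ω :
        Measure (EuclideanSpace ℝ (Fin k))) := fun n i => by
    have hV := hM.measurable_scaledError (G := G) hf hα hA r n
    have hh := measurable_history hM.measurable_obs n
    exact Integrable.condDistrib_ae (f := fun p : (Fin n → 𝕏) × EuclideanSpace ℝ (Fin k) => p.2 i ^ 2)
      hh.aemeasurable hV.aemeasurable ((integrable_map_measure
        ((hm i).comp measurable_snd).aestronglyMeasurable (hh.prodMk hV).aemeasurable).2 (hVi n i))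
  have h3 : ∀ n i, 0 ≤ r n → ∀ᵐ ω ∂P, P[fun ω => scaledError f α G₀ X G r A n ω i ^ 2 |
      historyFiltration hM.measurable_obs n] ω ≤ r n * sqTail α n := fun n i hn => by
    have e : (fun ω => scaledError f α G₀ X G r A n ω i ^ 2)
        = r n • fun ω => ((G ω).real (A i)
          - (newtonMeasure f α G₀ (fun i => X i ω) n).real (A i)) ^ 2 := by
      ext ω
      simp only [scaledError, Pi.smul_apply, smul_eq_mul, mul_pow, Real.sq_sqrt hn]
    -- A coordinate vector isolates `G(A_i) - G_n(A_i)`, with martingale bound `K = 1`.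
    have hw := (hM.isWeightedMartingale hf hf1 hα hG hA (Pi.single i 1)).condExp_sq_le hsum n
    have hs : ∑ j, |(Pi.single i 1 : Fin k → ℝ) j| = 1 := by
      rw [Finset.sum_eq_single i] <;> simp +contextual
    rw [hs] at hw
    simp only [Pi.single_apply, ite_mul, one_mul, zero_mul, Finset.sum_ite_eq',
      Finset.mem_univ, if_true, one_pow] at hw
    rw [e]
    filter_upwards [hw, condExp_smul (μ := P) (r n) (fun ω => ((G ω).real (A i)
          - (newtonMeasure f α G₀ (fun i => X i ω) n).real (A i)) ^ 2)
          (historyFiltration hM.measurable_obs n)] with ω hω1 hω2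
    rw [hω2]
    exact mul_le_mul_of_nonneg_left hω1 hn
  have h3' : ∀ᵐ ω ∂P, ∀ n i, 0 ≤ r n → P[fun ω => scaledError f α G₀ X G r A n ω i ^ 2 |
      historyFiltration hM.measurable_obs n] ω ≤ r n * sqTail α n :=
    ae_all_iff.2 fun n => ae_all_iff.2 fun i => by
      by_cases hn : 0 ≤ r n
      · simpa [hn] using h3 n i hn
      · simp [hn]
  filter_upwards [ae_all_iff.2 fun n => ae_all_iff.2 (h1 n),
    ae_all_iff.2 fun n => ae_all_iff.2 (h2 n), h3'] with ω h1 h2 h3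
  filter_upwards [hr0, hr.eventually_le_const (show (1 : ℝ) < 2 by norm_num)] with n hn1 hn2
  set ν : Measure (EuclideanSpace ℝ (Fin k)) :=
    (condLaw P (scaledError f α G₀ X G r A n) (history X n) ω :
      Measure (EuclideanSpace ℝ (Fin k)))
  have hi : Integrable (fun x : EuclideanSpace ℝ (Fin k) => 1 + ∑ i, x i ^ 2) ν :=
    (integrable_const _).add (integrable_finsetSum _ fun i _ => h2 n i)
  -- This reduces the first moment to `k` second moments, each eventually at most `2` because `r n *
  -- sqTail α n → 1`; whence the constant `1 + k * 2`.
  have hle : ∀ x : EuclideanSpace ℝ (Fin k), ‖x‖ ≤ 1 + ∑ i, x i ^ 2 := fun x => by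
    rw [← EuclideanSpace.real_norm_sq_eq]
    nlinarith [sq_nonneg (‖x‖ - 1), norm_nonneg x]
  have hn : Integrable (fun x : EuclideanSpace ℝ (Fin k) => ‖x‖) ν :=
    hi.mono' (by fun_prop) (ae_of_all _ fun x => by rw [norm_norm]; exact hle x)
  refine ⟨hn, (integral_mono hn hi hle).trans ?_⟩
  rw [integral_add (integrable_const _) (integrable_finsetSum _ fun i _ => h2 n i),
    integral_finsetSum _ fun i _ => h2 n i]
  simp only [integral_const, probReal_univ, smul_eq_mul, mul_one]
  gcongr
  have : ∀ i ∈ Finset.univ, ∫ x : EuclideanSpace ℝ (Fin k), x i ^ 2 ∂ν ≤ 2 := fun i _ => by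
    have := h3 n i hn1
    rw [h1 n i] at this
    exact this.trans hn2
  simpa using Finset.sum_le_card_nsmul _ _ _ this

omit hA in
/-- The central limit theorem for Newton's recursion under conditions on the weights. -/
theorem IsNewtonModel.jointGaussianLimit (hsum : Summable fun n => α n ^ 2) {r b : ℕ → ℝ}
    (hb : ∀ᶠ n in atTop, ∀ j, |α (n + j + 1)| ≤ b n) (hr0 : ∀ᶠ n in atTop, 0 ≤ r n)
    (hr : Tendsto (fun n => r n * sqTail α n) atTop (𝓝 1))
    (hrb : Tendsto (fun n => √(r n) * b n) atTop (𝓝 0)) :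
    JointGaussianLimit P μ f α G₀ X G r := by
  intro k A _ hA
  have hD := TopologicalSpace.exists_countable_dense (EuclideanSpace ℝ (Fin k))
  obtain ⟨D, hDc, hD⟩ := hD
  -- Restricting to a countable dense set of arguments leaves a single exceptional null set.
  filter_upwards [(ae_ball_iff hDc).2 fun t _ =>
    hM.ae_tendsto_charFun_condLaw hf hf1 hα hG hA hsum hb hr0 hr hrb t,
    hM.ae_integral_norm_condLaw_le hf hf1 hα hG hA hsum hr0 hr] with ω h1 h2
  exact tendsto_of_tendsto_charFun_of_dense hD h1 h2

end Model

/-! ### Asymptotics for polynomially decaying weights. -/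

section PolynomialWeights

/-- The convex function `y ↦ y ^ (-s)` lies above its tangent at `x`; this follows from `e^u ≥ 1 +
u` and `log z ≤ z - 1`. -/
lemma rpow_neg_sub_le {x y s : ℝ} (hx : 0 < x) (hy : 0 < y) (hs : 0 ≤ s) :
    x ^ (-s) - s * x ^ (-s - 1) * (y - x) ≤ y ^ (-s) := by
  have h1 : y ^ (-s) = x ^ (-s) * Real.exp (-s * Real.log (y / x)) := by
    rw [Real.rpow_def_of_pos hy, Real.rpow_def_of_pos hx, ← Real.exp_add,
      Real.log_div hy.ne' hx.ne']
    congr 1; ring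
  have h2 := Real.add_one_le_exp (-s * Real.log (y / x))
  have h3 := mul_le_mul_of_nonneg_left (Real.log_le_sub_one_of_pos (div_pos hy hx)) hs
  have h4 : x ^ (-s) - s * x ^ (-s - 1) * (y - x) = x ^ (-s) * (1 - s * (y / x - 1)) := by
    rw [Real.rpow_sub_one hx.ne']
    field_simp
  rw [h1, h4]
  exact mul_le_mul_of_nonneg_left (by linarith) (Real.rpow_nonneg hx.le _)

lemma hasSum_sub_of_antitone {u : ℕ → ℝ} (hu : Antitone u) (hu0 : Tendsto u atTop (𝓝 0)) :
    HasSum (fun j => u j - u (j + 1)) (u 0) := by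
  rw [hasSum_iff_tendsto_nat_of_nonneg fun j => sub_nonneg.2 (hu j.le_succ)]
  simp_rw [Finset.sum_range_sub']
  simpa using hu0.const_sub (u 0)

lemma hasSum_rpow_neg_sub {c s : ℝ} (hc : 0 < c) (hs : 0 < s) :
    HasSum (fun j : ℕ => (c + j) ^ (-s) - (c + (j + 1)) ^ (-s)) (c ^ (-s)) := by
  have h := hasSum_sub_of_antitone (u := fun j : ℕ => (c + j) ^ (-s))
    (fun i j hij => Real.rpow_le_rpow_of_nonpos (by positivity) (by gcongr) (by linarith))
    ((tendsto_rpow_neg_atTop hs).comp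
      (tendsto_atTop_add_const_left _ _ tendsto_natCast_atTop_atTop))
  simpa using h

/-- Bounds for the tails of `∑ (c + j) ^ (-s - 1)`. -/
lemma summable_rpow_and_tsum_bounds {c s : ℝ} (hc : 0 < c) (hs : 0 < s) :
    Summable (fun j : ℕ => (c + (j + 1)) ^ (-s - 1)) ∧
      (c + 1) ^ (-s) ≤ s * ∑' j : ℕ, (c + (j + 1)) ^ (-s - 1) ∧
      s * ∑' j : ℕ, (c + (j + 1)) ^ (-s - 1) ≤ c ^ (-s) := by
  -- The tangent inequality applied to the left and to the right traps each summand between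
  -- consecutive differences of `x ^ (-s)`, so both bounds telescope.
  have hup : ∀ j : ℕ, s * (c + (j + 1)) ^ (-s - 1) ≤ (c + j) ^ (-s) - (c + (j + 1)) ^ (-s) :=
    fun j => by
      have := rpow_neg_sub_le (x := c + (j + 1)) (y := c + j) (by positivity) (by positivity) hs.le
      rw [show c + (j : ℝ) - (c + (j + 1)) = -1 by ring] at this
      linarith
  have hlo : ∀ j : ℕ, (c + 1 + j) ^ (-s) - (c + 1 + (j + 1)) ^ (-s)
      ≤ s * (c + (j + 1)) ^ (-s - 1) := fun j => by
    have := rpow_neg_sub_le (x := c + 1 + j) (y := c + 1 + (j + 1)) (by positivity) (by positivity)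
      hs.le
    rw [show c + 1 + ((j : ℝ) + 1) - (c + 1 + j) = 1 by ring] at this
    rw [show c + ((j : ℝ) + 1) = c + 1 + j by ring]
    linarith
  have h1 := hasSum_rpow_neg_sub hc hs
  have h2 := hasSum_rpow_neg_sub (c := c + 1) (by positivity) hs
  have hS : Summable fun j : ℕ => s * (c + (j + 1)) ^ (-s - 1) :=
    Summable.of_nonneg_of_le (fun j => by positivity) hup h1.summable
  refine ⟨(summable_mul_left_iff hs.ne').1 hS, ?_, ?_⟩
  · rw [← tsum_mul_left, ← h2.tsum_eq]
    exact h2.summable.tsum_le_tsum hlo hS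
  · rw [← tsum_mul_left, ← h1.tsum_eq]
    exact hS.tsum_le_tsum hup h1.summable

lemma tendsto_div_add_rpow (c s : ℝ) (hs : 0 < s) :
    Tendsto (fun n : ℕ => (n : ℝ) ^ s * (c + n) ^ (-s)) atTop (𝓝 1) := by
  have h1 : Tendsto (fun n : ℕ => ((n : ℝ) / (n + c)) ^ s) atTop (𝓝 1) := by
    have h := (tendsto_natCast_div_add_atTop (𝕜 := ℝ) c).rpow_const (p := s) (Or.inr hs.le)
    simpa using h
  refine h1.congr' ?_
  filter_upwards [tendsto_natCast_atTop_atTop.eventually_gt_atTop (-c)] with n hn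
  have hn' : 0 < (n : ℝ) + c := by linarith
  rw [add_comm c, Real.rpow_neg hn'.le, Real.div_rpow (Nat.cast_nonneg n) hn'.le, div_eq_mul_inv]

variable {α : ℕ → ℝ} {a β : ℝ} (ha : 0 < a) (hβ : 1 / 2 < β)
  (hα : ∀ n : ℕ, 1 ≤ n → α n = (a + n) ^ (-β))
include ha hα

lemma sq_weight_eq (n j : ℕ) :
    α (n + 1 + j) ^ 2 = (a + n + (j + 1)) ^ (-(2 * β - 1) - 1) := by
  rw [hα _ (by omega), ← Real.rpow_natCast, ← Real.rpow_mul (by positivity)]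
  congr 1
  · push_cast; ring
  · push_cast; ring

include hβ

lemma summable_sq_weight : Summable fun n => α n ^ 2 := by
  have h := (summable_rpow_and_tsum_bounds (c := a) ha (s := 2 * β - 1) (by linarith)).1
  rw [← summable_nat_add_iff 1]
  refine h.congr fun j => ?_
  have := sq_weight_eq ha hα 0 j
  rw [zero_add, add_comm] at this
  simp [this]

lemma tendsto_mul_sqTail_weight :
    Tendsto (fun n : ℕ => (2 * β - 1) * (n : ℝ) ^ (2 * β - 1) * sqTail α n) atTop (𝓝 1) := by
  have hs : 0 < 2 * β - 1 := by linarith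
  have h := fun n : ℕ => (summable_rpow_and_tsum_bounds (c := a + n) (by positivity) hs).2
  have hT : ∀ n : ℕ, sqTail α n = ∑' j : ℕ, (a + n + (j + 1)) ^ (-(2 * β - 1) - 1) := fun n =>
    tsum_congr fun j => sq_weight_eq ha hα n j
  -- With `s = 2β - 1`, the telescoping bounds place `s` times the tail between `(a + n + 1) ^ (-s)`
  -- and `(a + n) ^ (-s)`.
  refine tendsto_of_tendsto_of_tendsto_of_le_of_le (tendsto_div_add_rpow (a + 1) _ hs)
    (tendsto_div_add_rpow a _ hs) (fun n => ?_) fun n => ?_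
  · have := mul_le_mul_of_nonneg_left (h n).1 (Real.rpow_nonneg (Nat.cast_nonneg n) (2 * β - 1))
    simp only [hT]
    rw [show a + 1 + (n : ℝ) = a + n + 1 by ring]
    linarith
  · have := mul_le_mul_of_nonneg_left (h n).2 (Real.rpow_nonneg (Nat.cast_nonneg n) (2 * β - 1))
    simp only [hT]
    linarith

omit hα in
lemma tendsto_sqrt_mul_weight :
    Tendsto (fun n : ℕ => √((2 * β - 1) * (n : ℝ) ^ (2 * β - 1)) * (a + n) ^ (-β)) atTop
      (𝓝 0) := by
  have hs : 0 < 2 * β - 1 := by linarith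
  have h0 : Tendsto (fun n : ℕ => a + (n : ℝ)) atTop atTop :=
    tendsto_atTop_add_const_left _ _ tendsto_natCast_atTop_atTop
  have h1 : Tendsto (fun n : ℕ => √((2 * β - 1) *
      (((n : ℝ) ^ (2 * β - 1) * (a + n) ^ (-(2 * β - 1))) * (a + n)⁻¹))) atTop (𝓝 0) := by
    have := (((tendsto_div_add_rpow a _ hs).mul (tendsto_inv_atTop_zero.comp h0)).const_mul
      (2 * β - 1)).sqrt
    simpa using this
  -- Squaring turns the product into `(2β - 1) n^(2β-1) (a + n)^(-2β)`, a bounded factor times `(a +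
  -- n)⁻¹`.
  refine h1.congr fun n => ?_
  have hp : 0 < a + (n : ℝ) := by positivity
  rw [← Real.sqrt_sq (Real.rpow_nonneg hp.le (-β)), ← Real.sqrt_mul (by positivity)]
  congr 1
  rw [← Real.rpow_natCast, ← Real.rpow_mul hp.le, mul_assoc, mul_assoc, ← Real.rpow_neg_one,
    ← Real.rpow_add hp]
  congr 3
  push_cast; ring

end PolynomialWeights

/-! ### General weights. -/

section GeneralWeights

variable {α r : ℕ → ℝ} (hα : ∀ n, 1 ≤ n → 0 < α n ∧ α n < 1)
include hα

lemma sqTail_pos (hsum : Summable fun n => α n ^ 2) (n : ℕ) : 0 < sqTail α n := by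
  have h := hasSum_sqTail hsum n
  rw [← h.tsum_eq]
  exact h.summable.tsum_pos (fun j => sq_nonneg _) 0 (pow_pos (hα _ (by omega)).1 2)

lemma tendsto_mul_sqTail_of_isEquivalent (hsum : Summable fun n => α n ^ 2)
    (hr : r ~[atTop] fun n => (sqTail α n)⁻¹) :
    Tendsto (fun n => r n * sqTail α n) atTop (𝓝 1) := by
  have h := (Asymptotics.isEquivalent_iff_tendsto_one
    (Eventually.of_forall fun n => (inv_pos.2 (sqTail_pos hα hsum n)).ne')).1 hr
  refine h.congr fun n => ?_
  simp

lemma abs_weight_le_iSup (n j : ℕ) : |α (n + j + 1)| ≤ ⨆ k : Set.Ici n, α k := by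
  rw [abs_of_pos (hα _ (by omega)).1]
  -- The supremum must be over a bounded family; `α 0` is unconstrained and occurs when `n = 0`,
  -- hence the bound `max 1 (α 0)`.
  refine le_ciSup (f := fun k : Set.Ici n => α k) ⟨max 1 (α 0), ?_⟩
    ⟨n + j + 1, Set.mem_Ici.2 (by omega)⟩
  rintro _ ⟨⟨k, hk⟩, rfl⟩
  rcases Nat.eq_zero_or_pos k with rfl | hk
  · exact le_max_right _ _
  · exact (hα k hk).2.le.trans (le_max_left _ _)

end GeneralWeights

end NewtonMixture

/-! ### The main theorem. -/

theorem mainTheorem7 {𝕏 Θ Ω : Type*}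
    [MeasurableSpace 𝕏] [StandardBorelSpace 𝕏] [Nonempty 𝕏]
    [TopologicalSpace Θ] [TopologicalSpace.MetrizableSpace Θ] [SecondCountableTopology Θ]
    [MeasurableSpace Θ] [BorelSpace Θ] [StandardBorelSpace Θ] [Nonempty Θ]
    [MeasurableSpace Ω] (P : Measure Ω) [IsProbabilityMeasure P]
    (μ : Measure 𝕏) [SigmaFinite μ]
    (f : 𝕏 → Θ → ℝ≥0) (hf : Measurable (Function.uncurry f))
    (hf_density : ∀ t, ∫⁻ x, (f x t : ℝ≥0∞) ∂μ = 1)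
    (G₀ : Measure Θ) [IsProbabilityMeasure G₀]
    (α : ℕ → ℝ) (hα : ∀ n, 1 ≤ n → 0 < α n ∧ α n < 1)
    (X : ℕ → Ω → 𝕏) (θ : ℕ → Ω → Θ)
    (hmodel : NewtonMixture.IsNewtonModel P μ f α G₀ X θ) :
    (∃ G : Kernel Ω Θ, NewtonMixture.IsNewtonLimit P f α G₀ X G) ∧
    ∀ G : Kernel Ω Θ, NewtonMixture.IsNewtonLimit P f α G₀ X G →
      (∀ r : ℕ → ℝ,
        (¬ Summable α) → (Summable fun n => α n ^ 2) →
        (∀ n, 1 ≤ n → 0 < r n) → (MonotoneOn r (Set.Ici 1) ∨ AntitoneOn r (Set.Ici 1)) →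
        (r ~[atTop] fun n => (∑' j, α (n + 1 + j) ^ 2)⁻¹) →
        Tendsto (fun n => √(r n) * ⨆ k : Set.Ici n, α k) atTop (𝓝 0) →
        (Summable fun k => r k ^ 2 * α (k + 1) ^ 4) →
        NewtonMixture.JointGaussianLimit P μ f α G₀ X G r) ∧
      (∀ a β : ℝ, 0 < a → 1 / 2 < β → β ≤ 1 →
        (∀ n : ℕ, 1 ≤ n → α n = (a + n) ^ (-β)) →
        NewtonMixture.JointGaussianLimit P μ f α G₀ X G
          (fun n => (2 * β - 1) * (n : ℝ) ^ (2 * β - 1))) := by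
  refine ⟨hmodel.exists_isNewtonLimit hf hf_density hα, fun G hG => ⟨?_, ?_⟩⟩
  · intro r _ hsum hr0 _ hr hrb _
    exact hmodel.jointGaussianLimit hf hf_density hα hG hsum
      (Eventually.of_forall (NewtonMixture.abs_weight_le_iSup hα))
      ((eventually_ge_atTop 1).mono fun n hn => (hr0 n hn).le)
      (NewtonMixture.tendsto_mul_sqTail_of_isEquivalent hα hsum hr) hrb
  · intro a β ha hβ _ hαβ
    -- The weights decrease, so the explicit value `(a + n) ^ (-β)` dominates all those after time
    -- `n` and can replace the supremum.
    refine hmodel.jointGaussianLimit (b := fun n : ℕ => (a + n) ^ (-β)) hf hf_density hα hG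
      (NewtonMixture.summable_sq_weight ha hβ hαβ) (Eventually.of_forall fun n j => ?_)
      (Eventually.of_forall fun n => mul_nonneg (by linarith) (by positivity))
      (NewtonMixture.tendsto_mul_sqTail_weight ha hβ hαβ)
      (NewtonMixture.tendsto_sqrt_mul_weight ha hβ)
    rw [hαβ _ (by omega), abs_of_nonneg (by positivity)]
    refine Real.rpow_le_rpow_of_nonpos (by positivity) ?_ (by linarith)
    push_cast
    linarith [(Nat.cast_nonneg j : (0 : ℝ) ≤ j)]
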